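/- **Setting.** Fix a local dimension $d\ge 2$. For $p\in[0,1]$ let $\rho(p)=p\,|\phi^+\rangle\langle\phi^+|+\frac{1-p}{d^2}\mathbb 1$ on $\mathbb C^d\otimes\mathbb C^d$, where $|\phi^+\rangle=\frac1{\sqrt d}\sum_{i=1}^d|ii\rangle$, be the isotropic state of visibility $p$. For a finite simple graph $G=(V,E)$ the isotropic network state is $\sigma(G,p)=\bigotimes_{e\in E}\rho_e(p)$: for every edge $e=\{u,v\}$ the parties $u$ and $v$ share a copy of $\rho(p)$, so that party $v$ holds one system $\mathbb C^d$ for each edge at $v$. A graph sequence $(G_n)$, $G_n=(V_n,E_n)$, consists of finite connected simple graphs with $V_n\subset V_{n+1}$ and $|G_n|=|V_n|\to\infty$. It has *partial distillability* (for $d$) if there is $p_0<1$ such that for every finite set of parties $V_0\subset\bigcup_nV_n$ and every pure state $\psi$ of $(\mathbb C^d)^{\otimes V_0}$ there are maps $\Lambda_{n,p}$, for $p\in[0,1]$ and all $n$ with $V_0\subset V_n$, each implementable by local operations and finitely many rounds of classical communication among the parties $V_n$, that take states of the network $G_n$ to states of $(\mathbb C^d)^{\otimes V_0}$ (one factor held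 by each party of $V_0$, the other parties keeping nothing), with $$\lim_{n\to\infty}F\big(\Lambda_{n,p}(\sigma(G_n,p)),\psi\big)=1\quad\text{for all }p\in(p_0,1],\qquad F(\rho,\sigma)=\Big(\operatorname{tr}\sqrt{\sqrt\rho\,\sigma\sqrt\rho}\Big)^2 .$$ **Theorem.** For every $\alpha\in(0,1)$ there is an integer $k\ge1$ such that the sequence $(G_n)_{n\ge1}$ of graphs on $V_n=[n]^k$, in which two vertices are adjacent if and only if they differ in exactly one coordinate, has the following properties. 1. The maximum degree $\delta_{\max}(G_n)$ is $O(|G_n|^\alpha)$ as $n\to\infty$. 2. $(G_n)_{n\ge1}$ has partial distillability, for every local dimension $d\ge2$. 3. For all $n\ge 1$, all $V_0\subset V_n$ with $|V_0|\ge2$ and all $v_0\in V_0$, the graph $G_n$ contains at least $$\Big(\Big\lfloor\frac{n-1}{|V_0|-1}\Big\rfloor-1\Big)k$$ pairwise edge-disjoint spiders with centre $v_0$, each with exactly $|V_0|-1$ legs, one ending at each vertex of $V_0\setminus\{v_0\}$, and all legs of length at most $k+1$. (A spider with centre $v_0$ is a union of simple paths, its legs, that start at $v_0$ and have pairwise no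 other vertex in common.) -/

import Mathlib

open Filter Topology Asymptotics
open scoped MatrixOrder ComplexOrder

noncomputable section

/-! ## Multipartite systems, fidelity and LOCC

A system of parties `P` in which party `v` holds a Hilbert space with orthonormal basis `H v` has
total Hilbert space with basis `∀ v, H v`. Operators are matrices in this product basis. -/

/-- Operators on the tensor product of the local spaces with bases `H v`. -/
abbrev MultiOp {P : Type} (H : P → Type) : Type := Matrix (∀ v, H v) (∀ v, H v) ℂ

/-- The tensor product `⨂ v, A v` of local operators `A v`. -/
def localTensor {P : Type} [Fintype P] {H K : P → Type} (A : ∀ v, Matrix (K v) (H v) ℂ) :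
    Matrix (∀ v, K v) (∀ v, H v) ℂ :=
  Matrix.of fun x y => ∏ v, A v (x v) (y v)

/-- The pure state `|ψ⟩⟨ψ|`. -/
def pureState {X : Type} (ψ : X → ℂ) : Matrix X X ℂ := Matrix.vecMulVec ψ (star ψ)

/-- The fidelity `F(ρ, σ) = (tr √(√ρ σ √ρ))²`. -/
def fidelity {X : Type} [Fintype X] [DecidableEq X] (ρ σ : Matrix X X ℂ) : ℝ :=
  (CFC.sqrt (CFC.sqrt ρ * σ * CFC.sqrt ρ)).trace.re ^ 2

/-- Maps implementable by local operations and finitely many rounds of classical communication.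
A protocol is a finite tree. At a leaf (`done`) every party applies a local isometry. In a `round`
one party `v` performs a local measurement with Kraus operators `A i v` (complete:
`∑ i, (A i v)ᴴ (A i v) = 1`) and announces the outcome `i` to everybody, every other party `u`
applies a local isometry `A i u` that may depend on `i`, and the parties go on with an LOCC
protocol `Λ i` that may depend on `i`. Averaging over the outcomes gives the map. Discarding
information (in particular partial traces and arbitrary local channels) is the case in which the
continuation ignores the outcome. -/
inductive IsLOCC {P : Type} [Fintype P] [DecidableEq P] {K : P → Type}
    [∀ v, Fintype (K v)] [∀ v, DecidableEq (K v)] :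
    ∀ {H : P → Type} [∀ v, Fintype (H v)] [∀ v, DecidableEq (H v)],
      (MultiOp H → MultiOp K) → Prop
  | done {H : P → Type} [∀ v, Fintype (H v)] [∀ v, DecidableEq (H v)]
      (U : ∀ v, Matrix (K v) (H v) ℂ) (hU : ∀ v, (U v).conjTranspose * U v = 1)
      (Λ : MultiOp H → MultiOp K)
      (hΛ : ∀ ρ, Λ ρ = localTensor U * ρ * (localTensor U).conjTranspose) :
      IsLOCC Λ
  | round {H : P → Type} [∀ v, Fintype (H v)] [∀ v, DecidableEq (H v)]
      {ι : Type} [Fintype ι] {H' : ι → P → Type}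
      [∀ i v, Fintype (H' i v)] [∀ i v, DecidableEq (H' i v)]
      (v : P) (A : ∀ i u, Matrix (H' i u) (H u) ℂ)
      (hv : ∑ i, (A i v).conjTranspose * A i v = 1)
      (hA : ∀ i u, u ≠ v → (A i u).conjTranspose * A i u = 1)
      (next : ∀ i, MultiOp (H' i) → MultiOp K)
      (hnext : ∀ i, IsLOCC (next i))
      (Λ : MultiOp H → MultiOp K)
      (hΛ : ∀ ρ, Λ ρ =
        ∑ i, next i (localTensor (A i) * ρ * (localTensor (A i)).conjTranspose)) :
      IsLOCC Λ

/-! ## Isotropic network states -/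

/-- The maximally entangled vector `|φ⁺⟩ = d^{-1/2} ∑ i, |ii⟩`. -/
def maxEntangled (d : ℕ) : Fin d × Fin d → ℂ :=
  fun a => if a.1 = a.2 then ((1 / Real.sqrt d : ℝ) : ℂ) else 0

/-- The isotropic state `ρ(p) = p φ⁺ + (1 - p) / d² 𝟙` of visibility `p`. -/
def isotropic (d : ℕ) (p : ℝ) : Matrix (Fin d × Fin d) (Fin d × Fin d) ℂ :=
  (p : ℂ) • pureState (maxEntangled d) + (((1 - p) / (d : ℝ) ^ 2 : ℝ) : ℂ) • 1

/-- The isotropic state is invariant under exchange of the two parties. -/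
theorem isotropic_swap (d : ℕ) (p : ℝ) (a b : Fin d × Fin d) :
    isotropic d p a.swap b.swap = isotropic d p a b := by
  simp [isotropic, pureState, maxEntangled, Matrix.vecMulVec_apply, Matrix.one_apply, eq_comm]

/-- The local space of `v` in a network: one `d`-dimensional system for every edge at `v`, the
edge being named by its other endpoint. -/
abbrev NetSystem {W : Type} (G : SimpleGraph W) (d : ℕ) (v : W) : Type :=
  {w : W // G.Adj v w} → Fin d

/-- The matrix entry, at the product basis elements `x` and `y`, of the isotropic state that lives
on the edge `e` (`1` if `e` is not an edge of `G`). -/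
def linkEntry {W : Type} (G : SimpleGraph W) [DecidableRel G.Adj] (d : ℕ) (p : ℝ)
    (x y : ∀ v, NetSystem G d v) (e : Sym2 W) : ℂ :=
  Sym2.lift
    ⟨fun u w => if h : G.Adj u w then
        isotropic d p (x u ⟨w, h⟩, x w ⟨u, h.symm⟩) (y u ⟨w, h⟩, y w ⟨u, h.symm⟩) else 1,
      by
        intro u w
        by_cases h : G.Adj u w
        · simp only [h, h.symm, dif_pos]
          exact (isotropic_swap d p _ _).symm
        · have h' : ¬ G.Adj w u := fun q => h q.symm
          simp only [h, h', dif_neg, not_false_eq_true]⟩ e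

/-- The isotropic network state `σ(G, p) = ⨂_{e ∈ E} ρ_e(p)`. -/
def networkState {W : Type} [Fintype W] [DecidableEq W] (G : SimpleGraph W)
    [DecidableRel G.Adj] (d : ℕ) (p : ℝ) : MultiOp (NetSystem G d) :=
  Matrix.of fun x y => ∏ e ∈ G.edgeFinset, linkEntry G d p x y e

/-! ## Graph sequences and partial distillability -/

/-- A growing sequence of networks: finite connected simple graphs on nested sets of parties,
whose order tends to infinity. -/
structure GraphSequence where
  Party : Type
  [decParty : DecidableEq Party]
  V : ℕ → Finset Party
  graph : ∀ n, SimpleGraph {v // v ∈ V n}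
  [decAdj : ∀ n, DecidableRel (graph n).Adj]
  nested : ∀ n, V n ⊆ V (n + 1)
  connected : ∀ n, (graph n).Connected
  order_tendsto : Tendsto (fun n => (V n).card) atTop atTop

attribute [instance] GraphSequence.decParty GraphSequence.decAdj

/-- The output space of a party: `d`-dimensional for parties in `V₀`, trivial (one-dimensional)
for the other parties. -/
abbrev OutSystem {Q : Type} (V : Finset Q) (V₀ : Finset Q) (d : ℕ)
    (v : {v // v ∈ V}) : Type :=
  v.1 ∈ V₀ → Fin d

/-- A vector of `⨂_{v ∈ V₀} ℂ^d`, seen in the output space of all parties in `V ⊇ V₀` (where the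
parties outside `V₀` contribute one-dimensional factors). -/
def extendVector {Q : Type} {V V₀ : Finset Q} (h : V₀ ⊆ V) {d : ℕ}
    (ψ : ({v // v ∈ V₀} → Fin d) → ℂ) : (∀ v, OutSystem V V₀ d v) → ℂ :=
  fun x => ψ fun v => x ⟨v.1, h v.2⟩ v.2

/-- Partial distillability of a graph sequence, for links of local dimension `d`. There is a
visibility threshold `p₀ < 1` such that for each finite set `V₀` of parties and each pure state `ψ`
of `V₀` there are LOCC maps `Λ n p`, for all `n` with `V₀ ⊆ V n`, that take the isotropic network
state of visibility `p` to states of fidelity tending to `1` with `ψ`, for all `p > p₀`. -/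
def PartiallyDistillable (S : GraphSequence) (d : ℕ) : Prop :=
  ∃ p₀ : ℝ, p₀ < 1 ∧
    ∀ (V₀ : Finset S.Party) (ψ : ({v // v ∈ V₀} → Fin d) → ℂ), ∑ x, ‖ψ x‖ ^ 2 = 1 →
      ∃ Λ : ∀ (n : {n // V₀ ⊆ S.V n}), ℝ →
          MultiOp (NetSystem (S.graph n) d) → MultiOp (OutSystem (S.V n) V₀ d),
        (∀ n p, IsLOCC (Λ n p)) ∧
        ∀ p : ℝ, 0 ≤ p → p₀ < p → p ≤ 1 →
          Tendsto (fun n : {n // V₀ ⊆ S.V n} =>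
              fidelity (Λ n p (networkState (S.graph n) d p)) (pureState (extendVector n.2 ψ)))
            atTop (𝓝 1)

/-! ## Hamming graphs and spiders -/

/-- The points of `[n]^k`, where `[n]` is `{0, …, n - 1}`. -/
def hammingVertices (k n : ℕ) : Finset (Fin k → ℕ) :=
  Fintype.piFinset fun _ => Finset.range n

/-- The graph on `[n]^k` in which two vertices are adjacent when they differ in exactly one
coordinate. -/
def hammingGraph (k n : ℕ) : SimpleGraph {v // v ∈ hammingVertices k n} where
  Adj I J := hammingDist I.1 J.1 = 1
  symm := ⟨fun I J h => by rw [hammingDist_comm]; exact h⟩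
  loopless := ⟨fun I h => by simp at h⟩

instance (k n : ℕ) : DecidableRel (hammingGraph k n).Adj :=
  fun I J => inferInstanceAs (Decidable (hammingDist I.1 J.1 = 1))

theorem hammingGraph_connected (k n : ℕ) : (hammingGraph k (n + 1)).Connected := by
  classical
  have key : ∀ (c : ℕ) (I J : {v // v ∈ hammingVertices k (n + 1)}),
      hammingDist I.1 J.1 = c → (hammingGraph k (n + 1)).Reachable I J := by
    intro c
    induction c with
    | zero =>
      intro I J h
      rw [Subtype.ext (hammingDist_eq_zero.1 h)]
    | succ c ih =>
      intro I J h
      have hne : I.1 ≠ J.1 := by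
        intro e
        rw [e, hammingDist_self] at h
        omega
      obtain ⟨m, hm⟩ := Function.ne_iff.1 hne
      have hmem : Function.update I.1 m (J.1 m) ∈ hammingVertices k (n + 1) := by
        have hI := I.2
        have hJ := J.2
        simp only [hammingVertices, Fintype.mem_piFinset] at hI hJ ⊢
        intro a
        by_cases ha : a = m
        · subst ha
          simpa using hJ a
        · simpa [ha] using hI a
      let I' : {v // v ∈ hammingVertices k (n + 1)} := ⟨_, hmem⟩
      have h1 : hammingDist I.1 I'.1 = 1 := by
        have : ({a | I.1 a ≠ I'.1 a} : Finset (Fin k)) = {m} := by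
          ext a
          by_cases ha : a = m
          · subst ha
            simpa [I'] using hm
          · simp [I', ha]
        rw [hammingDist, this, Finset.card_singleton]
      have h2 : hammingDist I'.1 J.1 = c := by
        have : ({a | I'.1 a ≠ J.1 a} : Finset (Fin k)) =
            ({a | I.1 a ≠ J.1 a} : Finset (Fin k)).erase m := by
          ext a
          by_cases ha : a = m
          · subst ha
            simp [I']
          · simp [I', ha]
        rw [hammingDist, this, Finset.card_erase_of_mem (by simpa using hm)]
        have h' := h
        rw [hammingDist] at h'
        omega
      exact (SimpleGraph.Adj.reachable (G := hammingGraph k (n + 1)) h1).trans (ih I' J h2)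
  have : Nonempty {v // v ∈ hammingVertices k (n + 1)} :=
    ⟨⟨fun _ => 0, by simp [hammingVertices]⟩⟩
  exact ⟨fun I J => key _ I J rfl⟩

/-- The sequence of Hamming graphs on `[1]^k, [2]^k, [3]^k, …`, for a fixed `k ≥ 1`. The indices
of the sequence begin with `0`, so that its graph of index `n` is the one on `[n + 1]^k`. -/
def hammingSequence (k : ℕ) (hk : 1 ≤ k) : GraphSequence where
  Party := Fin k → ℕ
  V n := hammingVertices k (n + 1)
  graph n := hammingGraph k (n + 1)
  nested n := Fintype.piFinset_subset _ _ fun _ => Finset.range_subset_range.2 (by omega)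
  connected n := hammingGraph_connected k n
  order_tendsto := by
    have h : ∀ n, n ≤ (hammingVertices k (n + 1)).card := by
      intro n
      have h1 : n + 1 ≤ (n + 1) ^ k := Nat.le_self_pow (by omega) _
      simp only [hammingVertices, Fintype.card_piFinset, Finset.card_range, Finset.prod_const,
        Finset.card_univ, Fintype.card_fin]
      omega
    exact tendsto_atTop_mono h tendsto_id

/-- A spider in `G` with centre `c` and with exactly one leg for each element of `T` (`c ∉ T`):
the leg of `t` is a simple path from `c` to `t`, and different legs only meet in `c`. -/
structure Spider {W : Type} (G : SimpleGraph W) (c : W) (T : Finset W) where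
  center_notMem : c ∉ T
  leg : ∀ t : {t // t ∈ T}, G.Walk c t
  isPath : ∀ t, (leg t).IsPath
  legs_disjoint : ∀ s t, s ≠ t → ∀ w, w ∈ (leg s).support → w ∈ (leg t).support → w = c

/-- The set of edges of a spider. -/
def Spider.edges {W : Type} {G : SimpleGraph W} {c : W} {T : Finset W} (S : Spider G c T) :
    Set (Sym2 W) :=
  {e | ∃ t, e ∈ (S.leg t).edges}

end

/-! Degrees: a vertex of $[n]^k$ has at most $kn$ neighbours and there are $n^k$ vertices, so every
$k\ge 1/\alpha$ gives the bound.

Spiders come from fresh values. Fix a coordinate $j$ and a value $a$ that no vertex of $V_0$ has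
there. From $v_0$, set coordinate $j$ to $a$, move the other coordinates to those of $t$ one by one,
and finally reset coordinate $j$: at most $k+1$ steps. An inner vertex has the value $a$ at $j$ and
values used by $V_0$ elsewhere, so it determines the pair $(j,a)$, and every edge of the route
contains such a vertex. Routes with different pairs therefore share no inner vertex and no edge
(`exists_path_of_fresh`), and counting fresh values gives the spiders
(`exists_edgeDisjoint_spiders`).

Distillability only needs a growing number of edge-disjoint spiders with legs of bounded length
$\ell$ (`partiallyDistillable_of_spiders`). An isotropic link is perfect with probability $p$ and a
random product basis state otherwise, so the network state is a mixture of pure states with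
independent link labels (`networkState_eq_sum`). The inner parties of the legs teleport, which turns
a leg of perfect links into a maximally entangled pair up to a known unitary
(`legMatrix_of_perfect`). From $9^m$ spiders, $v_0$ and each $t$ obtain $9^m$ pairs that fail
independently, each with probability at most $\ell(1-p)$, a bound that does not depend on $n$.

Such a pair is handled through its amplitude matrix $T$: local operators act by $T\mapsto
ATB^{\mathsf T}$, and a perfect pair is a multiple of the identity. A majority comparison of three
pairs, of which at most one is bad, leaves a diagonal matrix, that is, only phase errors. The
Fourier transform makes a diagonal matrix shift-invariant, a second majority makes it diagonal
again, and a diagonal shift-invariant matrix is scalar. This is the nine-qudit code in the form of a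
one-way protocol, correcting one arbitrary bad pair out of nine
(`Pairing.nineGadget_isScalarMatrix`). Concatenation changes the error probability by $x\mapsto
81x^2$ at worst, so it tends to zero from any start at most $1/162$
(`labelProb_not_correctable_le`).

When the errors are correctable, $v_0$ teleports $\psi$ through the distilled pairs and every branch
ends in a multiple of $\psi$ (`exists_isLOCC_of_correctable`). The fidelity with a pure state is
linear in the other argument, so it is at least the probability of correctable errors
(`fidelity_mixture`). This tends to $1$, since $m$ is the logarithm to base $9$ of the growing
number of spiders. -/

noncomputable section

set_option linter.unusedSectionVars false

/-! ## Degrees and spiders in Hamming graphs -/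

theorem hammingDist_update_right {k : ℕ} (I : Fin k → ℕ) (j : Fin k) (a : ℕ) (h : I j ≠ a) :
    hammingDist I (Function.update I j a) = 1 := by
  have : ({b | I b ≠ Function.update I j a b} : Finset (Fin k)) = {j} := by
    ext b
    by_cases hb : b = j
    · subst hb
      simpa using h
    · simp [hb]
  rw [hammingDist, this, Finset.card_singleton]

theorem update_mem_hammingVertices {k n : ℕ} {I : Fin k → ℕ} (hI : I ∈ hammingVertices k n)
    (j : Fin k) {a : ℕ} (ha : a < n) : Function.update I j a ∈ hammingVertices k n := by
  simp only [hammingVertices, Fintype.mem_piFinset, Finset.mem_range] at hI ⊢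
  intro b
  by_cases hb : b = j
  · subst hb
    simpa using ha
  · simpa [hb] using hI b

theorem lt_of_mem_hammingVertices {k n : ℕ} {I : Fin k → ℕ} (hI : I ∈ hammingVertices k n)
    (j : Fin k) : I j < n := by
  simp only [hammingVertices, Fintype.mem_piFinset, Finset.mem_range] at hI
  exact hI j

/-- Two vertices of the Hamming graph are joined by a walk that moves every coordinate at most
once. -/
theorem exists_walk_length_eq_hammingDist {k n : ℕ} (c : ℕ) :
    ∀ I J : {v // v ∈ hammingVertices k n}, hammingDist I.1 J.1 = c →
      ∃ w : (hammingGraph k n).Walk I J, w.length = c ∧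
        ∀ x ∈ w.support, ∀ b, x.1 b = I.1 b ∨ x.1 b = J.1 b := by
  induction c with
  | zero =>
    intro I J h
    obtain rfl := Subtype.ext (hammingDist_eq_zero.1 h)
    exact ⟨.nil, rfl, by simp⟩
  | succ c ih =>
    intro I J h
    have hne : I.1 ≠ J.1 := by
      intro e
      rw [e, hammingDist_self] at h
      omega
    obtain ⟨m, hm⟩ := Function.ne_iff.1 hne
    let I' : {v // v ∈ hammingVertices k n} :=
      ⟨_, update_mem_hammingVertices I.2 m (lt_of_mem_hammingVertices J.2 m)⟩
    have h1 : (hammingGraph k n).Adj I I' := hammingDist_update_right I.1 m (J.1 m) hm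
    have h2 : hammingDist I'.1 J.1 = c := by
      have : ({a | I'.1 a ≠ J.1 a} : Finset (Fin k)) =
          ({a | I.1 a ≠ J.1 a} : Finset (Fin k)).erase m := by
        ext a
        by_cases ha : a = m
        · subst ha
          simp [I']
        · simp [I', ha]
      rw [hammingDist, this, Finset.card_erase_of_mem (by simpa using hm)]
      rw [hammingDist] at h
      omega
    obtain ⟨w, hw, hs⟩ := ih I' J h2
    refine ⟨.cons h1 w, by simp [hw], ?_⟩
    intro x hx b
    rw [SimpleGraph.Walk.support_cons, List.mem_cons] at hx
    rcases hx with rfl | hx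
    · exact Or.inl rfl
    · rcases hs x hx b with h | h
      · by_cases hb : b = m
        · subst hb
          right
          simpa [I'] using h
        · left
          simpa [I', hb] using h
      · exact Or.inr h

/-- `x` has the fresh value `a` (not used by `V₀`) in coordinate `j`, and values used by `V₀` in
the other coordinates. -/
def IsFreshAt {k n : ℕ} (V₀ : Finset {v // v ∈ hammingVertices k n}) (j : Fin k) (a : ℕ)
    (x : {v // v ∈ hammingVertices k n}) : Prop :=
  x.1 j = a ∧ (∀ v ∈ V₀, v.1 j ≠ a) ∧ ∀ b, b ≠ j → ∃ v ∈ V₀, v.1 b = x.1 b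

theorem IsFreshAt.notMem {k n : ℕ} {V₀ : Finset {v // v ∈ hammingVertices k n}} {j : Fin k}
    {a : ℕ} {x : {v // v ∈ hammingVertices k n}} (h : IsFreshAt V₀ j a x) : x ∉ V₀ :=
  fun hx => h.2.1 x hx h.1

theorem IsFreshAt.unique {k n : ℕ} {V₀ : Finset {v // v ∈ hammingVertices k n}} {j j' : Fin k}
    {a a' : ℕ} {x : {v // v ∈ hammingVertices k n}} (h : IsFreshAt V₀ j a x)
    (h' : IsFreshAt V₀ j' a' x) : j = j' ∧ a = a' := by
  have hj : j = j' := by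
    by_contra hne
    obtain ⟨v, hv, e⟩ := h'.2.2 j hne
    exact h.2.1 v hv (e.trans h.1)
  subst hj
  exact ⟨rfl, h.1.symm.trans h'.1⟩

/-- The detour through the hyperplane where coordinate `j` equals `a`. The last two clauses are what
disjointness needs: a vertex that is fresh at `(j, a)` is outside `V₀` and is fresh for no other
pair. -/
theorem exists_path_of_fresh {k n : ℕ} {V₀ : Finset {v // v ∈ hammingVertices k n}}
    {s t : {v // v ∈ hammingVertices k n}} (hs : s ∈ V₀) (ht : t ∈ V₀) (j : Fin k) {a : ℕ}
    (ha : a < n) (hfresh : ∀ v ∈ V₀, v.1 j ≠ a) :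
    ∃ p : (hammingGraph k n).Walk s t, p.IsPath ∧ p.length ≤ k + 1 ∧
      (∀ x ∈ p.support, x = s ∨ x = t ∨ IsFreshAt V₀ j a x) ∧
      ∀ e ∈ p.edges, ∃ x ∈ e, IsFreshAt V₀ j a x := by
  classical
  let s' : {v // v ∈ hammingVertices k n} := ⟨_, update_mem_hammingVertices s.2 j ha⟩
  let t' : {v // v ∈ hammingVertices k n} := ⟨_, update_mem_hammingVertices t.2 j ha⟩
  have h1 : (hammingGraph k n).Adj s s' := hammingDist_update_right s.1 j a (hfresh s hs)
  have h2 : (hammingGraph k n).Adj t' t :=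
    (hammingDist_comm _ _).trans (hammingDist_update_right t.1 j a (hfresh t ht))
  obtain ⟨q, hq, hqs⟩ := exists_walk_length_eq_hammingDist _ s' t' rfl
  -- Both points have the value `a` at `j`. With the two outer steps this gives the length `k + 1`.
  have hdist : hammingDist s'.1 t'.1 ≤ k - 1 := by
    have : ({b | s'.1 b ≠ t'.1 b} : Finset (Fin k)) ⊆ Finset.univ.erase j := by
      intro b hb
      simp only [Finset.mem_filter, Finset.mem_univ, true_and, Finset.mem_erase, and_true] at hb ⊢
      rintro rfl
      simp [s', t'] at hb
    simpa [hammingDist] using Finset.card_le_card this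
  have hk : 0 < k := j.pos
  have hfr : ∀ x ∈ q.support, IsFreshAt V₀ j a x := by
    intro x hx
    refine ⟨by simpa [s', t'] using hqs x hx j, hfresh, fun b hb => ?_⟩
    rcases hqs x hx b with h | h
    · exact ⟨s, hs, by simp [h, s', hb]⟩
    · exact ⟨t, ht, by simp [h, t', hb]⟩
  let w : (hammingGraph k n).Walk s t := .cons h1 (q.append (.cons h2 .nil))
  -- Cutting out loops only shrinks the support and the edges, so the properties of `w` survive.
  refine ⟨w.bypass, w.bypass_isPath, ?_, ?_, ?_⟩
  · refine w.length_bypass_le_length.trans ?_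
    simp only [w, SimpleGraph.Walk.length_cons, SimpleGraph.Walk.length_append,
      SimpleGraph.Walk.length_nil]
    omega
  · intro x hx
    have hx := w.support_bypass_subset_support hx
    simp only [w, SimpleGraph.Walk.support_cons, List.mem_cons,
      SimpleGraph.Walk.mem_support_append_iff, SimpleGraph.Walk.support_nil, List.not_mem_nil,
      or_false] at hx
    rcases hx with h | h | h | h
    · exact Or.inl h
    · exact Or.inr (Or.inr (hfr x h))
    · exact Or.inr (Or.inr (hfr x (h ▸ q.end_mem_support)))
    · exact Or.inr (Or.inl h)
  · intro e he
    have he := w.edges_bypass_subset_edges he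
    simp only [w, SimpleGraph.Walk.edges_cons, List.mem_cons, SimpleGraph.Walk.edges_append,
      List.mem_append, SimpleGraph.Walk.edges_nil, List.not_mem_nil, or_false] at he
    rcases he with rfl | h | rfl
    · exact ⟨s', by simp, hfr _ q.start_mem_support⟩
    · induction e with
      | h x y => exact ⟨x, by simp, hfr x (q.fst_mem_support_of_mem_edges h)⟩
    · exact ⟨t', by simp, hfr _ q.end_mem_support⟩

/-- Edge-disjoint spiders with short legs in the Hamming graph. -/
theorem exists_edgeDisjoint_spiders (k n : ℕ) (V₀ : Finset {v // v ∈ hammingVertices k n})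
    (hV₀ : 2 ≤ V₀.card) (v₀ : {v // v ∈ hammingVertices k n}) (hv₀ : v₀ ∈ V₀) :
    ∃ S : Fin (((n - 1) / (V₀.card - 1) - 1) * k) →
        Spider (hammingGraph k n) v₀ (V₀.erase v₀),
      (∀ i t, ((S i).leg t).length ≤ k + 1) ∧
      Pairwise fun i j => Disjoint (S i).edges (S j).edges := by
  classical
  set c := (n - 1) / (V₀.card - 1) - 1 with hc
  -- The fresh values in coordinate `j`. Each leg of each of the `c` spiders for this coordinate
  -- receives its own fresh value.
  let Z : Fin k → Finset ℕ := fun j => Finset.range n \ V₀.image fun v => v.1 j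
  have hZ : ∀ j, Nonempty (Fin c × {t // t ∈ V₀.erase v₀} ↪ Z j) := by
    intro j
    rw [Function.Embedding.nonempty_iff_card_le]
    have h1 : n - V₀.card ≤ (Z j).card := by
      have := Finset.le_card_sdiff (V₀.image fun v => v.1 j) (Finset.range n)
      rw [Finset.card_range] at this
      have h' : (V₀.image fun v => v.1 j).card ≤ V₀.card := Finset.card_image_le
      simp only [Z]
      omega
    -- Subtracting one from the quotient leaves `(n - 1) - (|V₀| - 1) = n - |V₀|`, a lower bound for
    -- the number of fresh values.
    have h2 : c * (V₀.card - 1) ≤ n - V₀.card := by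
      have h3 := Nat.div_mul_le_self (n - 1) (V₀.card - 1)
      rw [hc, Nat.sub_mul]
      omega
    rw [Fintype.card_prod, Fintype.card_fin, Fintype.card_coe, Fintype.card_coe,
      Finset.card_erase_of_mem hv₀]
    exact h2.trans h1
  let val : Fin k → Fin c → {t // t ∈ V₀.erase v₀} → ℕ := fun j i t => (hZ j).some (i, t)
  have hval : ∀ j i t i' t', val j i t = val j i' t' → i = i' ∧ t = t' := by
    intro j i t i' t' h
    simpa using (hZ j).some.injective (Subtype.ext h)
  have hmem : ∀ j i t, val j i t < n ∧ ∀ v ∈ V₀, v.1 j ≠ val j i t := by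
    intro j i t
    have := ((hZ j).some (i, t)).2
    simp only [Z, Finset.mem_sdiff, Finset.mem_range, Finset.mem_image, not_exists, not_and] at this
    exact this
  choose p hpath hlen hsupp hedge using fun (j : Fin k) (i : Fin c) (t : {t // t ∈ V₀.erase v₀}) =>
    exists_path_of_fresh hv₀ (Finset.mem_of_mem_erase t.2) j (hmem j i t).1 (hmem j i t).2
  let S : Fin (c * k) → Spider (hammingGraph k n) v₀ (V₀.erase v₀) := fun i =>
    { center_notMem := Finset.notMem_erase _ _
      leg := p (finProdFinEquiv.symm i).2 (finProdFinEquiv.symm i).1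
      isPath := fun t => hpath _ _ t
      legs_disjoint := by
        intro s t hst w hs ht
        have hsV := Finset.mem_of_mem_erase s.2
        have htV := Finset.mem_of_mem_erase t.2
        rcases hsupp _ _ _ w hs with h | h | h
        · exact h
        · rcases hsupp _ _ _ w ht with h' | h' | h'
          · exact h'
          · exact absurd (Subtype.ext (h.symm.trans h')) hst
          · exact absurd (h ▸ hsV) h'.notMem
        · rcases hsupp _ _ _ w ht with h' | h' | h'
          · exact h'
          · exact absurd (h' ▸ htV) h.notMem
          · exact absurd (hval _ _ _ _ _ (h.unique h').2).2 hst }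
  refine ⟨S, fun i t => hlen _ _ t, ?_⟩
  intro i i' hne
  rw [Set.disjoint_left]
  rintro e ⟨s, hs⟩ ⟨t, ht⟩
  -- A common edge contains a vertex that is fresh for the first leg. It lies on the second leg too,
  -- outside `V₀`, so the two coordinates and the two values coincide.
  obtain ⟨x, hx, hfx⟩ := hedge _ _ _ e hs
  have hx' : x ∈ ((S i').leg t).support := SimpleGraph.Walk.mem_support_of_mem_edges ht hx
  rcases hsupp _ _ _ x hx' with h | h | h
  · exact hfx.notMem (h ▸ hv₀)
  · exact hfx.notMem (h ▸ Finset.mem_of_mem_erase t.2)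
  · obtain ⟨hj, ha⟩ := hfx.unique h
    apply hne
    apply finProdFinEquiv.symm.injective
    refine Prod.ext ?_ hj
    rw [hj] at ha
    exact (hval _ _ _ _ _ ha).1

/-- A neighbour is determined by the changed coordinate and its new value; the trivial change is
counted as well, which does no harm. -/
theorem hammingGraph_degree_le {k n : ℕ} (v : {v // v ∈ hammingVertices k n}) :
    (hammingGraph k n).degree v ≤ k * n := by
  classical
  let f : Fin k × Fin n → {v // v ∈ hammingVertices k n} := fun x =>
    ⟨_, update_mem_hammingVertices v.2 x.1 x.2.2⟩
  have h : (hammingGraph k n).neighborFinset v ⊆ Finset.univ.image f := by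
    intro w hw
    rw [SimpleGraph.mem_neighborFinset] at hw
    have hw' : ({a | v.1 a ≠ w.1 a} : Finset (Fin k)).card = 1 := hw
    obtain ⟨j, hj⟩ := Finset.card_eq_one.1 hw'
    rw [Finset.mem_image]
    refine ⟨(j, ⟨w.1 j, lt_of_mem_hammingVertices w.2 j⟩), Finset.mem_univ _, Subtype.ext ?_⟩
    funext b
    by_cases hb : b = j
    · subst hb
      simp [f]
    · have : b ∉ ({a | v.1 a ≠ w.1 a} : Finset (Fin k)) := by
        rw [hj]
        simpa using hb
      simp only [Finset.mem_filter, Finset.mem_univ, true_and, not_not] at this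
      simp [f, hb, this]
  calc (hammingGraph k n).degree v ≤ (Finset.univ.image f).card := Finset.card_le_card h
    _ ≤ _ := Finset.card_image_le
    _ = k * n := by simp

theorem hammingSequence_maxDegree_isBigO {α : ℝ} {k : ℕ} (hk : 1 ≤ k) (hα : 1 ≤ k * α) :
    (fun n => (((hammingSequence k hk).graph n).maxDegree : ℝ)) =O[atTop]
      fun n => (((hammingSequence k hk).V n).card : ℝ) ^ α := by
  refine IsBigO.of_bound k (Eventually.of_forall fun n => ?_)
  have h1 : ((hammingSequence k hk).graph n).maxDegree ≤ k * (n + 1) :=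
    SimpleGraph.maxDegree_le_of_forall_degree_le _ _ fun v => by
      convert! hammingGraph_degree_le v
  have h2 : ((hammingSequence k hk).V n).card = (n + 1) ^ k := by
    simp [hammingSequence, hammingVertices]
  have h3 : ((n + 1 : ℕ) : ℝ) ≤ (((hammingSequence k hk).V n).card : ℝ) ^ α := by
    rw [h2, Nat.cast_pow, ← Real.rpow_natCast, ← Real.rpow_mul (by positivity)]
    exact Real.self_le_rpow_of_one_le (by simp) hα
  rw [Real.norm_of_nonneg (by positivity), Real.norm_of_nonneg (by positivity)]
  calc (((hammingSequence k hk).graph n).maxDegree : ℝ) ≤ ((k * (n + 1) : ℕ) : ℝ) := by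
        exact_mod_cast h1
    _ = k * ((n + 1 : ℕ) : ℝ) := by push_cast; ring
    _ ≤ _ := by gcongr

/-! ## Local tensors -/

section LocalTensor

variable {P : Type} [Fintype P] {H K L : P → Type}

theorem localTensor_apply (A : ∀ v, Matrix (K v) (H v) ℂ) (x : ∀ v, K v) (y : ∀ v, H v) :
    localTensor A x y = ∏ v, A v (x v) (y v) := rfl

theorem localTensor_conjTranspose (A : ∀ v, Matrix (K v) (H v) ℂ) :
    (localTensor A).conjTranspose = localTensor fun v => (A v).conjTranspose := by
  ext x y
  simp [localTensor_apply, Matrix.conjTranspose_apply]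

theorem localTensor_transpose (A : ∀ v, Matrix (K v) (H v) ℂ) :
    (localTensor A).transpose = localTensor fun v => (A v).transpose := by
  ext x y
  simp [localTensor_apply]

theorem localTensor_mul [DecidableEq P] [∀ v, Fintype (K v)] (A : ∀ v, Matrix (L v) (K v) ℂ)
    (B : ∀ v, Matrix (K v) (H v) ℂ) :
    localTensor A * localTensor B = localTensor fun v => A v * B v := by
  ext x y
  simp only [localTensor_apply, Matrix.mul_apply]
  rw [Finset.prod_univ_sum, Fintype.piFinset_univ]
  exact Finset.sum_congr rfl fun z _ => Finset.prod_mul_distrib.symm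

theorem localTensor_one [∀ v, DecidableEq (H v)] [DecidableEq (∀ v, H v)] :
    localTensor (fun v => (1 : Matrix (H v) (H v) ℂ)) = 1 := by
  ext x y
  rw [localTensor_apply, Matrix.one_apply]
  split_ifs with h
  · subst h
    simp
  · obtain ⟨v, hv⟩ := Function.ne_iff.1 h
    exact Finset.prod_eq_zero (Finset.mem_univ v) (by rw [Matrix.one_apply_ne hv])

theorem localTensor_smul (c : P → ℂ) (A : ∀ v, Matrix (K v) (H v) ℂ) :
    localTensor (fun v => c v • A v) = (∏ v, c v) • localTensor A := by
  ext x y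
  simp [localTensor_apply, Finset.prod_mul_distrib]

theorem sum_localTensor [DecidableEq P] {O : P → Type} [∀ v, Fintype (O v)]
    (A : ∀ v, O v → Matrix (K v) (H v) ℂ) :
    ∑ o : ∀ v, O v, localTensor (fun v => A v (o v)) = localTensor fun v => ∑ i, A v i := by
  ext x y
  simp only [localTensor_apply, Matrix.sum_apply]
  rw [Finset.prod_univ_sum, Fintype.piFinset_univ]

theorem sum_localTensor_of_forall_ne [DecidableEq P] [∀ v, DecidableEq (H v)]
    [DecidableEq (∀ v, H v)] {ι : Type} [Fintype ι] (v : P) (A : ι → ∀ u, Matrix (H u) (H u) ℂ)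
    (hv : ∑ i, A i v = 1) (hA : ∀ i u, u ≠ v → A i u = 1) :
    ∑ i, localTensor (A i) = 1 := by
  have h : ∀ i x y, localTensor (A i) x y =
      A i v (x v) (y v) * ∏ u ∈ Finset.univ.erase v, (1 : Matrix (H u) (H u) ℂ) (x u) (y u) := by
    intro i x y
    rw [localTensor_apply, ← Finset.mul_prod_erase _ _ (Finset.mem_univ v)]
    congr 1
    exact Finset.prod_congr rfl fun u hu => by rw [hA i u (Finset.ne_of_mem_erase hu)]
  rw [← localTensor_one]
  ext x y
  simp only [Matrix.sum_apply, h]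
  rw [← Finset.sum_mul, localTensor_apply, ← Finset.mul_prod_erase _ _ (Finset.mem_univ v),
    ← hv, Matrix.sum_apply]

end LocalTensor

/-! ## LOCC protocols in which every party measures once -/

/-- The local systems after the measurement of `v`: `K v` for `v`, unchanged otherwise. -/
abbrev MeasuredSystem {P : Type} (K H : P → Type) (v : P) (u : P) : Type :=
  {x : K u ⊕ H u // x.isLeft = true ↔ u = v}

/-- The operator `B` on the system of `v`, the identity on all other systems. -/
def measureOp {P : Type} {K H : P → Type} [∀ v, DecidableEq (H v)] (v : P)
    (B : ∀ u, Matrix (K u) (H u) ℂ) (u : P) : Matrix (MeasuredSystem K H v u) (H u) ℂ :=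
  Matrix.of fun x y => Sum.elim (fun k => B u k y) (fun h => if h = y then 1 else 0) x.1

/-- The operator `B u` if `u` has not yet been measured, the identity otherwise. -/
def remainingOp {P : Type} {K H : P → Type} [∀ v, DecidableEq (K v)] (v : P)
    (B : ∀ u, Matrix (K u) (H u) ℂ) (u : P) : Matrix (K u) (MeasuredSystem K H v u) ℂ :=
  Matrix.of fun k x => Sum.elim (fun k' => if k = k' then 1 else 0) (fun h => B u k h) x.1

/-- The system of the measured party. -/
def measuredEquiv {P : Type} (K H : P → Type) (v : P) : MeasuredSystem K H v v ≃ K v where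
  toFun x := x.1.getLeft (x.2.2 rfl)
  invFun k := ⟨Sum.inl k, by simp⟩
  left_inv x := Subtype.ext (by simp)
  right_inv k := rfl

/-- The systems of the other parties do not change. -/
def unmeasuredEquiv {P : Type} (K H : P → Type) {v u : P} (huv : u ≠ v) :
    MeasuredSystem K H v u ≃ H u where
  toFun x := x.1.getRight (by simpa using mt x.2.1 huv)
  invFun h := ⟨Sum.inr h, by simp [huv]⟩
  left_inv x := Subtype.ext (by simp)
  right_inv k := rfl

@[simp]
theorem coe_measuredEquiv_symm {P : Type} (K H : P → Type) (v : P) (k : K v) :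
    ((measuredEquiv K H v).symm k).1 = Sum.inl k := rfl

@[simp]
theorem coe_unmeasuredEquiv_symm {P : Type} (K H : P → Type) {v u : P} (huv : u ≠ v) (h : H u) :
    ((unmeasuredEquiv K H huv).symm h).1 = Sum.inr h := rfl

section

variable {P : Type} [DecidableEq P] {K H : P → Type} [∀ v, Fintype (K v)] [∀ v, DecidableEq (K v)]
  [∀ v, Fintype (H v)] [∀ v, DecidableEq (H v)]

theorem measureOp_self (v : P) (B : ∀ u, Matrix (K u) (H u) ℂ) :
    (measureOp v B v).conjTranspose * measureOp v B v = (B v).conjTranspose * B v := by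
  ext x y
  simp only [Matrix.mul_apply, Matrix.conjTranspose_apply]
  exact Fintype.sum_equiv (measuredEquiv K H v).symm _ _ (fun k => rfl) |>.symm

theorem measureOp_of_ne (v : P) (B : ∀ u, Matrix (K u) (H u) ℂ) {u : P} (huv : u ≠ v) :
    (measureOp v B u).conjTranspose * measureOp v B u = 1 := by
  have : (1 : Matrix (H u) (H u) ℂ) = (1 : Matrix (H u) (H u) ℂ).conjTranspose * 1 := by simp
  rw [this]
  ext x y
  simp only [Matrix.mul_apply, Matrix.conjTranspose_apply]
  exact Fintype.sum_equiv (unmeasuredEquiv K H huv).symm _ _ (fun k => by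
    simp [measureOp, Matrix.one_apply]) |>.symm

theorem remainingOp_self (v : P) (B : ∀ u, Matrix (K u) (H u) ℂ) :
    (remainingOp v B v).conjTranspose * remainingOp v B v = 1 := by
  have : (remainingOp v B v) = (1 : Matrix (K v) (K v) ℂ).submatrix id (measuredEquiv K H v) := by
    ext k x
    obtain ⟨k', rfl⟩ := (measuredEquiv K H v).symm.surjective x
    rw [Matrix.submatrix_apply, Equiv.apply_symm_apply]
    simp [remainingOp, Matrix.one_apply]
  rw [this, Matrix.conjTranspose_submatrix, Matrix.conjTranspose_one,
    Matrix.submatrix_mul _ _ _ id _ Function.bijective_id |>.symm, Matrix.one_mul,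
    Matrix.submatrix_one_equiv]

theorem remainingOp_of_ne (v : P) (B : ∀ u, Matrix (K u) (H u) ℂ) {u : P} (huv : u ≠ v) :
    remainingOp v B u = (B u).submatrix id (unmeasuredEquiv K H huv) := by
  ext k x
  obtain ⟨h, rfl⟩ := (unmeasuredEquiv K H huv).symm.surjective x
  rw [Matrix.submatrix_apply, Equiv.apply_symm_apply]
  simp [remainingOp]

theorem remainingOp_conjTranspose_mul (v : P) (B : ∀ u, Matrix (K u) (H u) ℂ) {u : P}
    (huv : u ≠ v) : (remainingOp v B u).conjTranspose * remainingOp v B u =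
      ((B u).conjTranspose * B u).submatrix (unmeasuredEquiv K H huv)
        (unmeasuredEquiv K H huv) := by
  rw [remainingOp_of_ne v B huv, Matrix.conjTranspose_submatrix,
    Matrix.submatrix_mul _ _ _ id _ Function.bijective_id]

theorem remainingOp_mul_measureOp (v : P) (B B' : ∀ u, Matrix (K u) (H u) ℂ) (u : P) :
    remainingOp v B u * measureOp v B' u = if u = v then B' u else B u := by
  split_ifs with huv
  · subst huv
    ext k y
    rw [Matrix.mul_apply, ← Fintype.sum_equiv (measuredEquiv K H u).symm
      (fun k' => if k = k' then B' u k' y else 0) _ (fun k' => by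
        simp [remainingOp, measureOp])]
    simp
  · ext k y
    rw [Matrix.mul_apply, ← Fintype.sum_equiv (unmeasuredEquiv K H huv).symm
      (fun h => if h = y then B u k h else 0) _ (fun k' => by
        simp [remainingOp, measureOp])]
    simp

end

section Protocols

variable {P : Type} [Fintype P] [DecidableEq P] {K : P → Type}
  [∀ v, Fintype (K v)] [∀ v, DecidableEq (K v)]

/-- By cyclicity of the trace only the products `Aᴴ A` matter, and in every round these add up to
the identity. -/
theorem IsLOCC.trace_eq {H : P → Type} [∀ v, Fintype (H v)] [∀ v, DecidableEq (H v)]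
    {Λ : MultiOp H → MultiOp K} (h : IsLOCC Λ) (ρ : MultiOp H) : (Λ ρ).trace = ρ.trace := by
  induction h with
  | done U hU Λ hΛ =>
    rw [hΛ, Matrix.trace_mul_comm, ← Matrix.mul_assoc, localTensor_conjTranspose, localTensor_mul]
    simp only [hU]
    rw [localTensor_one, Matrix.one_mul]
  | round v A hv hA next hnext Λ hΛ ih =>
    rw [hΛ, Matrix.trace_sum]
    simp only [ih]
    have : ∀ i, (localTensor (A i) * ρ * (localTensor (A i)).conjTranspose).trace =
        (localTensor (fun u => (A i u).conjTranspose * A i u) * ρ).trace := by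
      intro i
      rw [Matrix.trace_mul_comm, ← Matrix.mul_assoc, localTensor_conjTranspose, localTensor_mul]
    simp only [this]
    rw [← Matrix.trace_sum, ← Finset.sum_mul, sum_localTensor_of_forall_ne v _ hv hA,
      Matrix.one_mul]

/-- The LOCC map in which the parties of the list `l` measure one after the other, the Kraus
operator of each depending on the outcomes of those before it, with the Kraus decomposition into
the branches of the protocol. -/
theorem exists_isLOCC_of_measurements {O : Type} [Fintype O] (l : List P) (hl : l.Nodup) :
    ∀ {H : P → Type} [∀ v, Fintype (H v)] [∀ v, DecidableEq (H v)]
      (M : ∀ v, (P → O) → Matrix (K v) (H v) ℂ) (o₀ : P → O)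
      (_ : ∀ v ∈ l, ∀ o, ∑ i, (M v (Function.update o v i)).conjTranspose *
        M v (Function.update o v i) = 1)
      (_ : ∀ v ∉ l, ∀ o, (M v o).conjTranspose * M v o = 1)
      (_ : l.Pairwise fun v u => ∀ o i, M v (Function.update o u i) = M v o),
      ∃ Λ : MultiOp H → MultiOp K, IsLOCC Λ ∧
        ∃ (B : Type) (_ : Fintype B) (ob : B → P → O),
          (∀ ρ, Λ ρ = ∑ b, localTensor (fun v => M v (ob b)) * ρ *
            (localTensor fun v => M v (ob b)).conjTranspose) ∧
          ∀ {γ : Type} (f : (P → O) → γ),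
            (∀ u ∈ l, ∀ o i, f (Function.update o u i) = f o) → ∀ b, f (ob b) = f o₀ := by
  induction l with
  | nil =>
    intro H _ _ M o₀ _ h2 _
    refine ⟨_, IsLOCC.done (fun v => M v o₀) (fun v => h2 v (by simp) o₀) _ (fun ρ => rfl), Unit,
      inferInstance, fun _ => o₀, fun ρ => by simp, fun f _ _ => rfl⟩
  | cons v l ih =>
    intro H _ _ M o₀ h1 h2 h3
    rw [List.nodup_cons] at hl
    rw [List.pairwise_cons] at h3
    -- After the outcome `i` the party `v` already holds its output, so its remaining operator is an
    -- isometry and `v` counts as a party outside the list.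
    have key := fun i : O => ih hl.2 (H := MeasuredSystem K H v)
      (fun u o => remainingOp v (fun u => M u o) u) (Function.update o₀ v i)
      (by
        intro u hu o
        have huv : u ≠ v := fun e => hl.1 (e ▸ hu)
        simp only [remainingOp_conjTranspose_mul v _ huv]
        have := h1 u (List.mem_cons_of_mem _ hu) o
        rw [← Matrix.submatrix_one_equiv (unmeasuredEquiv K H huv), ← this]
        ext x y
        simp [Matrix.sum_apply])
      (by
        intro u hu o
        by_cases huv : u = v
        · subst huv
          exact remainingOp_self u _
        · rw [remainingOp_conjTranspose_mul v _ huv, h2 u (by simp [huv, hu]),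
            Matrix.submatrix_one_equiv])
      (by
        refine h3.2.imp_of_mem ?_
        intro u w hu hw h o i
        ext k x
        rcases x with ⟨x | x, hx⟩
        · rfl
        · simp [remainingOp, h])
    choose next hnext B hB ob hker hob using key
    let A : ∀ (i : O) (u : P), Matrix (MeasuredSystem K H v u) (H u) ℂ :=
      fun i => measureOp v fun u => M u (Function.update o₀ v i)
    refine ⟨_, IsLOCC.round v A ?_ (fun i u huv => measureOp_of_ne v _ huv) next hnext _
      (fun ρ => rfl), Σ i, B i, inferInstance, fun b => ob b.1 b.2, ?_, ?_⟩
    · simp only [A, measureOp_self]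
      exact h1 v (by simp) o₀
    · intro ρ
      rw [Fintype.sum_sigma]
      refine Finset.sum_congr rfl fun i _ => ?_
      rw [hker]
      refine Finset.sum_congr rfl fun b _ => ?_
      have : localTensor (fun u => remainingOp v (fun u => M u (ob i b)) u) *
          localTensor (A i) = localTensor fun u => M u (ob i b) := by
        rw [localTensor_mul]
        congr 1
        funext u
        rw [remainingOp_mul_measureOp]
        split_ifs with huv
        · subst huv
          -- The operator of `v` ignores the outcomes of later parties, so the one applied in this
          -- round is also the one that belongs to the complete outcome of the branch.
          exact (hob i (fun o => M u o) h3.1 b).symm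
        · rfl
      rw [← this, Matrix.conjTranspose_mul]
      simp only [Matrix.mul_assoc]
    · intro γ f hf b
      rw [hob b.1 f (fun u hu => hf u (List.mem_cons_of_mem _ hu)) b.2]
      exact hf v (by simp) _ _

end Protocols

/-! ## Fidelity with a pure state -/

/-- The square root of $ww^*$ is $ww^*/\|w\|$; for $w=0$ this holds with the convention $0^{-1}=0$.
-/
theorem CFC_sqrt_vecMulVec {X : Type} [Fintype X] [DecidableEq X] (w : X → ℂ) :
    (CFC.sqrt (Matrix.vecMulVec w (star w))).trace = (Real.sqrt (∑ x, ‖w x‖ ^ 2) : ℂ) := by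
  set c : ℝ := ∑ x, ‖w x‖ ^ 2 with hc
  have hdot : star w ⬝ᵥ w = (c : ℂ) := by
    simp [dotProduct, hc, Complex.conj_mul']
  have hc0 : 0 ≤ c := by positivity
  have hB : CFC.sqrt (Matrix.vecMulVec w (star w)) =
      (((Real.sqrt c)⁻¹ : ℝ) : ℂ) • Matrix.vecMulVec w (star w) := by
    refine CFC.sqrt_unique ?_ ?_
    · rw [Matrix.smul_mul, Matrix.mul_smul, Matrix.vecMulVec_mul_vecMulVec, hdot, smul_smul]
      by_cases h0 : c = 0
      · have : w = 0 := by
          funext x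
          have := (Finset.sum_eq_zero_iff_of_nonneg (fun x _ => by positivity)).1 (hc ▸ h0) x
            (Finset.mem_univ x)
          simpa using this
        simp [this]
      · rw [Matrix.vecMulVec_smul, smul_smul, ← Complex.ofReal_mul, ← mul_inv,
          Real.mul_self_sqrt hc0, ← Complex.ofReal_mul, inv_mul_cancel₀ h0]
        simp
    · rw [Matrix.nonneg_iff_posSemidef]
      exact (Matrix.posSemidef_vecMulVec_self_star w).smul (by
        exact_mod_cast inv_nonneg.2 (Real.sqrt_nonneg c))
  rw [hB, Matrix.trace_smul, Matrix.trace_vecMulVec, dotProduct_comm, hdot, smul_eq_mul,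
    ← Complex.ofReal_mul]
  congr 1
  rw [inv_mul_eq_div, Real.div_sqrt]

/-- With $w=\sqrt\rho\,\psi$ the operator under the outer root is $ww^*$, so the fidelity is
$\|w\|^2$. It is thus linear in `ρ`. -/
theorem fidelity_pureState {X : Type} [Fintype X] [DecidableEq X] {ρ : Matrix X X ℂ}
    (hρ : ρ.PosSemidef) (ψ : X → ℂ) :
    fidelity ρ (pureState ψ) = (star ψ ⬝ᵥ Matrix.mulVec ρ ψ).re := by
  have hS : (CFC.sqrt ρ).conjTranspose = CFC.sqrt ρ :=
    (Matrix.nonneg_iff_posSemidef.1 (CFC.sqrt_nonneg ρ)).isHermitian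
  have hSS : CFC.sqrt ρ * CFC.sqrt ρ = ρ :=
    CFC.sqrt_mul_sqrt_self ρ (Matrix.nonneg_iff_posSemidef.2 hρ)
  set w := Matrix.mulVec (CFC.sqrt ρ) ψ with hw
  have h1 : CFC.sqrt ρ * pureState ψ * CFC.sqrt ρ = Matrix.vecMulVec w (star w) := by
    rw [pureState, Matrix.mul_vecMulVec, Matrix.vecMulVec_mul, hw, Matrix.star_mulVec, hS]
  have h2 : star ψ ⬝ᵥ Matrix.mulVec ρ ψ = star w ⬝ᵥ w := by
    conv_lhs => rw [← hSS]
    rw [hw, Matrix.star_mulVec, hS, ← Matrix.mulVec_mulVec, Matrix.dotProduct_mulVec]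
  have h3 : star w ⬝ᵥ w = ((∑ x, ‖w x‖ ^ 2 : ℝ) : ℂ) := by
    simp [dotProduct, Complex.conj_mul']
  rw [fidelity, h1, CFC_sqrt_vecMulVec, h2, h3, Complex.ofReal_re, Complex.ofReal_re,
    Real.sq_sqrt (by positivity)]

theorem pureState_conj {X Y : Type} [Fintype X] (A : Matrix Y X ℂ) (η : X → ℂ) :
    A * pureState η * A.conjTranspose = pureState (Matrix.mulVec A η) := by
  rw [pureState, pureState, Matrix.mul_vecMulVec, Matrix.vecMulVec_mul, Matrix.star_mulVec]

theorem trace_pureState {X : Type} [Fintype X] (η : X → ℂ) :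
    (pureState η).trace = ((∑ x, ‖η x‖ ^ 2 : ℝ) : ℂ) := by
  simp [pureState, Matrix.trace_vecMulVec, dotProduct, Complex.mul_conj']

theorem dotProduct_pureState_mulVec {X : Type} [Fintype X] (ψ η : X → ℂ) :
    star ψ ⬝ᵥ Matrix.mulVec (pureState η) ψ = ((‖star ψ ⬝ᵥ η‖ ^ 2 : ℝ) : ℂ) := by
  have : star η ⬝ᵥ ψ = star (star ψ ⬝ᵥ η) := by
    rw [Matrix.star_dotProduct]
  rw [pureState, Matrix.vecMulVec_mulVec, this, dotProduct_smul]
  simp [Complex.mul_conj']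

theorem norm_dotProduct_sq_le {X : Type} [Fintype X] (ψ η : X → ℂ) (hψ : ∑ x, ‖ψ x‖ ^ 2 = 1) :
    ‖star ψ ⬝ᵥ η‖ ^ 2 ≤ ∑ x, ‖η x‖ ^ 2 := by
  have h := norm_inner_le_norm (𝕜 := ℂ) (WithLp.toLp 2 ψ) (WithLp.toLp 2 η)
  have h1 : ‖WithLp.toLp 2 ψ‖ = 1 := by
    rw [EuclideanSpace.norm_eq, Real.sqrt_eq_one]
    exact hψ
  rw [h1, one_mul, EuclideanSpace.inner_toLp_toLp, dotProduct_comm] at h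
  calc _ ≤ ‖WithLp.toLp 2 η‖ ^ 2 := by gcongr
    _ = _ := EuclideanSpace.norm_sq_eq _

/-- The output of a trace-preserving map with Kraus operators `A b` on a mixture of pure states
`η q` has fidelity at least the weight of those `q` for which every branch leads to the target. -/
theorem fidelity_mixture {X Y Q B : Type} [Fintype X] [Fintype Y] [DecidableEq Y] [Fintype Q]
    [Fintype B] (A : B → Matrix Y X ℂ) (Λ : Matrix X X ℂ → Matrix Y Y ℂ)
    (hΛ : ∀ ρ, Λ ρ = ∑ b, A b * ρ * (A b).conjTranspose) (htr : ∀ ρ, (Λ ρ).trace = ρ.trace)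
    (w : Q → ℝ) (hw : ∀ q, 0 ≤ w q) (hw1 : ∑ q, w q = 1) (η : Q → X → ℂ)
    (hη : ∀ q, ∑ x, ‖η q x‖ ^ 2 = 1) (ψ : Y → ℂ) (hψ : ∑ y, ‖ψ y‖ ^ 2 = 1) (good : Finset Q)
    (hgood : ∀ q ∈ good, ∀ b, ∃ c : ℂ, Matrix.mulVec (A b) (η q) = c • ψ) :
    ∑ q ∈ good, w q ≤ fidelity (Λ (∑ q, (w q : ℂ) • pureState (η q))) (pureState ψ) ∧
      fidelity (Λ (∑ q, (w q : ℂ) • pureState (η q))) (pureState ψ) ≤ 1 := by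
  set y : Q → B → Y → ℂ := fun q b => Matrix.mulVec (A b) (η q) with hy
  have hout : Λ (∑ q, (w q : ℂ) • pureState (η q)) =
      ∑ q, ∑ b, (w q : ℂ) • pureState (y q b) := by
    rw [hΛ, Finset.sum_comm]
    refine Finset.sum_congr rfl fun b _ => ?_
    rw [Matrix.mul_sum, Matrix.sum_mul]
    refine Finset.sum_congr rfl fun q _ => ?_
    rw [Matrix.mul_smul, Matrix.smul_mul, pureState_conj]
  -- Trace preservation, applied to the single pure state `η q`.
  have hnorm : ∀ q, ∑ b, ∑ z, ‖y q b z‖ ^ 2 = 1 := by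
    intro q
    have h := htr (pureState (η q))
    rw [hΛ, trace_pureState, hη q, Matrix.trace_sum] at h
    simp only [pureState_conj, trace_pureState] at h
    exact_mod_cast h
  have hpsd : (Λ (∑ q, (w q : ℂ) • pureState (η q))).PosSemidef := by
    rw [hout]
    refine Matrix.posSemidef_sum _ fun q _ => Matrix.posSemidef_sum _ fun b _ => ?_
    exact (Matrix.posSemidef_vecMulVec_self_star _).smul (by exact_mod_cast hw q)
  have hF : fidelity (Λ (∑ q, (w q : ℂ) • pureState (η q))) (pureState ψ) =
      ∑ q, w q * ∑ b, ‖star ψ ⬝ᵥ y q b‖ ^ 2 := by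
    rw [fidelity_pureState hpsd, hout]
    simp only [Matrix.sum_mulVec, dotProduct_sum, Matrix.smul_mulVec, dotProduct_smul,
      dotProduct_pureState_mulVec, Complex.re_sum, smul_eq_mul, ← Complex.ofReal_mul,
      Complex.ofReal_re, Finset.mul_sum]
  have hle : ∀ q, ∑ b, ‖star ψ ⬝ᵥ y q b‖ ^ 2 ≤ 1 := fun q =>
    (Finset.sum_le_sum fun b _ => norm_dotProduct_sq_le ψ (y q b) hψ).trans (hnorm q).le
  -- Every branch vector is parallel to `ψ` here, so the Cauchy–Schwarz estimate is an equality.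
  have heq : ∀ q ∈ good, ∑ b, ‖star ψ ⬝ᵥ y q b‖ ^ 2 = 1 := by
    intro q hq
    rw [← hnorm q]
    refine Finset.sum_congr rfl fun b _ => ?_
    obtain ⟨c, hc⟩ := hgood q hq b
    have h1 : star ψ ⬝ᵥ ψ = 1 := by
      have : star ψ ⬝ᵥ ψ = ((∑ z, ‖ψ z‖ ^ 2 : ℝ) : ℂ) := by
        simp [dotProduct, Complex.conj_mul']
      rw [this, hψ, Complex.ofReal_one]
    simp only [hy, hc, dotProduct_smul, h1, Pi.smul_apply, smul_eq_mul, mul_one, norm_mul, mul_pow]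
    rw [← Finset.mul_sum, hψ, mul_one]
  rw [hF]
  constructor
  · calc ∑ q ∈ good, w q = ∑ q ∈ good, w q * ∑ b, ‖star ψ ⬝ᵥ y q b‖ ^ 2 :=
        Finset.sum_congr rfl fun q hq => by rw [heq q hq, mul_one]
      _ ≤ _ := Finset.sum_le_univ_sum_of_nonneg fun q =>
        mul_nonneg (hw q) (by positivity)
  · calc ∑ q, w q * ∑ b, ‖star ψ ⬝ᵥ y q b‖ ^ 2 ≤ ∑ q, w q * 1 := by
          gcongr with q
          · exact hw q
          · exact hle q
      _ = 1 := by simpa using hw1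

/-! ## Distillation gadgets

Two parties share a vector with amplitude matrix `T` in the local basis `H × H`. -/

/-- A one-way distillation protocol of two parties: the first measures with Kraus operators `A s`
and announces `s`, the second measures with Kraus operators `B s r`. -/
structure Gadget (H K : Type) [Fintype H] [DecidableEq H] [Fintype K] where
  S : Type
  R : Type
  [fintypeS : Fintype S]
  [fintypeR : Fintype R]
  A : S → Matrix K H ℂ
  B : S → R → Matrix K H ℂ
  sum_A : ∑ s, (A s).conjTranspose * A s = 1
  sum_B : ∀ s, ∑ r, (B s r).conjTranspose * B s r = 1

attribute [instance] Gadget.fintypeS Gadget.fintypeR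

namespace Gadget

variable {H K L : Type} [Fintype H] [DecidableEq H] [Fintype K] [DecidableEq K] [Fintype L]

/-- In some branch of the protocol, the shared amplitude matrix `T` becomes `T'`. -/
def Maps (g : Gadget H K) (T : Matrix H H ℂ) (T' : Matrix K K ℂ) : Prop :=
  ∃ s r, T' = g.A s * T * (g.B s r).transpose

/-- First `g`, then `g'`. -/
def comp (g' : Gadget K L) (g : Gadget H K) : Gadget H L where
  S := g.S × g'.S
  R := g.R × g'.R
  A s := g'.A s.2 * g.A s.1
  B s r := g'.B s.2 r.2 * g.B s.1 r.1
  sum_A := by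
    rw [Fintype.sum_prod_type, ← g.sum_A]
    refine Finset.sum_congr rfl fun s _ => ?_
    have : ∀ s', (g'.A s' * g.A s).conjTranspose * (g'.A s' * g.A s) =
        (g.A s).conjTranspose * ((g'.A s').conjTranspose * g'.A s') * g.A s := by
      intro s'
      simp only [Matrix.conjTranspose_mul, Matrix.mul_assoc]
    simp only [this]
    rw [← Matrix.sum_mul, ← Matrix.mul_sum, g'.sum_A, Matrix.mul_one]
  sum_B s := by
    rw [Fintype.sum_prod_type, ← g.sum_B s.1]
    refine Finset.sum_congr rfl fun r _ => ?_
    have : ∀ r', (g'.B s.2 r' * g.B s.1 r).conjTranspose * (g'.B s.2 r' * g.B s.1 r) =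
        (g.B s.1 r).conjTranspose * ((g'.B s.2 r').conjTranspose * g'.B s.2 r') * g.B s.1 r := by
      intro r'
      simp only [Matrix.conjTranspose_mul, Matrix.mul_assoc]
    simp only [this]
    rw [← Matrix.sum_mul, ← Matrix.mul_sum, g'.sum_B, Matrix.mul_one]

theorem Maps.of_comp {g' : Gadget K L} {g : Gadget H K} {T : Matrix H H ℂ} {T'' : Matrix L L ℂ}
    (h : (g'.comp g).Maps T T'') : ∃ T', g.Maps T T' ∧ g'.Maps T' T'' := by
  obtain ⟨s, r, rfl⟩ := h
  refine ⟨_, ⟨s.1, r.1, rfl⟩, s.2, r.2, ?_⟩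
  simp only [comp, Matrix.transpose_mul, Matrix.mul_assoc]

/-- The gadgets `g j` side by side. -/
def pi {J : Type} [Fintype J] [DecidableEq J] {H K : J → Type} [∀ j, Fintype (H j)]
    [∀ j, DecidableEq (H j)] [∀ j, Fintype (K j)] (g : ∀ j, Gadget (H j) (K j)) :
    Gadget (∀ j, H j) (∀ j, K j) where
  S := ∀ j, (g j).S
  R := ∀ j, (g j).R
  A s := localTensor fun j => (g j).A (s j)
  B s r := localTensor fun j => (g j).B (s j) (r j)
  sum_A := by
    simp only [localTensor_conjTranspose, localTensor_mul]
    rw [sum_localTensor fun j s => ((g j).A s).conjTranspose * (g j).A s]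
    simp only [(g _).sum_A]
    exact localTensor_one
  sum_B s := by
    simp only [localTensor_conjTranspose, localTensor_mul]
    rw [sum_localTensor fun j r => ((g j).B (s j) r).conjTranspose * (g j).B (s j) r]
    simp only [(g _).sum_B]
    exact localTensor_one

theorem Maps.of_pi {J : Type} [Fintype J] [DecidableEq J] {H K : J → Type} [∀ j, Fintype (H j)]
    [∀ j, DecidableEq (H j)] [∀ j, Fintype (K j)] {g : ∀ j, Gadget (H j) (K j)}
    {T : ∀ j, Matrix (H j) (H j) ℂ} {T' : Matrix (∀ j, K j) (∀ j, K j) ℂ}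
    (h : (pi g).Maps (localTensor T) T') :
    ∃ T'', T' = localTensor T'' ∧ ∀ j, (g j).Maps (T j) (T'' j) := by
  obtain ⟨s, r, rfl⟩ := h
  refine ⟨fun j => (g j).A (s j) * T j * ((g j).B (s j) (r j)).transpose, ?_,
    fun j => ⟨s j, r j, rfl⟩⟩
  simp only [pi, localTensor_transpose, localTensor_mul]

/-- The gadget `g` after a renaming of the basis. -/
def reindex (g : Gadget H K) {H' : Type} [Fintype H'] [DecidableEq H'] (e : H' ≃ H) :
    Gadget H' K where
  S := g.S
  R := g.R
  A s := (g.A s).submatrix id e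
  B s r := (g.B s r).submatrix id e
  sum_A := by
    rw [← Matrix.submatrix_one_equiv e, ← g.sum_A]
    ext x y
    simp [Matrix.sum_apply, Matrix.mul_apply]
  sum_B s := by
    rw [← Matrix.submatrix_one_equiv e, ← g.sum_B s]
    ext x y
    simp [Matrix.sum_apply, Matrix.mul_apply]

theorem Maps.of_reindex {g : Gadget H K} {H' : Type} [Fintype H'] [DecidableEq H'] {e : H' ≃ H}
    {T : Matrix H' H' ℂ} {T' : Matrix K K ℂ} (h : (g.reindex e).Maps T T') :
    g.Maps (T.submatrix e.symm e.symm) T' := by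
  obtain ⟨s, r, rfl⟩ := h
  refine ⟨s, r, ?_⟩
  have hT : T = (T.submatrix e.symm e.symm).submatrix e e := by simp
  conv_lhs => rw [hT]
  simp only [reindex, Matrix.transpose_submatrix]
  rw [Matrix.submatrix_mul_equiv, Matrix.submatrix_mul_equiv, Matrix.submatrix_id_id]

/-- Both parties rotate: `T ↦ F T Fᴴ`. -/
def rotate (F : Matrix H H ℂ) (hF : F.conjTranspose * F = 1) : Gadget H H where
  S := Unit
  R := Unit
  A _ := F
  -- The second operator enters transposed, so the entrywise conjugate produces the adjoint of `F`.
  B _ _ := F.map star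
  sum_A := by simpa using hF
  sum_B _ := by
    have : (F.map star).conjTranspose * F.map star = (F.conjTranspose * F).map star := by
      ext x y
      simp [Matrix.mul_apply, mul_comm]
    simp only [Finset.univ_unique, Finset.sum_const, Finset.card_singleton, one_smul]
    rw [this, hF]
    ext x y
    by_cases h : x = y <;> simp [Matrix.one_apply, h]

theorem Maps.of_rotate {F : Matrix H H ℂ} {hF : F.conjTranspose * F = 1} {T T' : Matrix H H ℂ}
    (h : (rotate F hF).Maps T T') : T' = F * T * F.conjTranspose := by
  obtain ⟨s, r, rfl⟩ := h
  rfl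

/-- The matrix of a partial inverse of `f`. -/
def selectOp (f : K → H) : Matrix K H ℂ := Matrix.of fun x p => if p = f x then 1 else 0

/-- The images of the `f i` partition the basis of `H`, so the operators form a complete projective
measurement followed by relabelling. -/
theorem sum_selectOp {ι : Type} [Fintype ι] (f : ι → K → H)
    (hf : Function.Bijective fun ix : ι × K => f ix.1 ix.2) :
    ∑ i, (selectOp (f i)).conjTranspose * selectOp (f i) = 1 := by
  ext p q
  simp only [Matrix.sum_apply, Matrix.mul_apply, Matrix.conjTranspose_apply, selectOp,
    Matrix.of_apply]
  rw [← Fintype.sum_prod_type', Function.Bijective.sum_comp hf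
    (g := fun h => star (if p = h then (1 : ℂ) else 0) * if q = h then 1 else 0)]
  by_cases h : p = q <;> simp [h, Matrix.one_apply]

theorem selectOp_mul_mul_transpose (f f' : K → H) (T : Matrix H H ℂ) (x y : K) :
    (selectOp f * T * (selectOp f').transpose) x y = T (f x) (f' y) := by
  simp [Matrix.mul_apply, selectOp]

end Gadget

/-! ### Scalar, diagonal and shift-invariant matrices -/

/-- Multiples of the identity. -/
def IsScalarMatrix {X : Type} [DecidableEq X] (T : Matrix X X ℂ) : Prop := ∃ c : ℂ, T = c • 1

theorem IsScalarMatrix.isDiag {X : Type} [DecidableEq X] {T : Matrix X X ℂ}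
    (h : IsScalarMatrix T) : T.IsDiag := by
  obtain ⟨c, rfl⟩ := h
  intro x y hxy
  simp [hxy]

section ShiftInvariant

variable {X : Type} [AddCommGroup X]

/-- Matrices that commute with all shifts. -/
def IsShiftInvariant (T : Matrix X X ℂ) : Prop := ∀ x y z, T (x + z) (y + z) = T x y

theorem IsShiftInvariant.isScalarMatrix [DecidableEq X] {T : Matrix X X ℂ}
    (h : IsShiftInvariant T) (h' : T.IsDiag) : IsScalarMatrix T := by
  refine ⟨T 0 0, ?_⟩
  ext x y
  by_cases hxy : x = y
  · subst hxy
    simpa using h 0 0 x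
  · simp [hxy, h' hxy]

theorem IsScalarMatrix.isShiftInvariant [DecidableEq X] {T : Matrix X X ℂ}
    (h : IsScalarMatrix T) : IsShiftInvariant T := by
  obtain ⟨c, rfl⟩ := h
  intro x y z
  simp [Matrix.one_apply]

end ShiftInvariant

section Majority

variable {X : Type} [AddCommGroup X] [Fintype X] [DecidableEq X]

/-- The offset of the majority among `0` and the two entries of `r`. -/
def majorityOffset (r : X × X) : X := if r.1 = r.2 then r.1 else 0

/-- The code word `(x, x + a, x + b)`. -/
def shiftedTriple (a : X × X) (x : X) : Fin 3 → X := ![x, x + a.1, x + a.2]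

theorem shiftedTriple_bijective :
    Function.Bijective fun ax : (X × X) × X => shiftedTriple ax.1 ax.2 := by
  constructor
  · rintro ⟨⟨a, b⟩, x⟩ ⟨⟨a', b'⟩, x'⟩ h
    have h0 := congrFun h 0
    have h1 := congrFun h 1
    have h2 := congrFun h 2
    simp only [shiftedTriple, Matrix.cons_val] at h0 h1 h2
    subst h0
    simp_all
  · intro p
    refine ⟨((p 1 - p 0, p 2 - p 0), p 0), ?_⟩
    funext i
    fin_cases i <;> simp [shiftedTriple]

/-- Three links become one: both parties compare their three systems, and the second one corrects
according to the majority. -/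
def majorityGadget : Gadget (Fin 3 → X) X where
  S := X × X
  R := X × X
  A s := Gadget.selectOp (shiftedTriple s)
  -- Here `r` is the syndrome relative to the announced one: apart from errors the second triple
  -- differs from the first by `(0, r.1, r.2)`. The subtracted majority of these three offsets is
  -- the correction.
  B s r := Gadget.selectOp fun y => shiftedTriple (r + s) (y - majorityOffset r)
  sum_A := Gadget.sum_selectOp _ shiftedTriple_bijective
  sum_B s := by
    refine Gadget.sum_selectOp _ ?_
    let e : (X × X) × X ≃ (X × X) × X :=
      { toFun := fun rx => (rx.1 + s, rx.2 - majorityOffset rx.1)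
        invFun := fun rx => (rx.1 - s, rx.2 + majorityOffset (rx.1 - s))
        left_inv := fun rx => by simp
        right_inv := fun rx => by simp }
    exact shiftedTriple_bijective.comp e.bijective

theorem majorityGadget_maps {T : Fin 3 → Matrix X X ℂ} {T' : Matrix X X ℂ}
    (h : majorityGadget.Maps (localTensor T) T') : ∃ (a r : X × X), ∀ x y,
      T' x y = T 0 x (y - majorityOffset r) *
        T 1 (x + a.1) (y - majorityOffset r + (r.1 + a.1)) *
        T 2 (x + a.2) (y - majorityOffset r + (r.2 + a.2)) := by
  obtain ⟨a, r, rfl⟩ := h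
  refine ⟨a, r, fun x y => ?_⟩
  simp only [majorityGadget, Gadget.selectOp_mul_mul_transpose, localTensor_apply,
    Fin.prod_univ_three]
  rfl

/-- In a nonzero entry `(x, y)` every scalar link `i` forces `x = y - majorityOffset r + rᵢ`, where
`r₀ = 0`. Two such links have equal `rᵢ`, which is then the majority offset, and so `x = y`. Nothing
is assumed about the third link. -/
theorem majorityGadget_isDiag {T : Fin 3 → Matrix X X ℂ} {T' : Matrix X X ℂ}
    (h : majorityGadget.Maps (localTensor T) T')
    (hT : {i | ¬ IsScalarMatrix (T i)}.Subsingleton) : T'.IsDiag := by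
  obtain ⟨a, r, hr⟩ := majorityGadget_maps h
  intro x y hxy
  rw [hr]
  by_contra hne
  rw [← ne_eq, mul_ne_zero_iff, mul_ne_zero_iff] at hne
  obtain ⟨⟨h0, h1⟩, h2⟩ := hne
  have e0 : IsScalarMatrix (T 0) → x = y - majorityOffset r := fun h =>
    not_imp_comm.1 (fun h' => h.isDiag h') h0
  have e1 : IsScalarMatrix (T 1) → x = y - majorityOffset r + r.1 := fun h => by
    have := not_imp_comm.1 (fun h' => h.isDiag h') h1
    rwa [← add_assoc, add_left_inj] at this
  have e2 : IsScalarMatrix (T 2) → x = y - majorityOffset r + r.2 := fun h => by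
    have := not_imp_comm.1 (fun h' => h.isDiag h') h2
    rwa [← add_assoc, add_left_inj] at this
  apply hxy
  have key : ∀ i j : Fin 3, i ≠ j → IsScalarMatrix (T i) ∨ IsScalarMatrix (T j) := by
    intro i j hij
    by_contra hcon
    rw [not_or] at hcon
    exact hij (hT hcon.1 hcon.2)
  have hcases : (IsScalarMatrix (T 0) ∧ IsScalarMatrix (T 1)) ∨
      (IsScalarMatrix (T 0) ∧ IsScalarMatrix (T 2)) ∨
      (IsScalarMatrix (T 1) ∧ IsScalarMatrix (T 2)) := by
    have h01 := key 0 1 (by decide)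
    have h02 := key 0 2 (by decide)
    have h12 := key 1 2 (by decide)
    tauto
  rcases hcases with ⟨ha, hb⟩ | ⟨ha, hb⟩ | ⟨ha, hb⟩
  · have hr1 : r.1 = 0 := by simpa using (e0 ha).symm.trans (e1 hb)
    have : majorityOffset r = 0 := by simp [majorityOffset, hr1]
    simpa [this] using e0 ha
  · have hr2 : r.2 = 0 := by simpa using (e0 ha).symm.trans (e2 hb)
    have : majorityOffset r = 0 := by
      rw [majorityOffset]
      split_ifs with h
      · exact h.trans hr2
      · rfl
    simpa [this] using e0 ha
  · have hr12 : r.1 = r.2 := by simpa using (e1 ha).symm.trans (e2 hb)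
    have : majorityOffset r = r.1 := by simp [majorityOffset, hr12]
    simpa [this] using e1 ha

/-- A simultaneous shift of `x` and `y` shifts both arguments of all three factors by the same
element. -/
theorem majorityGadget_isShiftInvariant {T : Fin 3 → Matrix X X ℂ} {T' : Matrix X X ℂ}
    (h : majorityGadget.Maps (localTensor T) T') (hT : ∀ i, IsShiftInvariant (T i)) :
    IsShiftInvariant T' := by
  obtain ⟨a, r, hr⟩ := majorityGadget_maps h
  intro x y z
  have e : y + z - majorityOffset r = y - majorityOffset r + z := add_sub_right_comm _ _ _
  rw [hr, hr, ← hT 0 x _ z, ← hT 1 (x + a.1) _ z, ← hT 2 (x + a.2) _ z, e,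
    add_right_comm x z, add_right_comm x z, add_right_comm (y - majorityOffset r) z,
    add_right_comm (y - majorityOffset r) z]

theorem majorityGadget_isScalarMatrix {T : Fin 3 → Matrix X X ℂ} {T' : Matrix X X ℂ}
    (h : majorityGadget.Maps (localTensor T) T') (hT : ∀ i, IsShiftInvariant (T i))
    (hT' : {i | ¬ IsScalarMatrix (T i)}.Subsingleton) : IsScalarMatrix T' :=
  (majorityGadget_isShiftInvariant h hT).isScalarMatrix (majorityGadget_isDiag h hT')

end Majority

/-! ### Characters, Weyl operators and the concatenated code -/

/-- The positions of the concatenated code with `m` levels. -/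
def CodeIndex : ℕ → Type
  | 0 => Unit
  | m + 1 => (Fin 3 × Fin 3) × CodeIndex m

instance CodeIndex.fintype : ∀ m, Fintype (CodeIndex m)
  | 0 => inferInstanceAs (Fintype Unit)
  | m + 1 => @instFintypeProd _ _ _ (CodeIndex.fintype m)

instance CodeIndex.decidableEq : ∀ m, DecidableEq (CodeIndex m)
  | 0 => inferInstanceAs (DecidableEq Unit)
  | m + 1 => @instDecidableEqProd _ _ _ (CodeIndex.decidableEq m)

theorem CodeIndex.card : ∀ m, Fintype.card (CodeIndex m) = 9 ^ m
  | 0 => rfl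
  | m + 1 => by
    have : Fintype.card (CodeIndex (m + 1)) =
        Fintype.card ((Fin 3 × Fin 3) × CodeIndex m) := rfl
    rw [this, Fintype.card_prod, CodeIndex.card m, pow_succ]
    simp [mul_comm]

/-- The concatenated code corrects errors in the positions `bad`: on each level, at most one of
nine blocks is not correctable. -/
def Correctable : ∀ m, (CodeIndex m → Prop) → Prop
  | 0, bad => ¬ bad ()
  | m + 1, bad => {i | ¬ Correctable m fun x => bad (i, x)}.Subsingleton

/-- A nondegenerate pairing of a finite abelian group with itself, with values in the circle. -/
structure Pairing (X : Type) [AddCommGroup X] [Fintype X] [DecidableEq X] where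
  χ : X → X → ℂ
  comm : ∀ x y, χ x y = χ y x
  map_add : ∀ x y z, χ (x + y) z = χ x z * χ y z
  star_eq : ∀ x z, star (χ x z) = χ (-x) z
  sum_eq : ∀ x, ∑ z, χ x z = if x = 0 then (Fintype.card X : ℂ) else 0

namespace Pairing

variable {X : Type} [AddCommGroup X] [Fintype X] [DecidableEq X] (Q : Pairing X)

theorem star_mul (x y z : X) : star (Q.χ x z) * Q.χ y z = Q.χ (y - x) z := by
  rw [Q.star_eq, ← Q.map_add, neg_add_eq_sub]

/-- Unimodularity is not an axiom of a pairing. The values `χ 0 w` are idempotent, hence `0` or `1`,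
and their sum over `w` is the order of the group, so none of them vanishes. -/
theorem star_mul_self (x z : X) : star (Q.χ x z) * Q.χ x z = 1 := by
  have h0 : Q.χ 0 z * Q.χ 0 z = Q.χ 0 z := by rw [← Q.map_add, add_zero]
  have h1 : Q.χ 0 z ≠ 0 := by
    intro h
    have hall : ∀ w, Q.χ w z = 0 := by
      intro w
      have := Q.map_add w 0 z
      rwa [add_zero, h, mul_zero] at this
    have h2 := Q.sum_eq 0
    have h3 : ∀ w, Q.χ 0 w = 1 ∨ Q.χ 0 w = 0 := by
      intro w
      have : Q.χ 0 w * (Q.χ 0 w - 1) = 0 := by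
        rw [mul_sub, ← Q.map_add, add_zero, mul_one, sub_self]
      rcases mul_eq_zero.1 this with h | h
      · exact Or.inr h
      · exact Or.inl (sub_eq_zero.1 h)
    have h4 : (∑ w, Q.χ 0 w).re < Fintype.card X := by
      rw [Complex.re_sum, ← Finset.card_univ, Finset.card_eq_sum_ones, Nat.cast_sum]
      refine Finset.sum_lt_sum (fun w _ => ?_) ⟨z, Finset.mem_univ z, by simp [h]⟩
      rcases h3 w with h | h <;> simp [h]
    rw [h2] at h4
    simp at h4
  rw [Q.star_mul, sub_self]
  exact mul_right_cancel₀ h1 (by rw [h0, one_mul])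

/-- The Fourier matrix. -/
def fourier : Matrix X X ℂ :=
  Matrix.of fun x y => (((Real.sqrt (Fintype.card X))⁻¹ : ℝ) : ℂ) * Q.χ x y

theorem card_ne_zero : ((Fintype.card X : ℝ) : ℂ) ≠ 0 := by
  exact_mod_cast Fintype.card_ne_zero (α := X)

theorem fourier_unitary : Q.fourier.conjTranspose * Q.fourier = 1 := by
  ext x y
  have : ∀ z, star (Q.fourier z x) * Q.fourier z y =
      ((Fintype.card X : ℝ) : ℂ)⁻¹ * Q.χ (y - x) z := by
    intro z
    have h1 : (((Real.sqrt (Fintype.card X))⁻¹ : ℝ) : ℂ) * ((Real.sqrt (Fintype.card X))⁻¹ : ℝ) =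
        ((Fintype.card X : ℝ) : ℂ)⁻¹ := by
      rw [← Complex.ofReal_mul, ← mul_inv, Real.mul_self_sqrt (by positivity), Complex.ofReal_inv]
    rw [← h1, ← Q.star_mul, fourier, Matrix.of_apply, Matrix.of_apply, star_mul', Q.comm z x,
      Q.comm z y]
    have : star ((((Real.sqrt (Fintype.card X))⁻¹ : ℝ) : ℂ)) =
      (((Real.sqrt (Fintype.card X))⁻¹ : ℝ) : ℂ) := Complex.conj_ofReal _
    rw [this]
    ring
  simp only [Matrix.mul_apply, Matrix.conjTranspose_apply, this]
  rw [← Finset.mul_sum, Q.sum_eq, Matrix.one_apply]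
  by_cases h : x = y
  · have := card_ne_zero (X := X)
    simp only [h, sub_self, if_true]
    exact inv_mul_cancel₀ this
  · have : y - x ≠ 0 := fun h' => h (sub_eq_zero.1 h').symm
    simp [h, this]

/-- The entry at `(x, y)` is a combination of products of the value of a character at `x` with its
conjugate at `y`, in which a common shift cancels. Phase errors thus become shift errors. -/
theorem fourier_conj_isShiftInvariant {D : Matrix X X ℂ} (hD : D.IsDiag) :
    IsShiftInvariant (Q.fourier * D * Q.fourier.conjTranspose) := by
  have key : ∀ x y, (Q.fourier * D * Q.fourier.conjTranspose) x y =
      ∑ z, D z z * star (Q.fourier y z) * Q.fourier x z := by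
    intro x y
    rw [Matrix.mul_apply]
    refine Finset.sum_congr rfl fun z _ => ?_
    rw [Matrix.mul_apply, Finset.sum_eq_single z (fun w _ hw => by rw [hD hw, mul_zero])
      (by simp), Matrix.conjTranspose_apply]
    ring
  intro x y z
  rw [key, key]
  refine Finset.sum_congr rfl fun w _ => ?_
  rw [mul_assoc, mul_assoc]
  congr 1
  simp only [fourier, Matrix.of_apply, star_mul', Q.map_add]
  linear_combination (star (((Real.sqrt (Fintype.card X))⁻¹ : ℝ) : ℂ)) * star (Q.χ y w) *
    (((Real.sqrt (Fintype.card X))⁻¹ : ℝ) : ℂ) * Q.χ x w * Q.star_mul_self z w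

theorem fourier_conj_isScalarMatrix {D : Matrix X X ℂ} (hD : IsScalarMatrix D) :
    IsScalarMatrix (Q.fourier * D * Q.fourier.conjTranspose) := by
  obtain ⟨c, rfl⟩ := hD
  refine ⟨c, ?_⟩
  rw [Matrix.mul_smul, Matrix.mul_one, Matrix.smul_mul,
    mul_eq_one_comm.1 Q.fourier_unitary]

/-- Nine links become one. -/
def nineGadget : Gadget (Fin 3 → Fin 3 → X) X :=
  majorityGadget.comp ((Gadget.pi fun _ => Gadget.rotate Q.fourier Q.fourier_unitary).comp
    (Gadget.pi fun _ => majorityGadget))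

/-- At most one inner block contains the bad link. It comes out diagonal and the other blocks
scalar, so after the Fourier transform all three are shift-invariant and at most one is not scalar.
The outer majority then gives a matrix that is both shift-invariant and diagonal. -/
theorem nineGadget_isScalarMatrix {T : Fin 3 → Fin 3 → Matrix X X ℂ} {T' : Matrix X X ℂ}
    (h : Q.nineGadget.Maps (localTensor fun i => localTensor (T i)) T')
    (hT : {i : Fin 3 × Fin 3 | ¬ IsScalarMatrix (T i.1 i.2)}.Subsingleton) :
    IsScalarMatrix T' := by
  obtain ⟨T₂, h₂, h₃⟩ := h.of_comp
  obtain ⟨T₁, h₁, h₂⟩ := h₂.of_comp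
  obtain ⟨T₁, rfl, hm⟩ := h₁.of_pi
  obtain ⟨T₂, rfl, hr⟩ := h₂.of_pi
  have hdiag : ∀ i, (T₁ i).IsDiag := fun i => majorityGadget_isDiag (hm i) fun j hj j' hj' =>
    congrArg Prod.snd (hT (show (i, j) ∈ _ from hj) (show (i, j') ∈ _ from hj'))
  have hscalar : ∀ i, (∀ j, IsScalarMatrix (T i j)) → IsScalarMatrix (T₁ i) := fun i hi =>
    majorityGadget_isScalarMatrix (hm i) (fun j => (hi j).isShiftInvariant)
      fun j hj => absurd (hi j) hj
  have e : ∀ i, T₂ i = Q.fourier * T₁ i * Q.fourier.conjTranspose := fun i => (hr i).of_rotate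
  refine majorityGadget_isScalarMatrix h₃
    (fun i => e i ▸ Q.fourier_conj_isShiftInvariant (hdiag i)) ?_
  intro i hi i' hi'
  have hex : ∀ i, ¬ IsScalarMatrix (T₂ i) → ∃ j, ¬ IsScalarMatrix (T i j) := by
    intro i hi
    by_contra! hcon
    exact hi (e i ▸ Q.fourier_conj_isScalarMatrix (hscalar i hcon))
  obtain ⟨j, hj⟩ := hex i hi
  obtain ⟨j', hj'⟩ := hex i' hi'
  exact congrArg Prod.fst (hT (show (i, j) ∈ _ from hj) (show (i', j') ∈ _ from hj'))

/-- The concatenated code distils one perfect link from links with correctable errors. -/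
theorem exists_gadget (Q : Pairing X) (m : ℕ) : ∃ g : Gadget (CodeIndex m → X) X,
    ∀ (T : CodeIndex m → Matrix X X ℂ) (T' : Matrix X X ℂ) (bad : CodeIndex m → Prop),
      g.Maps (localTensor T) T' → (∀ i, ¬ bad i → IsScalarMatrix (T i)) → Correctable m bad →
      IsScalarMatrix T' := by
  induction m with
  | zero =>
    let e : (CodeIndex 0 → X) ≃ X := Equiv.funUnique Unit X
    refine ⟨(Gadget.rotate (1 : Matrix X X ℂ) (by simp)).reindex e, ?_⟩
    intro T T' bad h hT hbad
    have h' := h.of_reindex.of_rotate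
    obtain ⟨c, hc⟩ := hT () hbad
    refine ⟨c, ?_⟩
    rw [h', ← hc]
    ext x y
    have : (Finset.univ : Finset (CodeIndex 0)) = {()} := rfl
    simp only [Matrix.one_mul, Matrix.conjTranspose_one, Matrix.mul_one, Matrix.submatrix_apply,
      localTensor_apply, this]
    exact Finset.prod_singleton _ _
  | succ m ih =>
    obtain ⟨g, hg⟩ := ih
    let e : (CodeIndex (m + 1) → X) ≃ (Fin 3 → Fin 3 → CodeIndex m → X) :=
      (Equiv.curry (Fin 3 × Fin 3) (CodeIndex m) X).trans (Equiv.curry (Fin 3) (Fin 3) _)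
    refine ⟨(Q.nineGadget.comp (Gadget.pi fun _ => Gadget.pi fun _ => g)).reindex e, ?_⟩
    intro T T' bad h hT hbad
    have h := h.of_reindex
    have hTe : (localTensor T).submatrix e.symm e.symm =
        localTensor fun i => localTensor fun j => localTensor fun x => T ((i, j), x) := by
      ext p q
      simp only [Matrix.submatrix_apply, localTensor_apply]
      rw [← Fintype.prod_prod_type', ← Fintype.prod_prod_type']
      rfl
    rw [hTe] at h
    obtain ⟨T₁, h₁, h₂⟩ := h.of_comp
    obtain ⟨T₁, rfl, h₃⟩ := h₁.of_pi
    choose T₂ hT₂ h₂' using fun i => (h₃ i).of_pi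
    obtain rfl : T₁ = fun i => localTensor (T₂ i) := funext hT₂
    refine Q.nineGadget_isScalarMatrix h₂ ?_
    refine Set.Subsingleton.anti hbad ?_
    rintro ⟨i, j⟩ hij hcor
    exact hij (hg _ _ _ (h₂' i j) (fun x hx => hT _ hx) hcor)

/-- The Weyl operators (shifts and characters). -/
def weyl (s : X × X) : Matrix X X ℂ := Matrix.of fun x y => if y = x + s.1 then Q.χ s.2 x else 0

theorem weyl_unitary (s : X × X) : (Q.weyl s).conjTranspose * Q.weyl s = 1 := by
  ext x y
  simp only [Matrix.mul_apply, Matrix.conjTranspose_apply, weyl, Matrix.of_apply]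
  rw [Finset.sum_eq_single (x - s.1)]
  · by_cases h : x = y
    · subst h
      simpa using Q.star_mul_self _ _
    · simp [h, Ne.symm h]
  · intro z _ hz
    have : x ≠ z + s.1 := fun h => hz (by rw [h, add_sub_cancel_right])
    simp [this]
  · simp

/-- The second component of `s` enforces `x = x'` by orthogonality of characters, the first is then
determined by `y - x`. This is the completeness of the Bell measurement in all teleportation steps.
-/
theorem weyl_complete (x y x' y' : X) :
    ∑ s, star (Q.weyl s x y) * Q.weyl s x' y' =
      if x = x' ∧ y = y' then (Fintype.card X : ℂ) else 0 := by
  have : ∀ s, star (Q.weyl s x y) * Q.weyl s x' y' =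
      (if y = x + s.1 ∧ y' = x' + s.1 then 1 else 0) * Q.χ (x' - x) s.2 := by
    intro s
    simp only [weyl, Matrix.of_apply]
    by_cases h : y = x + s.1 <;> by_cases h' : y' = x' + s.1 <;> simp [h, h']
    rw [Q.comm s.2 x, Q.comm s.2 x']
    exact Q.star_mul _ _ _
  simp only [this]
  have h2 : ∀ a, ∑ b, (if y = x + a ∧ y' = x' + a then (1 : ℂ) else 0) * Q.χ (x' - x) b =
      (if y = x + a ∧ y' = x' + a then 1 else 0) *
        if x' - x = 0 then (Fintype.card X : ℂ) else 0 := fun a => by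
    rw [← Finset.mul_sum, Q.sum_eq]
  rw [Fintype.sum_prod_type, Finset.sum_congr rfl fun a _ => h2 a, ← Finset.sum_mul]
  by_cases hx : x = x'
  · subst hx
    simp only [sub_self, if_true, true_and]
    by_cases hy : y = y'
    · subst hy
      rw [Finset.sum_eq_single (y - x)]
      · simp
      · intro z _ hz
        have : y ≠ x + z := fun h => hz (by rw [h, add_sub_cancel_left])
        simp [this]
      · simp
    · have : ∀ z, ¬ (y = x + z ∧ y' = x + z) := fun z h => hy (h.1.trans h.2.symm)
      simp [hy, this]
  · have : x' - x ≠ 0 := fun h => hx (sub_eq_zero.1 h).symm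
    simp [hx, this]

end Pairing

/-- The cyclic group with the pairing $\exp(2\pi i\,xy/d)$. -/
theorem exists_pairing (d : ℕ) [NeZero d] :
    ∃ _ : AddCommGroup (Fin d), Nonempty (Pairing (Fin d)) := by
  obtain ⟨n, rfl⟩ := Nat.exists_eq_succ_of_ne_zero (NeZero.ne d)
  refine ⟨inferInstanceAs (AddCommGroup (ZMod (n + 1))), ⟨?_⟩⟩
  have : Pairing (ZMod (n + 1)) :=
    { χ := fun x y => ZMod.stdAddChar (x * y)
      comm := fun x y => by rw [mul_comm]
      map_add := fun x y z => by rw [add_mul, AddChar.map_add_eq_mul]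
      star_eq := fun x z => by
        rw [neg_mul, AddChar.map_neg_eq_conj]
        rfl
      sum_eq := fun x => by
        have := AddChar.sum_mulShift x (ZMod.isPrimitive_stdAddChar (n + 1))
        simpa [mul_comm] using this }
  exact this

/-! ## The isotropic network state as a mixture of pure states -/

section NetworkState

/-- A link is either a perfect link (`none`) or in a product state of the standard basis. -/
abbrev LinkLabel (d : ℕ) : Type := Option (Fin d × Fin d)

/-- The weight of a link label in the isotropic state. -/
def linkWeight (d : ℕ) (p : ℝ) : LinkLabel d → ℝ
  | none => p
  | some _ => (1 - p) / (d : ℝ) ^ 2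

/-- The pure state of a link with a given label. -/
def linkVector (d : ℕ) : LinkLabel d → Matrix (Fin d) (Fin d) ℂ
  | none => (((Real.sqrt d)⁻¹ : ℝ) : ℂ) • 1
  | some c => Matrix.of fun a b => if (a, b) = c then 1 else 0

/-- White noise is the uniform mixture of the product basis states; this makes the noise a classical
random label. -/
theorem isotropic_eq_sum (d : ℕ) (p : ℝ) (a b : Fin d × Fin d) :
    isotropic d p a b = ∑ q, (linkWeight d p q : ℂ) *
      (linkVector d q a.1 a.2 * star (linkVector d q b.1 b.2)) := by
  rw [Fintype.sum_option]
  simp only [isotropic, Matrix.add_apply, Matrix.smul_apply, pureState, Matrix.vecMulVec_apply,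
    smul_eq_mul, Pi.star_apply, linkWeight, linkVector, Matrix.of_apply]
  congr 1
  · simp [maxEntangled, Matrix.one_apply]
  · rw [← Finset.mul_sum]
    congr 1
    rw [Finset.sum_eq_single a]
    · by_cases h : a = b
      · subst h
        simp
      · simp [h, Ne.symm h]
    · intro c _ hc
      simp [Ne.symm hc]
    · simp

theorem sum_linkWeight (d : ℕ) [NeZero d] (p : ℝ) : ∑ q, linkWeight d p q = 1 := by
  have : (d : ℝ) ≠ 0 := NeZero.ne _
  rw [Fintype.sum_option]
  simp only [linkWeight, Finset.sum_const, Finset.card_univ, Fintype.card_prod, Fintype.card_fin,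
    nsmul_eq_mul]
  push_cast
  field_simp
  ring

theorem linkWeight_nonneg (d : ℕ) {p : ℝ} (h0 : 0 ≤ p) (h1 : p ≤ 1) (q : LinkLabel d) :
    0 ≤ linkWeight d p q := by
  cases q with
  | none => exact h0
  | some c => exact div_nonneg (by linarith) (by positivity)

theorem sum_norm_linkVector (d : ℕ) [NeZero d] (q : LinkLabel d) :
    ∑ c : Fin d × Fin d, ‖linkVector d q c.1 c.2‖ ^ 2 = 1 := by
  have hd : (d : ℝ) ≠ 0 := NeZero.ne _
  cases q with
  | none =>
    rw [Fintype.sum_prod_type]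
    simp only [linkVector, Matrix.smul_apply, Matrix.one_apply, smul_eq_mul, norm_mul, mul_pow]
    have : ∀ x y : Fin d, ‖(if x = y then (1 : ℂ) else 0)‖ ^ 2 = if x = y then 1 else 0 := by
      intro x y
      split_ifs <;> simp
    simp only [this]
    simp [hd]
  | some c =>
    rw [Finset.sum_eq_single c]
    · simp [linkVector]
    · intro b _ hb
      simp [linkVector, hb]
    · simp

variable {W : Type} [Fintype W] [DecidableEq W] (G : SimpleGraph W) [DecidableRel G.Adj]
  {d : ℕ}

/-- The basis label of the system of `h.fst` on the edge of the dart `h`. -/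
def atDart {G : SimpleGraph W} (x : ∀ v, NetSystem G d v) (h : G.Dart) : Fin d :=
  x h.fst ⟨h.snd, h.adj⟩

/-- A basis label of the network is a label for every dart. -/
def dartEquiv (d : ℕ) : (∀ v, NetSystem G d v) ≃ (G.Dart → Fin d) where
  toFun x := atDart x
  invFun f v w := f ⟨(v, w.1), w.2⟩
  left_inv _ := rfl
  right_inv _ := rfl

theorem linkEntry_edge (p : ℝ) (x y : ∀ v, NetSystem G d v) (h : G.Dart) :
    linkEntry G d p x y h.edge =
      isotropic d p (atDart x h, atDart x h.symm) (atDart y h, atDart y h.symm) := by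
  rcases h with ⟨⟨u, w⟩, h⟩
  exact dif_pos h

/-- The edges of `G`. -/
abbrev EdgeType : Type := {e // e ∈ G.edgeFinset}

/-- The edge of a dart. -/
def edgeOfDart (h : G.Dart) : EdgeType G := ⟨h.edge, by simp⟩

theorem exists_orientation (e : EdgeType G) : ∃ h : G.Dart, edgeOfDart G h = e := by
  obtain ⟨e, he⟩ := e
  induction e with
  | h u w =>
    rw [SimpleGraph.mem_edgeFinset] at he
    exact ⟨⟨(u, w), he⟩, rfl⟩

/-- A chosen orientation of an edge. -/
def orient (e : EdgeType G) : G.Dart := (exists_orientation G e).choose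

theorem edgeOfDart_orient (e : EdgeType G) : edgeOfDart G (orient G e) = e :=
  (exists_orientation G e).choose_spec

theorem edgeOfDart_eq_iff (h h' : G.Dart) : edgeOfDart G h = edgeOfDart G h' ↔
    h = h' ∨ h = h'.symm := by
  rw [← SimpleGraph.dart_edge_eq_iff, edgeOfDart, edgeOfDart, Subtype.mk.injEq]

/-- The pure network state with given link labels. -/
def netVector (q : EdgeType G → LinkLabel d) (x : ∀ v, NetSystem G d v) : ℂ :=
  ∏ e, linkVector d (q e) (atDart x (orient G e)) (atDart x (orient G e).symm)

theorem networkState_eq_sum (p : ℝ) : networkState G d p =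
    ∑ q : EdgeType G → LinkLabel d, ((∏ e, linkWeight d p (q e) : ℝ) : ℂ) •
      pureState (netVector G q) := by
  ext x y
  have h1 : networkState G d p x y = ∏ e : EdgeType G, linkEntry G d p x y e.1 := by
    rw [networkState, Matrix.of_apply, ← Finset.prod_coe_sort]
  have h2 : ∀ e : EdgeType G, linkEntry G d p x y e.1 = ∑ q, (linkWeight d p q : ℂ) *
      (linkVector d q (atDart x (orient G e)) (atDart x (orient G e).symm) *
        star (linkVector d q (atDart y (orient G e)) (atDart y (orient G e).symm))) := by
    intro e
    rw [← isotropic_eq_sum d p (_, _) (_, _), ← linkEntry_edge]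
    congr 1
    exact (congrArg Subtype.val (edgeOfDart_orient G e)).symm
  rw [h1, Finset.prod_congr rfl fun e _ => h2 e, Finset.prod_univ_sum, Fintype.piFinset_univ,
    Matrix.sum_apply]
  refine Finset.sum_congr rfl fun q _ => ?_
  rw [Finset.prod_mul_distrib, Finset.prod_mul_distrib, Matrix.smul_apply, pureState,
    Matrix.vecMulVec_apply, smul_eq_mul, Complex.ofReal_prod, Pi.star_apply, netVector, netVector,
    star_prod]

/-- This regroups labels of darts into pairs of labels of edges, so that the norm of the network
vector factorises over the edges. -/
theorem orient_bijective : Function.Bijective fun eb : EdgeType G × Bool =>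
    if eb.2 then (orient G eb.1).symm else orient G eb.1 := by
  constructor
  · rintro ⟨e, b⟩ ⟨e', b'⟩ h
    have hedge : ∀ (e : EdgeType G) (b : Bool),
        edgeOfDart G (if b then (orient G e).symm else orient G e) = e := by
      intro e b
      cases b
      · exact edgeOfDart_orient G e
      · exact ((edgeOfDart_eq_iff G _ _).2 (Or.inr rfl)).trans (edgeOfDart_orient G e)
    have he : e = e' := by
      rw [← hedge e b, ← hedge e' b']
      exact congrArg _ h
    subst he
    have hs := (orient G e).symm_ne
    cases b <;> cases b' <;> simp_all [eq_comm]
  · intro h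
    rcases (edgeOfDart_eq_iff G _ _).1 (edgeOfDart_orient G (edgeOfDart G h)) with h' | h'
    · exact ⟨(edgeOfDart G h, false), h'⟩
    · refine ⟨(edgeOfDart G h, true), ?_⟩
      simp [h']

theorem sum_norm_netVector [NeZero d] (q : EdgeType G → LinkLabel d) :
    ∑ x, ‖netVector G q x‖ ^ 2 = 1 := by
  let e := Equiv.ofBijective _ (orient_bijective G)
  let E : (∀ v, NetSystem G d v) ≃ (EdgeType G → Fin d × Fin d) :=
    (dartEquiv G d).trans ((e.arrowCongr (Equiv.refl (Fin d))).symm.trans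
      ((Equiv.curry _ _ _).trans (Equiv.arrowCongr (Equiv.refl _) (Equiv.boolArrowEquivProd _))))
  have h1 : ∀ x, ‖netVector G q x‖ ^ 2 =
      ∏ e, ‖linkVector d (q e) (E x e).1 (E x e).2‖ ^ 2 := by
    intro x
    rw [netVector, norm_prod, Finset.prod_pow]
    rfl
  have h2 := Finset.prod_univ_sum (fun _ : EdgeType G => (Finset.univ : Finset (Fin d × Fin d)))
    (fun e c => ‖linkVector d (q e) c.1 c.2‖ ^ 2)
  rw [Fintype.piFinset_univ] at h2
  rw [Fintype.sum_equiv E _ (fun y => ∏ e, ‖linkVector d (q e) (y e).1 (y e).2‖ ^ 2) h1]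
  exact h2.symm.trans (Finset.prod_eq_one fun e _ => sum_norm_linkVector d (q e))

end NetworkState

/-! ## Measuring the used systems of a network -/

section UsedSystems

variable {W : Type} [Fintype W] [DecidableEq W] {G : SimpleGraph W} [DecidableRel G.Adj]
  {d : ℕ} [NeZero d]

/-- A basis label of `v`, extended by `0` to the other parties. -/
def extendLabel (v : W) (x : NetSystem G d v) : ∀ u, NetSystem G d u :=
  Function.update (fun _ _ => 0) v x

theorem atDart_extendLabel {v : W} {h : G.Dart} (hv : h.fst = v) (x : ∀ u, NetSystem G d u) :
    atDart (extendLabel v (x v)) h = atDart x h := by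
  subst hv
  simp [atDart, extendLabel]

theorem sum_mul_prod {A B : Type} [Fintype A] [Fintype B] (f : A → ℂ) (g : B → ℂ) :
    ∑ i : A × B, f i.1 * g i.2 = (∑ a, f a) * ∑ b, g b := by
  rw [Fintype.sum_mul_sum, Fintype.sum_prod_type]

/-- The squared distance between the columns at `y` and `y'` expands to `1 - 1 - (1 - 1) = 0`.
Completeness alone therefore forces a party's amplitudes to depend only on the systems that it
holds. -/
theorem eq_of_completeness {O K Y : Type} [Fintype O] [Fintype K] {f : O → K → Y → ℂ}
    {r : Y → Y → Prop} [∀ y y', Decidable (r y y')] (hr : Equivalence r)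
    (h : ∀ y y', ∑ i, ∑ z, star (f i z y) * f i z y' = if r y y' then 1 else 0) {y y' : Y}
    (hy : r y y') (i : O) (z : K) : f i z y = f i z y' := by
  have h1 : ∑ i, ∑ z, star (f i z y - f i z y') * (f i z y - f i z y') = 0 := by
    have e : ∀ i z, star (f i z y - f i z y') * (f i z y - f i z y') =
        star (f i z y) * f i z y - star (f i z y) * f i z y' -
          (star (f i z y') * f i z y - star (f i z y') * f i z y') := by
      intro i z
      rw [star_sub]
      ring
    simp only [e, Finset.sum_sub_distrib, h, hr.refl, hy, hr.symm hy, if_true]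
    ring
  have h2 : ∑ i, ∑ z, ‖f i z y - f i z y'‖ ^ 2 = 0 := by
    have e : ∀ i z, star (f i z y - f i z y') * (f i z y - f i z y') =
        ((‖f i z y - f i z y'‖ ^ 2 : ℝ) : ℂ) := by
      intro i z
      push_cast
      exact Complex.conj_mul' _
    simp only [e] at h1
    exact_mod_cast h1
  rw [Finset.sum_eq_zero_iff_of_nonneg fun i _ => by positivity] at h2
  have h3 := h2 i (Finset.mem_univ i)
  rw [Finset.sum_eq_zero_iff_of_nonneg fun i _ => by positivity] at h3
  have h4 := h3 z (Finset.mem_univ z)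
  simpa [sub_eq_zero] using h4

/-- Every party measures the systems that are in use by means of `n v`, and the others in the
standard basis. The parties in `T` come last. The branches contract the used systems. -/
theorem exists_isLOCC_of_used {K : W → Type} [∀ v, Fintype (K v)] [∀ v, DecidableEq (K v)]
    {U : Type} [Fintype U] [DecidableEq U] (ι : U → G.Dart) (hι : Function.Injective ι)
    {O : Type} [Fintype O] [Inhabited O] (n : ∀ v, (W → O) → K v → (U → Fin d) → ℂ)
    (hn : ∀ v o y y', ∑ i, ∑ z, star (n v (Function.update o v i) z y) *
      n v (Function.update o v i) z y' = if ∀ u, (ι u).fst = v → y u = y' u then 1 else 0)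
    (T : Finset W) (hT : ∀ v ∉ T, ∀ o o', o v = o' v → n v o = n v o')
    (hT' : ∀ v ∈ T, ∀ o o', o v = o' v → (∀ u ∉ T, o u = o' u) → n v o = n v o') :
    ∃ Λ : MultiOp (NetSystem G d) → MultiOp K, IsLOCC Λ ∧
      ∃ (B : Type) (_ : Fintype B) (A : B → Matrix (∀ v, K v) (∀ v, NetSystem G d v) ℂ),
        (∀ ρ, Λ ρ = ∑ b, A b * ρ * (A b).conjTranspose) ∧
        ∀ b, ∃ (o : W → O) (w : G.Dart → Fin d) (c : ℂ), ∀ (F : (G.Dart → Fin d) → ℂ) z,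
          ∑ x, A b z x * F (atDart x) =
            c * ∑ y : U → Fin d, (∏ v, n v o (z v) y) * F (Function.extend ι y w) := by
  classical
  have hdep : ∀ v o z (y y' : U → Fin d), (∀ u, (ι u).fst = v → y u = y' u) →
      n v o z y = n v o z y' := by
    intro v o z y y' hy
    have := eq_of_completeness (f := fun i z y => n v (Function.update o v i) z y)
      (r := fun y y' => ∀ u, (ι u).fst = v → y u = y' u)
      ⟨fun y u _ => rfl, fun h u hu => (h u hu).symm, fun h h' u hu => (h u hu).trans (h' u hu)⟩
      (hn v o) hy (o v) z
    simpa using this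
  -- All parties share one outcome type, with an entry for every dart. The entry of an unused system
  -- of `v` records its basis label; each other entry is forced to be `0`, which keeps the
  -- measurement complete.
  let res : ∀ v, (W → O × (G.Dart → Fin d)) → (∀ u, NetSystem G d u) → G.Dart → ℂ :=
    fun v o x h => if h.fst = v ∧ h ∉ Set.range ι then if atDart x h = (o v).2 h then 1 else 0
      else if (o v).2 h = 0 then 1 else 0
  let M : ∀ v, (W → O × (G.Dart → Fin d)) → Matrix (K v) (NetSystem G d v) ℂ := fun v o =>
    Matrix.of fun z x => n v (fun u => (o u).1) z (fun u => atDart (extendLabel v x) (ι u)) *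
      ∏ h, res v o (extendLabel v x) h
  have hM : ∀ v o z (x : ∀ u, NetSystem G d u), M v o z (x v) =
      n v (fun u => (o u).1) z (fun u => atDart x (ι u)) * ∏ h, res v o x h := by
    intro v o z x
    simp only [M, Matrix.of_apply]
    congr 1
    · exact hdep _ _ _ _ _ fun u hu => atDart_extendLabel hu x
    · refine Finset.prod_congr rfl fun h _ => ?_
      simp only [res]
      by_cases hh : h.fst = v
      · rw [atDart_extendLabel hh]
      · simp [hh]
  have hcomplete : ∀ v o, ∑ i, (M v (Function.update o v i)).conjTranspose *
      M v (Function.update o v i) = 1 := by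
    intro v o
    ext a b
    have hab : ∀ c : NetSystem G d v, extendLabel v c v = c := fun c => by simp [extendLabel]
    let δ : NetSystem G d v → G.Dart → Fin d → ℂ := fun a h j =>
      if h.fst = v ∧ h ∉ Set.range ι then if atDart (extendLabel v a) h = j then 1 else 0
      else if j = 0 then 1 else 0
    let f : O → ℂ := fun i => ∑ z, star (n v (Function.update (fun u => (o u).1) v i) z
      (fun u => atDart (extendLabel v a) (ι u))) *
      n v (Function.update (fun u => (o u).1) v i) z (fun u => atDart (extendLabel v b) (ι u))
    have e1 : ∀ i, ((M v (Function.update o v i)).conjTranspose *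
        M v (Function.update o v i)) a b = f i.1 * ∏ h, (δ a h (i.2 h) * δ b h (i.2 h)) := by
      intro i
      have hup : (fun u => (Function.update o v i u).1) =
          Function.update (fun u => (o u).1) v i.1 := by
        funext u
        by_cases hu : u = v
        · subst hu
          simp
        · simp [hu]
      rw [Matrix.mul_apply, Finset.sum_mul]
      refine Finset.sum_congr rfl fun z _ => ?_
      rw [Matrix.conjTranspose_apply]
      conv_lhs => rw [← hab a, ← hab b, hM, hM]
      rw [hup, star_mul', star_prod, Finset.prod_mul_distrib]
      simp only [res, Function.update_self]
      have : ∀ h : G.Dart, star (if h.fst = v ∧ h ∉ Set.range ι then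
            if atDart (extendLabel v a) h = i.2 h then (1 : ℂ) else 0
          else if i.2 h = 0 then 1 else 0) = δ a h (i.2 h) := by
        intro h
        simp only [δ]
        split_ifs <;> simp
      simp only [this]
      ring
    have e2 : ∀ h : G.Dart, ∑ j : Fin d, δ a h j * δ b h j = if h.fst = v ∧ h ∉ Set.range ι →
        atDart (extendLabel v a) h = atDart (extendLabel v b) h then 1 else 0 := by
      intro h
      by_cases hh : h.fst = v ∧ h ∉ Set.range ι
      · by_cases hab : atDart (extendLabel v a) h = atDart (extendLabel v b) h
        · simp only [δ, if_pos hh, hab]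
          simp
        · simp only [δ, if_pos hh]
          simp [hh, hab]
      · simp only [δ, hh, if_false]
        simp
    have e3 : ∑ w : G.Dart → Fin d, ∏ h, (δ a h (w h) * δ b h (w h)) =
        ∏ h, ∑ j : Fin d, δ a h j * δ b h j := by
      rw [Finset.prod_univ_sum, Fintype.piFinset_univ]
    refine (Matrix.sum_apply _ _ _ _).trans ((Finset.sum_congr rfl fun i _ => e1 i).trans
      (Eq.trans ?_ Matrix.one_apply.symm))
    rw [sum_mul_prod f fun w : G.Dart → Fin d => ∏ h, (δ a h (w h) * δ b h (w h)), e3, hn,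
      Finset.prod_congr rfl fun h _ => e2 h, Fintype.prod_boole]
    by_cases hab' : a = b
    · subst hab'
      simp
    · rw [if_neg hab']
      by_contra hne
      rw [← ne_eq, mul_ne_zero_iff, ne_eq, ne_eq, ite_eq_right_iff, ite_eq_right_iff] at hne
      obtain ⟨h1, h2⟩ := hne
      rw [Classical.not_imp] at h1 h2
      apply hab'
      funext k
      let h : G.Dart := ⟨(v, k.1), k.2⟩
      have hk : ∀ c : NetSystem G d v, atDart (extendLabel v c) h = c k := fun c => by
        simp [atDart, extendLabel, h]
      rw [← hk a, ← hk b]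
      by_cases hr : h ∈ Set.range ι
      · obtain ⟨u, hu⟩ := hr
        rw [← hu]
        exact h1.1 u (by rw [hu])
      · exact h2.1 h ⟨rfl, hr⟩
  have hMdep : ∀ v o o', n v (fun u => (o u).1) = n v (fun u => (o' u).1) → o v = o' v →
      M v o = M v o' := by
    intro v o o' h1 h2
    ext z x
    simp only [M, res, Matrix.of_apply, h1, h2]
  obtain ⟨Λ, hΛ, B, hB, ob, hsum, -⟩ := exists_isLOCC_of_measurements
    ((Tᶜ).toList ++ T.toList)
    (List.nodup_append.2 ⟨Finset.nodup_toList _, Finset.nodup_toList _, by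
      intro a ha b hb
      rw [Finset.mem_toList, Finset.mem_compl] at ha
      rw [Finset.mem_toList] at hb
      exact fun h => ha (h ▸ hb)⟩) M default (fun v _ o => hcomplete v o)
    (fun v hv => by simp [em'] at hv)
    (by
      rw [List.pairwise_append]
      refine ⟨?_, ?_, ?_⟩
      · refine (Finset.nodup_toList _).imp_of_mem ?_
        intro v u hv hu hvu o i
        rw [Finset.mem_toList, Finset.mem_compl] at hv
        exact hMdep v _ _ (hT v hv _ _ (by simp [hvu])) (by simp [hvu])
      · refine (Finset.nodup_toList _).imp_of_mem ?_
        intro v u hv hu hvu o i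
        rw [Finset.mem_toList] at hv hu
        refine hMdep v _ _ (hT' v hv _ _ (by simp [hvu]) ?_) (by simp [hvu])
        intro u' hu'
        have : u' ≠ u := fun h => hu' (h ▸ hu)
        simp [this]
      · intro v hv u hu o i
        rw [Finset.mem_toList, Finset.mem_compl] at hv
        rw [Finset.mem_toList] at hu
        have hvu : v ≠ u := fun h => hv (h ▸ hu)
        exact hMdep v _ _ (hT v hv _ _ (by simp [hvu])) (by simp [hvu]))
  refine ⟨Λ, hΛ, B, hB, fun b => localTensor fun v => M v (ob b), hsum, fun b => ?_⟩
  set o := ob b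
  let w : G.Dart → Fin d := fun h => (o h.fst).2 h
  -- The constraints on entries that record nothing do not involve the label `x` and come out as a
  -- constant.
  let c : ℂ := ∏ h : G.Dart, if h ∉ Set.range ι then
      ∏ v ∈ Finset.univ.erase h.fst, if (o v).2 h = 0 then 1 else 0
    else ∏ v, if (o v).2 h = 0 then 1 else 0
  refine ⟨fun u => (o u).1, w, c, fun F z => ?_⟩
  have e1 : ∀ x : ∀ v, NetSystem G d v, localTensor (fun v => M v o) z x =
      c * ((∏ v, n v (fun u => (o u).1) (z v) (fun u => atDart x (ι u))) *
        if ∀ h, h ∉ Set.range ι → atDart x h = w h then 1 else 0) := by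
    intro x
    rw [localTensor_apply, Finset.prod_congr rfl fun v _ => hM v o (z v) x,
      Finset.prod_mul_distrib, Finset.prod_comm, ← Fintype.prod_boole, mul_left_comm]
    congr 1
    rw [← Finset.prod_mul_distrib]
    refine Finset.prod_congr rfl fun h _ => ?_
    by_cases hh : h ∈ Set.range ι
    · simp only [res, hh, not_true, and_false, if_false, false_imp_iff, if_true, mul_one]
    · rw [if_pos hh, ← Finset.mul_prod_erase _ _ (Finset.mem_univ h.fst), mul_comm]
      congr 1
      · refine Finset.prod_congr rfl fun v hv => ?_
        have : h.fst ≠ v := (Finset.ne_of_mem_erase hv).symm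
        simp [res, this]
      · simp only [res, hh, not_false_iff, and_self, if_true, true_imp_iff, w]
  refine (Finset.sum_congr rfl fun x _ => congrArg (· * F (atDart x)) (e1 x)).trans ?_
  rw [Finset.mul_sum]
  have e2 := Fintype.sum_equiv (dartEquiv G d)
    (fun x => c * ((∏ v, n v (fun u => (o u).1) (z v) (fun u => atDart x (ι u))) *
        if ∀ h, h ∉ Set.range ι → atDart x h = w h then 1 else 0) * F (atDart x))
    (fun f => c * ((∏ v, n v (fun u => (o u).1) (z v) (fun u => f (ι u))) *
        if ∀ h, h ∉ Set.range ι → f h = w h then 1 else 0) * F f) (fun x => rfl)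
  rw [e2]
  symm
  -- Only labels that agree with the recorded outcomes `w` on all unused darts survive, and these
  -- are the extensions of labels `y` of the used darts.
  refine Fintype.sum_of_injective (fun y => Function.extend ι y w)
    (fun y y' h => ?_) _ _ ?_ ?_
  · funext u
    have := congrFun h (ι u)
    simpa [hι.extend_apply] using this
  · intro f hf
    have : ¬ ∀ h, h ∉ Set.range ι → f h = w h := by
      intro hall
      apply hf
      refine ⟨fun u => f (ι u), ?_⟩
      funext h
      by_cases hh : h ∈ Set.range ι
      · obtain ⟨u, rfl⟩ := hh
        exact hι.extend_apply _ _ _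
      · rw [hall h hh]
        exact Function.extend_apply' _ _ _ hh
    rw [if_neg this]
    simp
  · intro y
    have : ∀ h, h ∉ Set.range ι → Function.extend ι y w h = w h := fun h hh =>
      Function.extend_apply' _ _ _ hh
    rw [if_pos this]
    simp only [hι.extend_apply]
    ring

end UsedSystems

/-! ## Teleportation along legs -/

/-- The sum over all paths is the product of the transition matrices. -/
theorem sum_path_eq_prod {X : Type} [Fintype X] [DecidableEq X] {r : ℕ}
    (A : Fin r → Matrix X X ℂ) (p q : X) :
    ∑ a : Fin (r + 1) → X, (if a 0 = p ∧ a (Fin.last r) = q then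
      ∏ j, A j (a j.castSucc) (a j.succ) else 0) = (List.ofFn A).prod p q := by
  induction r generalizing p with
  | zero =>
    rw [Fintype.sum_equiv (Equiv.funUnique (Fin 1) X) _
      (fun x => if x = p ∧ x = q then (1 : ℂ) else 0) (fun a => by simp)]
    by_cases h : p = q
    · subst h
      simp
    · have : ∀ x, ¬ (x = p ∧ x = q) := fun x hx => h (hx.1.symm.trans hx.2)
      simp [this, h]
  | succ r ih =>
    rw [List.ofFn_succ, List.prod_cons, Matrix.mul_apply,
      Fintype.sum_equiv (Fin.consEquiv fun _ : Fin (r + 2) => X).symm _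
      (fun c : X × (Fin (r + 1) → X) => if c.1 = p ∧ c.2 (Fin.last r) = q then
        A 0 c.1 (c.2 0) * ∏ j : Fin r, A j.succ (c.2 j.castSucc) (c.2 j.succ) else 0) ?_]
    · rw [Fintype.sum_prod_type, Finset.sum_eq_single p]
      · simp only [true_and]
        have : ∀ m, A 0 p m * (List.ofFn fun i : Fin r => A i.succ).prod m q =
            ∑ a : Fin (r + 1) → X, if a 0 = m then (if a (Fin.last r) = q then
              A 0 p (a 0) * ∏ j : Fin r, A j.succ (a j.castSucc) (a j.succ) else 0) else 0 := by
          intro m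
          rw [← ih, Finset.mul_sum]
          refine Finset.sum_congr rfl fun a _ => ?_
          by_cases h : a 0 = m <;> by_cases h' : a (Fin.last r) = q <;> simp [h, h']
        simp only [this]
        rw [Finset.sum_comm]
        refine Finset.sum_congr rfl fun a _ => ?_
        simp
      · intro x _ hx
        simp [hx]
      · simp
    · intro a
      simp only [Fin.consEquiv, Equiv.coe_fn_symm_mk, Fin.prod_univ_succ, Fin.castSucc_zero,
        Fin.tail]
      rfl

/-- With `s` the end labels of a leg, this sums out the inside of each leg separately while the ends
are held fixed. -/
theorem sum_mul_prod_fiberwise {L Z : Type} [Fintype L] [DecidableEq L] [Fintype Z]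
    [DecidableEq Z] {Y : L → Type} [∀ l, Fintype (Y l)] (s : ∀ l, Y l → Z) (F : (L → Z) → ℂ)
    (g : ∀ l, Y l → ℂ) :
    ∑ y : ∀ l, Y l, F (fun l => s l (y l)) * ∏ l, g l (y l) =
      ∑ z : L → Z, F z * ∏ l, ∑ y, if s l y = z l then g l y else 0 := by
  simp only [Finset.prod_univ_sum, Fintype.piFinset_univ, Finset.mul_sum]
  rw [Finset.sum_comm]
  refine Finset.sum_congr rfl fun y _ => ?_
  rw [Finset.sum_eq_single fun l => s l (y l)]
  · simp
  · intro z _ hz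
    obtain ⟨l, hl⟩ := Function.ne_iff.1 hz
    rw [Finset.prod_eq_zero (Finset.mem_univ l), mul_zero]
    rw [if_neg (Ne.symm hl)]
  · simp

section Legs

variable {W : Type} [Fintype W] [DecidableEq W] {G : SimpleGraph W} [DecidableRel G.Adj]

/-- Pairwise edge-disjoint legs from `v₀` to the vertices `tgt l`, given by their darts, with no
inner vertex in `V₀`. -/
structure LegSystem (G : SimpleGraph W) (v₀ : W) (V₀ : Finset W) {L : Type} (tgt : L → W) where
  r : L → ℕ
  dart : ∀ l, Fin (r l + 1) → G.Dart
  start : ∀ l, (dart l 0).fst = v₀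
  finish : ∀ l, (dart l (Fin.last _)).snd = tgt l
  chain : ∀ l (j : Fin (r l)), (dart l j.castSucc).snd = (dart l j.succ).fst
  inner : ∀ l (j : Fin (r l)), (dart l j.succ).fst ∉ V₀
  edge_injective : Function.Injective fun u : Σ l, Fin (r l + 1) => (dart u.1 u.2).edge

namespace LegSystem

variable {v₀ : W} {V₀ : Finset W} {L : Type} {tgt : L → W} (S : LegSystem G v₀ V₀ tgt)

/-- The darts on the legs, in both directions. -/
def usedDart (u : (Σ l, Fin (S.r l + 1)) × Bool) : G.Dart :=
  if u.2 then (S.dart u.1.1 u.1.2).symm else S.dart u.1.1 u.1.2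

theorem edgeOfDart_usedDart (u : (Σ l, Fin (S.r l + 1)) × Bool) :
    edgeOfDart G (S.usedDart u) = edgeOfDart G (S.dart u.1.1 u.1.2) := by
  rw [edgeOfDart_eq_iff]
  cases h : u.2 <;> simp [usedDart, h]

theorem usedDart_injective : Function.Injective S.usedDart := by
  rintro ⟨u, b⟩ ⟨u', b'⟩ h
  have hu : u = u' := S.edge_injective (by
    have := congrArg (edgeOfDart G) h
    rw [edgeOfDart_usedDart, edgeOfDart_usedDart] at this
    exact congrArg Subtype.val this)
  subst hu
  have := (S.dart u.1 u.2).symm_ne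
  cases b <;> cases b' <;> simp_all [usedDart, eq_comm]

/-- The edges on the legs. -/
def edge (l : L) (j : Fin (S.r l + 1)) : EdgeType G := edgeOfDart G (S.dart l j)

/-- The matrix of a link of a leg, oriented along the leg. -/
def linkMatrix {d : ℕ} (q : EdgeType G → LinkLabel d) (l : L) (j : Fin (S.r l + 1)) :
    Matrix (Fin d) (Fin d) ℂ :=
  if S.dart l j = orient G (S.edge l j) then linkVector d (q (S.edge l j))
  else (linkVector d (q (S.edge l j))).transpose

/-- The edges off the legs see only the fixed outcomes `w` and give the constant. An edge that its
leg traverses against the chosen orientation enters transposed. -/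
theorem exists_prod_linkVector_eq [Fintype L] {d : ℕ} (q : EdgeType G → LinkLabel d)
    (w : G.Dart → Fin d) :
    ∃ c : ℂ, ∀ y : (Σ l, Fin (S.r l + 1)) × Bool → Fin d,
      ∏ e, linkVector d (q e) (Function.extend S.usedDart y w (orient G e))
        (Function.extend S.usedDart y w (orient G e).symm) =
      c * ∏ l, ∏ j, S.linkMatrix q l j (y (⟨l, j⟩, false)) (y (⟨l, j⟩, true)) := by
  classical
  let used : Finset (EdgeType G) :=
    Finset.univ.image fun u : Σ l, Fin (S.r l + 1) => S.edge u.1 u.2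
  refine ⟨∏ e ∈ usedᶜ, linkVector d (q e) (w (orient G e)) (w (orient G e).symm), fun y => ?_⟩
  rw [← Finset.prod_compl_mul_prod used]
  congr 1
  · refine Finset.prod_congr rfl fun e he => ?_
    have hnot : ∀ h : G.Dart, edgeOfDart G h = e → ¬ ∃ u, S.usedDart u = h := by
      rintro h hh ⟨u, rfl⟩
      rw [edgeOfDart_usedDart] at hh
      rw [Finset.mem_compl] at he
      exact he (Finset.mem_image.2 ⟨u.1, Finset.mem_univ _, hh⟩)
    rw [Function.extend_apply' _ _ _ (hnot _ (edgeOfDart_orient G e)),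
      Function.extend_apply' _ _ _ (hnot _ (((edgeOfDart_eq_iff G _ _).2 (Or.inr rfl)).trans
        (edgeOfDart_orient G e)))]
  · rw [Finset.prod_image fun u _ u' _ h =>
      S.edge_injective (congrArg Subtype.val h), Fintype.prod_sigma]
    refine Finset.prod_congr rfl fun l _ => Finset.prod_congr rfl fun j _ => ?_
    have e1 : Function.extend S.usedDart y w (S.dart l j) = y (⟨l, j⟩, false) :=
      S.usedDart_injective.extend_apply y w (⟨l, j⟩, false)
    have e2 : Function.extend S.usedDart y w (S.dart l j).symm = y (⟨l, j⟩, true) :=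
      S.usedDart_injective.extend_apply y w (⟨l, j⟩, true)
    have h := edgeOfDart_orient G (S.edge l j)
    rw [linkMatrix]
    split_ifs with hd
    · rw [← hd, e1, e2]
    · rw [edge, edgeOfDart_eq_iff] at h
      rcases h with h | h
      · exact absurd h.symm hd
      · change orient G (S.edge l j) = _ at h
        rw [h, SimpleGraph.Dart.symm_symm, e1, e2, Matrix.transpose_apply]

/-- The matrix that a leg ends up with, after its inner parties have projected onto the vectors
with matrices `A`. -/
def legMatrix {d : ℕ} (q : EdgeType G → LinkLabel d) (l : L)
    (A : Fin (S.r l) → Matrix (Fin d) (Fin d) ℂ) : Matrix (Fin d) (Fin d) ℂ :=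
  Matrix.of fun a b => ∑ y : Fin (S.r l + 1) → Bool → Fin d,
    if (y 0 false, y (Fin.last _) true) = (a, b) then
      (∏ j, A j (y j.castSucc true) (y j.succ false)) *
        ∏ j, S.linkMatrix q l j (y j false) (y j true) else 0

/-- Perfect links identify the labels at their two ends, so the contraction becomes a sum over paths
of the matrices `A`. -/
theorem legMatrix_of_perfect {d : ℕ} (q : EdgeType G → LinkLabel d) (l : L)
    (A : Fin (S.r l) → Matrix (Fin d) (Fin d) ℂ) (hq : ∀ j, q (S.edge l j) = none) :
    ∃ c : ℂ, S.legMatrix q l A = c • (List.ofFn A).prod := by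
  set c₀ : ℂ := (((Real.sqrt d)⁻¹ : ℝ) : ℂ) with hc₀
  have hlink : ∀ j, S.linkMatrix q l j = c₀ • 1 := by
    intro j
    rw [linkMatrix, hq j]
    simp [linkVector, hc₀]
  refine ⟨c₀ ^ (S.r l + 1), ?_⟩
  ext a b
  rw [Matrix.smul_apply, smul_eq_mul, ← sum_path_eq_prod, Finset.mul_sum, legMatrix,
    Matrix.of_apply]
  symm
  refine Fintype.sum_of_injective (fun x j _ => x j) (fun x x' h => ?_) _ _ ?_ ?_
  · funext j
    exact congrFun (congrFun h j) true
  · intro y hy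
    rw [ite_eq_right_iff]
    intro _
    obtain ⟨j, hj⟩ : ∃ j, y j false ≠ y j true := by
      by_contra! hcon
      apply hy
      refine ⟨fun j => y j true, ?_⟩
      funext j b
      cases b
      · exact (hcon j).symm
      · rfl
    rw [Finset.prod_eq_zero (f := fun j => S.linkMatrix q l j (y j false) (y j true))
      (Finset.mem_univ j), mul_zero]
    simp [hlink, hj]
  · intro x
    simp only [hlink, Matrix.smul_apply, Matrix.one_apply_eq, smul_eq_mul, mul_one,
      Finset.prod_const, Finset.card_univ, Fintype.card_fin, Prod.mk.injEq]
    split_ifs <;> ring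

end LegSystem

end Legs

/-! ## Reduction of a network to its legs -/

section Reduction

variable {W : Type} [Fintype W] [DecidableEq W] {G : SimpleGraph W} [DecidableRel G.Adj]
  {d : ℕ} [NeZero d] {v₀ : W} {V₀ : Finset W} {L : Type} [Fintype L] [DecidableEq L] {tgt : L → W}

namespace LegSystem

variable (S : LegSystem G v₀ V₀ tgt)

/-- The inner vertices of the legs. -/
def node (l : L) (j : Fin (S.r l)) : W := (S.dart l j.succ).fst

theorem node_notMem (l : L) (j : Fin (S.r l)) : S.node l j ∉ V₀ := S.inner l j

/-- Sorts the used systems at `v` by role: the pair at an inner passage of a leg, the first systems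
at the centre, the last ones at the targets. -/
theorem usedDart_fst_iff (v : W) (y y' : (Σ l, Fin (S.r l + 1)) × Bool → Fin d) :
    (∀ u, (S.usedDart u).fst = v → y u = y' u) ↔
      (∀ l j, S.node l j = v → y (⟨l, j.castSucc⟩, true) = y' (⟨l, j.castSucc⟩, true) ∧
        y (⟨l, j.succ⟩, false) = y' (⟨l, j.succ⟩, false)) ∧
      (v = v₀ → (fun l => y (⟨l, 0⟩, false)) = fun l => y' (⟨l, 0⟩, false)) ∧
      ∀ l, tgt l = v → y (⟨l, Fin.last _⟩, true) = y' (⟨l, Fin.last _⟩, true) := by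
  constructor
  · intro h
    refine ⟨fun l j hv => ⟨h (⟨l, j.castSucc⟩, true) ?_, h (⟨l, j.succ⟩, false) hv⟩, ?_, ?_⟩
    · exact (S.chain l j).trans hv
    · rintro rfl
      funext l
      exact h (⟨l, 0⟩, false) (S.start l)
    · intro l hv
      exact h (⟨l, Fin.last _⟩, true) ((S.finish l).trans hv)
  · rintro ⟨h1, h2, h3⟩ ⟨⟨l, j⟩, b⟩ hu
    cases b
    · change (S.dart l j).fst = v at hu
      induction j using Fin.cases with
      | zero => exact congrFun (h2 (hu.symm.trans (S.start l))) l
      | succ j => exact (h1 l j hu).2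
    · change (S.dart l j).snd = v at hu
      induction j using Fin.lastCases with
      | last => exact h3 l ((S.finish l).symm.trans hu)
      | cast j => exact (h1 l j ((S.chain l j).symm.trans hu)).1

section Inner

variable {Y : Type} [DecidableEq Y] [Inhabited Y] (A : Y → Matrix (Fin d) (Fin d) ℂ)

/-- The measurement of `v` on the legs that pass through it. -/
def innerAmplitude (v : W) (m : ∀ l, Fin (S.r l) → Y)
    (y : (Σ l, Fin (S.r l + 1)) × Bool → Fin d) : ℂ :=
  ∏ l, ∏ j, if S.node l j = v then (((Real.sqrt d)⁻¹ : ℝ) : ℂ) *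
      A (m l j) (y (⟨l, j.castSucc⟩, true)) (y (⟨l, j.succ⟩, false))
    else if m l j = default then 1 else 0

/-- The sum over outcomes factorises over the passages of legs through vertices. A passage through
`v` gives the completeness of `A`, normalised by `1 / d`; at any other passage only the default
outcome has nonzero amplitude. -/
theorem innerAmplitude_complete [Fintype Y]
    (hA : ∀ x y x' y', ∑ s, star (A s x y) * A s x' y' =
      if x = x' ∧ y = y' then (d : ℂ) else 0) (v : W)
    (y y' : (Σ l, Fin (S.r l + 1)) × Bool → Fin d) :
    ∑ m, star (S.innerAmplitude A v m y) * S.innerAmplitude A v m y' =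
      if ∀ l j, S.node l j = v → y (⟨l, j.castSucc⟩, true) = y' (⟨l, j.castSucc⟩, true) ∧
        y (⟨l, j.succ⟩, false) = y' (⟨l, j.succ⟩, false) then 1 else 0 := by
  let t : ∀ l, Fin (S.r l) → Y → ((Σ l, Fin (S.r l + 1)) × Bool → Fin d) → ℂ := fun l j s y =>
    if S.node l j = v then (((Real.sqrt d)⁻¹ : ℝ) : ℂ) *
      A s (y (⟨l, j.castSucc⟩, true)) (y (⟨l, j.succ⟩, false))
    else if s = default then 1 else 0
  have ht : ∀ l j, ∑ s, star (t l j s y) * t l j s y' =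
      if S.node l j = v → y (⟨l, j.castSucc⟩, true) = y' (⟨l, j.castSucc⟩, true) ∧
        y (⟨l, j.succ⟩, false) = y' (⟨l, j.succ⟩, false) then 1 else 0 := by
    intro l j
    by_cases hv : S.node l j = v
    · simp only [t, if_pos hv, hv, true_imp_iff]
      have hd : (((Real.sqrt d)⁻¹ : ℝ) : ℂ) * ((Real.sqrt d)⁻¹ : ℝ) = (d : ℂ)⁻¹ := by
        rw [← Complex.ofReal_mul, ← mul_inv, Real.mul_self_sqrt (by positivity),
          Complex.ofReal_inv, Complex.ofReal_natCast]
      have : ∀ s, star ((((Real.sqrt d)⁻¹ : ℝ) : ℂ) *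
          A s (y (⟨l, j.castSucc⟩, true)) (y (⟨l, j.succ⟩, false))) *
          ((((Real.sqrt d)⁻¹ : ℝ) : ℂ) *
            A s (y' (⟨l, j.castSucc⟩, true)) (y' (⟨l, j.succ⟩, false))) =
          (d : ℂ)⁻¹ * (star (A s (y (⟨l, j.castSucc⟩, true)) (y (⟨l, j.succ⟩, false))) *
            A s (y' (⟨l, j.castSucc⟩, true)) (y' (⟨l, j.succ⟩, false))) := by
        intro s
        have hs : star (((Real.sqrt d)⁻¹ : ℝ) : ℂ) = (((Real.sqrt d)⁻¹ : ℝ) : ℂ) :=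
          Complex.conj_ofReal _
        rw [star_mul', hs, ← hd]
        ring
      simp only [this]
      rw [← Finset.mul_sum, hA]
      have : (d : ℂ) ≠ 0 := NeZero.ne _
      split_ifs
      · exact inv_mul_cancel₀ this
      · exact mul_zero _
    · simp [t, hv]
  have h1 : ∀ m, star (S.innerAmplitude A v m y) * S.innerAmplitude A v m y' =
      ∏ l, ∏ j, star (t l j (m l j) y) * t l j (m l j) y' := by
    intro m
    simp only [innerAmplitude, star_prod, ← Finset.prod_mul_distrib]
    rfl
  simp only [h1]
  have h2 : ∑ m : ∀ l, Fin (S.r l) → Y, ∏ l, ∏ j, star (t l j (m l j) y) * t l j (m l j) y' =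
      ∏ l, ∏ j, ∑ s, star (t l j s y) * t l j s y' := by
    simp only [Finset.prod_univ_sum, Fintype.piFinset_univ]
  have h3 : ∀ l, ∏ j, ∑ s, star (t l j s y) * t l j s y' =
      if ∀ j, S.node l j = v → y (⟨l, j.castSucc⟩, true) = y' (⟨l, j.castSucc⟩, true) ∧
        y (⟨l, j.succ⟩, false) = y' (⟨l, j.succ⟩, false) then 1 else 0 := by
    intro l
    rw [Finset.prod_congr rfl fun j _ => ht l j, Fintype.prod_boole]
    congr
  rw [h2, Finset.prod_congr rfl fun l _ => h3 l]
  exact Fintype.prod_boole.trans (if_congr Iff.rfl rfl rfl)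

/-- Exactly one party acts at each passage; the default-outcome conditions of all the others are
collected in the constant. -/
theorem exists_prod_innerAmplitude_eq (m : W → ∀ l, Fin (S.r l) → Y) :
    ∃ c : ℂ, ∀ y, ∏ v, S.innerAmplitude A v (m v) y =
      c * ∏ l, ∏ j, A (m (S.node l j) l j) (y (⟨l, j.castSucc⟩, true))
        (y (⟨l, j.succ⟩, false)) := by
  refine ⟨∏ l, ∏ j, ((((Real.sqrt d)⁻¹ : ℝ) : ℂ) * ∏ v ∈ Finset.univ.erase (S.node l j),
    if m v l j = default then 1 else 0), fun y => ?_⟩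
  simp only [innerAmplitude]
  rw [Finset.prod_comm, ← Finset.prod_mul_distrib]
  refine Finset.prod_congr rfl fun l _ => ?_
  rw [Finset.prod_comm, ← Finset.prod_mul_distrib]
  refine Finset.prod_congr rfl fun j _ => ?_
  rw [← Finset.mul_prod_erase _ _ (Finset.mem_univ (S.node l j)), if_pos rfl,
    mul_right_comm _ (∏ v ∈ _, _)]
  congr 1
  refine Finset.prod_congr rfl fun v hv => ?_
  rw [if_neg (Finset.ne_of_mem_erase hv).symm]

end Inner

/-- A label of the used systems is a family of labels of the legs. -/
def labelEquiv (X : Type) : ((Σ l, Fin (S.r l + 1)) × Bool → X) ≃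
    ∀ l, Fin (S.r l + 1) → Bool → X :=
  (Equiv.curry _ _ _).trans (Equiv.piCurry fun _ _ => Bool → X)

end LegSystem

/-- If the inner parties of the legs teleport, and the parties in `V₀` measure their ends of the
legs by means of `e v`, then the branches of the protocol contract `e` with the matrices of the
legs. -/
theorem exists_isLOCC_of_legs (S : LegSystem G v₀ V₀ tgt) {K : W → Type} [∀ v, Fintype (K v)]
    [∀ v, DecidableEq (K v)] {Y : Type} [Fintype Y] [DecidableEq Y] [Inhabited Y]
    (A : Y → Matrix (Fin d) (Fin d) ℂ) (hA : ∀ x y x' y', ∑ s, star (A s x y) * A s x' y' =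
      if x = x' ∧ y = y' then (d : ℂ) else 0)
    {O : Type} [Fintype O] [Inhabited O]
    (e : ∀ v, (W → O) → (∀ l, Fin (S.r l) → Y) → K v → (L → Fin d) → (L → Fin d) → ℂ)
    (he : ∀ v o m p q p' q', ∑ i, ∑ z, star (e v (Function.update o v i) m z p q) *
      e v (Function.update o v i) m z p' q' =
        if (v = v₀ → p = p') ∧ ∀ l, tgt l = v → q l = q' l then 1 else 0)
    (T : Finset W) (hTV : T ⊆ V₀)
    (hT : ∀ v ∉ T, ∀ o o' m m', o v = o' v → e v o m = e v o' m')
    (hT' : ∀ v ∈ T, ∀ o o' m, o v = o' v → (∀ u ∉ T, o u = o' u) → e v o m = e v o' m) :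
    ∃ Λ : MultiOp (NetSystem G d) → MultiOp K, IsLOCC Λ ∧
      ∃ (B : Type) (_ : Fintype B) (M : B → Matrix (∀ v, K v) (∀ v, NetSystem G d v) ℂ),
        (∀ ρ, Λ ρ = ∑ b, M b * ρ * (M b).conjTranspose) ∧
        ∀ b, ∃ (o : W → O) (m : ∀ l, Fin (S.r l) → Y), ∀ q : EdgeType G → LinkLabel d, ∃ c : ℂ,
          ∀ z, Matrix.mulVec (M b) (netVector G q) z = c * ∑ s : L → Fin d × Fin d,
            (∏ v, e v o m (z v) (fun l => (s l).1) fun l => (s l).2) *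
              ∏ l, S.legMatrix q l (fun j => A (m l j)) (s l).1 (s l).2 := by
  -- The teleportation outcomes along the legs, each read off from the party that produced it.
  let mids : (W → (∀ l, Fin (S.r l) → Y) × O) → ∀ l, Fin (S.r l) → Y :=
    fun o l j => (o (S.node l j)).1 l j
  let E : ∀ v, (W → (∀ l, Fin (S.r l) → Y) × O) → K v →
      ((Σ l, Fin (S.r l + 1)) × Bool → Fin d) → ℂ := fun v o z y =>
    e v (fun u => (o u).2) (mids o) z (fun l => y (⟨l, 0⟩, false))
      fun l => y (⟨l, Fin.last _⟩, true)
  obtain ⟨Λ, hΛ, B, hB, M, hsum, hM⟩ := exists_isLOCC_of_used (K := K) S.usedDart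
    S.usedDart_injective (O := (∀ l, Fin (S.r l) → Y) × O)
    (fun v o z y => S.innerAmplitude A v (o v).1 y * E v o z y)
    (by
      intro v o y y'
      have hup : ∀ i, (fun u => (Function.update o v i u).2) =
          Function.update (fun u => (o u).2) v i.2 := by
        intro i
        funext u
        by_cases hu : u = v
        · subst hu
          simp
        · simp [hu]
      have hE : ∀ i z y, E v (Function.update o v i) z y =
          e v (Function.update (fun u => (o u).2) v i.2) (mids o) z (fun l => y (⟨l, 0⟩, false))
            fun l => y (⟨l, Fin.last _⟩, true) := by
        intro i z y
        simp only [E]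
        rw [hup]
        -- A party in `T ⊆ V₀` is no inner vertex, so its own outcome does not affect `mids`; a
        -- party outside `T` ignores `mids`.
        by_cases hv : v ∈ T
        · have : mids (Function.update o v i) = mids o := by
            funext l j
            have : S.node l j ≠ v := fun h => S.node_notMem l j (h ▸ hTV hv)
            simp [mids, this]
          rw [this]
        · rw [hT v hv _ _ _ (mids o) rfl]
      simp only [hE, Function.update_self]
      have : ∀ i : (∀ l, Fin (S.r l) → Y) × O, ∑ z,
          star (S.innerAmplitude A v i.1 y * e v (Function.update (fun u => (o u).2) v i.2)
            (mids o) z (fun l => y (⟨l, 0⟩, false)) fun l => y (⟨l, Fin.last _⟩, true)) *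
          (S.innerAmplitude A v i.1 y' * e v (Function.update (fun u => (o u).2) v i.2)
            (mids o) z (fun l => y' (⟨l, 0⟩, false)) fun l => y' (⟨l, Fin.last _⟩, true)) =
          (star (S.innerAmplitude A v i.1 y) * S.innerAmplitude A v i.1 y') * ∑ z,
          star (e v (Function.update (fun u => (o u).2) v i.2)
            (mids o) z (fun l => y (⟨l, 0⟩, false)) fun l => y (⟨l, Fin.last _⟩, true)) *
          (e v (Function.update (fun u => (o u).2) v i.2)
            (mids o) z (fun l => y' (⟨l, 0⟩, false)) fun l => y' (⟨l, Fin.last _⟩, true)) := by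
        intro i
        rw [Finset.mul_sum]
        refine Finset.sum_congr rfl fun z _ => ?_
        rw [star_mul']
        ring
      simp only [this]
      rw [sum_mul_prod (fun m => star (S.innerAmplitude A v m y) * S.innerAmplitude A v m y')
        (fun i => ∑ z, star (e v (Function.update (fun u => (o u).2) v i)
            (mids o) z (fun l => y (⟨l, 0⟩, false)) fun l => y (⟨l, Fin.last _⟩, true)) *
          (e v (Function.update (fun u => (o u).2) v i)
            (mids o) z (fun l => y' (⟨l, 0⟩, false)) fun l => y' (⟨l, Fin.last _⟩, true))),
        S.innerAmplitude_complete A hA, he, ite_zero_mul_ite_zero, mul_one]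
      refine if_congr ?_ rfl rfl
      exact (S.usedDart_fst_iff v y y').symm)
    T
    (by
      intro v hv o o' h
      funext z y
      simp only [E, h]
      rw [hT v hv (fun u => (o u).2) (fun u => (o' u).2) (mids o) (mids o') (by simp only [h])])
    (by
      intro v hv o o' h h'
      funext z y
      have : mids o = mids o' := by
        funext l j
        simp only [mids]
        rw [h' _ fun hn => S.node_notMem l j (hTV hn)]
      simp only [E, h, this]
      rw [hT' v hv (fun u => (o u).2) (fun u => (o' u).2) (mids o') (by simp only [h])
        fun u hu => by rw [h' u hu]])
  refine ⟨Λ, hΛ, B, hB, M, hsum, fun b => ?_⟩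
  obtain ⟨o, w, c, hc⟩ := hM b
  refine ⟨fun u => (o u).2, mids o, fun q => ?_⟩
  obtain ⟨c₁, hc₁⟩ := S.exists_prod_linkVector_eq q w
  obtain ⟨c₂, hc₂⟩ := S.exists_prod_innerAmplitude_eq A fun v => (o v).1
  refine ⟨c * c₂ * c₁, fun z => ?_⟩
  have h1 := hc (fun f => ∏ e, linkVector d (q e) (f (orient G e)) (f (orient G e).symm)) z
  refine (Eq.trans rfl h1).trans ?_
  simp only [hc₁, Finset.prod_mul_distrib, hc₂]
  rw [mul_assoc c, mul_assoc c]
  congr 1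
  have h2 := sum_mul_prod_fiberwise
    (fun l (y : Fin (S.r l + 1) → Bool → Fin d) => (y 0 false, y (Fin.last _) true))
    (fun s => ∏ v, e v (fun u => (o u).2) (mids o) (z v) (fun l => (s l).1) fun l => (s l).2)
    (fun l y => (∏ j : Fin (S.r l), A (mids o l j) (y j.castSucc true) (y j.succ false)) *
        ∏ j, S.linkMatrix q l j (y j false) (y j true))
  have h3 : ∀ s : L → Fin d × Fin d, ∏ l, S.legMatrix q l (fun j => A (mids o l j)) (s l).1
      (s l).2 = ∏ l, ∑ y : Fin (S.r l + 1) → Bool → Fin d,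
        if (y 0 false, y (Fin.last _) true) = s l then
          (∏ j : Fin (S.r l), A (mids o l j) (y j.castSucc true) (y j.succ false)) *
        ∏ j, S.linkMatrix q l j (y j false) (y j true) else 0 := fun s => rfl
  simp only [h3]
  rw [← h2, Finset.mul_sum]
  refine Fintype.sum_equiv (S.labelEquiv (Fin d)) _ _ fun y => ?_
  rw [Finset.prod_mul_distrib]
  have h4 : ∀ l j b, S.labelEquiv (Fin d) y l j b = y (⟨l, j⟩, b) := fun l j b => rfl
  simp only [h4, E, mids]
  ring

end Reduction

/-! ## Distillation of a target state from a system of legs -/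

theorem sum_prop_fun {p : Prop} [Decidable p] {d : ℕ} (hp : p) (f : Fin d → ℂ) :
    ∑ z : p → Fin d, f (z hp) = ∑ x, f x :=
  Fintype.sum_bijective (fun z : p → Fin d => z hp)
    ⟨fun _ _ h => funext fun _ => h, fun x => ⟨fun _ => x, rfl⟩⟩ _ _ fun _ => rfl

theorem sum_prop_fun_of_not {p : Prop} [Decidable p] {d : ℕ} (hp : ¬ p) (c : ℂ) :
    ∑ _z : p → Fin d, c = c := by
  have : IsEmpty p := ⟨hp⟩
  simp

/-- An empty sum cannot be the identity. The element serves as the default outcome of parties that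
do not use this component. -/
theorem Gadget.nonempty_S {H K : Type} [Fintype H] [DecidableEq H] [Fintype K] [Nonempty H]
    (g : Gadget H K) : Nonempty g.S := by
  by_contra h
  rw [not_nonempty_iff] at h
  have := g.sum_A
  rw [Finset.univ_eq_empty, Finset.sum_empty] at this
  exact zero_ne_one this

theorem Gadget.nonempty_R {H K : Type} [Fintype H] [DecidableEq H] [Fintype K] [Nonempty H]
    (g : Gadget H K) : Nonempty g.R := by
  by_contra h
  rw [not_nonempty_iff] at h
  obtain ⟨s⟩ := g.nonempty_S
  have := g.sum_B s
  rw [Finset.univ_eq_empty, Finset.sum_empty] at this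
  exact zero_ne_one this

theorem unitary_list_prod {X : Type} [Fintype X] [DecidableEq X] (l : List (Matrix X X ℂ))
    (h : ∀ A ∈ l, A.conjTranspose * A = 1) : l.prod.conjTranspose * l.prod = 1 := by
  induction l with
  | nil => simp
  | cons A l ih =>
    rw [List.prod_cons, Matrix.conjTranspose_mul, Matrix.mul_assoc, ← Matrix.mul_assoc _ A,
      h A (by simp), Matrix.one_mul]
    exact ih fun B hB => h B (List.mem_cons_of_mem _ hB)

/-- Entrywise form of the completeness relation. -/
theorem sum_star_mul_of_complete {ι H K : Type} [Fintype ι] [Fintype K] [DecidableEq H]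
    {A : ι → Matrix K H ℂ} (hA : ∑ i, (A i).conjTranspose * A i = 1) (p p' : H) :
    ∑ i, ∑ z, star (A i z p) * A i z p' = if p = p' then 1 else 0 := by
  rw [← Matrix.one_apply, ← hA, Matrix.sum_apply]
  rfl

section Teleport

variable {d : ℕ} [NeZero d] {T : Type} [Fintype T] [DecidableEq T] {Y : Type} [Fintype Y]
  (A : Y → Matrix (Fin d) (Fin d) ℂ) (ψ : Matrix (Fin d) (T → Fin d) ℂ)

/-- The measurement by which the registers `T` of the state `ψ` are teleported. -/
def teleportOp (σ : T → Y) : Matrix (Fin d) (T → Fin d) ℂ :=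
  (((Real.sqrt d)⁻¹ : ℝ) : ℂ) ^ Fintype.card T • (ψ * (localTensor fun t => A (σ t)).transpose)

/-- Completeness of `A` at each register identifies the link labels `x`, `x'` and the register
labels `y`, `y'`; what is left is the squared norm of `ψ`. The factors $d^{-1/2}$, one per register,
cancel the values `d`. -/
theorem sum_teleportOp (hA : ∀ x y x' y', ∑ s, star (A s x y) * A s x' y' =
      if x = x' ∧ y = y' then (d : ℂ) else 0) (hψ : ∑ z, ∑ y, ‖ψ z y‖ ^ 2 = 1) :
    ∑ σ, (teleportOp A ψ σ).conjTranspose * teleportOp A ψ σ = 1 := by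
  have hd : star ((((Real.sqrt d)⁻¹ : ℝ) : ℂ) ^ Fintype.card T) *
      (((Real.sqrt d)⁻¹ : ℝ) : ℂ) ^ Fintype.card T = ∏ _t : T, (d : ℂ)⁻¹ := by
    have hs : star (((Real.sqrt d)⁻¹ : ℝ) : ℂ) = (((Real.sqrt d)⁻¹ : ℝ) : ℂ) :=
      Complex.conj_ofReal _
    rw [star_pow, hs, ← mul_pow, ← Complex.ofReal_mul, ← mul_inv,
      Real.mul_self_sqrt (by positivity), Complex.ofReal_inv, Complex.ofReal_natCast,
      Finset.prod_const, Finset.card_univ]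
  have hterm : ∀ σ z x x', star (teleportOp A ψ σ z x) * teleportOp A ψ σ z x' =
      ∑ y, ∑ y', star (ψ z y) * ψ z y' *
        ∏ t, ((d : ℂ)⁻¹ * (star (A (σ t) (x t) (y t)) * A (σ t) (x' t) (y' t))) := by
    intro σ z x x'
    simp only [teleportOp, Matrix.smul_apply, smul_eq_mul, Matrix.mul_apply,
      Matrix.transpose_apply, localTensor_apply]
    rw [star_mul', mul_mul_mul_comm, hd, star_sum, Finset.sum_mul_sum, Finset.mul_sum]
    refine Finset.sum_congr rfl fun y _ => ?_
    rw [Finset.mul_sum]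
    refine Finset.sum_congr rfl fun y' _ => ?_
    rw [star_mul', star_prod, Finset.prod_mul_distrib, Finset.prod_mul_distrib]
    ring
  have hsum : ∀ x x' y y' : T → Fin d, ∑ σ : T → Y,
      ∏ t, ((d : ℂ)⁻¹ * (star (A (σ t) (x t) (y t)) * A (σ t) (x' t) (y' t))) =
      if x = x' ∧ y = y' then 1 else 0 := by
    intro x x' y y'
    have h1 : ∑ σ : T → Y,
        ∏ t, ((d : ℂ)⁻¹ * (star (A (σ t) (x t) (y t)) * A (σ t) (x' t) (y' t))) =
        ∏ t, ∑ s, ((d : ℂ)⁻¹ * (star (A s (x t) (y t)) * A s (x' t) (y' t))) := by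
      rw [Finset.prod_univ_sum, Fintype.piFinset_univ]
    have hd0 : (d : ℂ) ≠ 0 := NeZero.ne _
    rw [h1]
    simp only [← Finset.mul_sum, hA, mul_ite, mul_zero, inv_mul_cancel₀ hd0]
    rw [Fintype.prod_boole]
    refine if_congr ?_ rfl rfl
    rw [funext_iff, funext_iff, forall_and]
  ext x x'
  have h2 : (∑ σ, (teleportOp A ψ σ).conjTranspose * teleportOp A ψ σ) x x' =
      ∑ σ, ∑ z, star (teleportOp A ψ σ z x) * teleportOp A ψ σ z x' := by
    rw [Matrix.sum_apply]
    rfl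
  rw [h2]
  simp only [hterm]
  rw [Finset.sum_comm]
  have h3 : ∀ z, ∑ σ : T → Y, ∑ y, ∑ y', star (ψ z y) * ψ z y' *
      ∏ t, ((d : ℂ)⁻¹ * (star (A (σ t) (x t) (y t)) * A (σ t) (x' t) (y' t))) =
      ∑ y, ∑ y', star (ψ z y) * ψ z y' * if x = x' ∧ y = y' then 1 else 0 := by
    intro z
    rw [Finset.sum_comm]
    refine Finset.sum_congr rfl fun y _ => ?_
    rw [Finset.sum_comm]
    refine Finset.sum_congr rfl fun y' _ => ?_
    rw [← Finset.mul_sum, hsum]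
  simp only [h3]
  by_cases hx : x = x'
  · subst hx
    have h4 : ∀ z y, star (ψ z y) * ψ z y = ((‖ψ z y‖ ^ 2 : ℝ) : ℂ) := by
      intro z y
      push_cast
      exact Complex.conj_mul' _
    simp only [true_and, mul_ite, mul_one, mul_zero, Finset.sum_ite_eq, Finset.mem_univ, if_true,
      h4, Matrix.one_apply_eq]
    exact_mod_cast hψ
  · simp [hx]

/-- The receivers undo the announced Weyl operators, so every outcome gives `ψ` with the same
factor. -/
theorem teleportOp_mul (hA : ∀ s, (A s).conjTranspose * A s = 1) (σ : T → Y) :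
    ∃ c : ℂ, teleportOp A ψ σ * (localTensor fun t => (A (σ t)).conjTranspose).transpose =
      c • ψ := by
  refine ⟨(((Real.sqrt d)⁻¹ : ℝ) : ℂ) ^ Fintype.card T, ?_⟩
  rw [teleportOp, Matrix.smul_mul, Matrix.mul_assoc, ← Matrix.transpose_mul, localTensor_mul]
  simp only [hA]
  rw [localTensor_one, Matrix.transpose_one, Matrix.mul_one]

end Teleport

section Distill

variable {W : Type} [Fintype W] [DecidableEq W] {G : SimpleGraph W} [DecidableRel G.Adj]
  {d : ℕ} [NeZero d] {v₀ : W} {V₀ : Finset W}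

/-- A label of `V₀`, put together from labels of `v₀` and of the other parties. -/
def assembleLabel (v₀ : W) (V₀ : Finset W) {P : W → Prop} (hP : ∀ v, P v → v ∈ V₀) (z : Fin d)
    (x : {t // t ∈ V₀.erase v₀} → Fin d) : ∀ v, P v → Fin d := fun v hv =>
  if h : v = v₀ then z else x ⟨v, Finset.mem_erase.2 ⟨h, hP v hv⟩⟩

theorem assembleLabel_eq {P : W → Prop} (hP : ∀ v, P v → v ∈ V₀) (hP' : ∀ v ∈ V₀, P v)
    (hv₀ : v₀ ∈ V₀) (z : ∀ v, P v → Fin d) :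
    assembleLabel v₀ V₀ hP (z v₀ (hP' _ hv₀))
      (fun t => z t.1 (hP' _ (Finset.mem_of_mem_erase t.2))) = z := by
  funext v hv
  rw [assembleLabel]
  split_ifs with h
  · subst h
    rfl
  · rfl

theorem sum_assembleLabel {P : W → Prop} [∀ v, Decidable (P v)] (hP : ∀ v, P v → v ∈ V₀)
    (hP' : ∀ v ∈ V₀, P v) (hv₀ : v₀ ∈ V₀) (f : (∀ v, P v → Fin d) → ℝ) :
    ∑ z, ∑ x, f (assembleLabel v₀ V₀ hP z x) = ∑ z, f z := by
  rw [← Fintype.sum_prod_type']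
  refine Fintype.sum_bijective (fun c : Fin d × ({t // t ∈ V₀.erase v₀} → Fin d) =>
    assembleLabel v₀ V₀ hP c.1 c.2) ⟨?_, fun z => ⟨(_, _), assembleLabel_eq hP hP' hv₀ z⟩⟩ _ _
    fun _ => rfl
  rintro ⟨z, x⟩ ⟨z', x'⟩ h
  have h1 : ∀ v hv, assembleLabel v₀ V₀ hP z x v hv = assembleLabel v₀ V₀ hP z' x' v hv :=
    fun v hv => congrFun (congrFun h v) hv
  refine Prod.ext ?_ (funext fun t => ?_)
  · simpa [assembleLabel] using h1 v₀ (hP' _ hv₀)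
  · have := h1 t.1 (hP' _ (Finset.mem_of_mem_erase t.2))
    simpa [assembleLabel, Finset.ne_of_mem_erase t.2] using this

/-- If the errors on the legs to each party are correctable, then every branch of a suitable
protocol leads to the target state. -/
theorem exists_isLOCC_of_correctable (hv₀ : v₀ ∈ V₀) {P : W → Prop} [∀ v, Decidable (P v)]
    (hP : ∀ v, P v → v ∈ V₀) (hP' : ∀ v ∈ V₀, P v) (Ψ : (∀ v, P v → Fin d) → ℂ)
    (hΨ : ∑ z, ‖Ψ z‖ ^ 2 = 1) (m : ℕ)
    (S : LegSystem G v₀ V₀ fun l : {t // t ∈ V₀.erase v₀} × CodeIndex m => l.1.1) :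
    ∃ Λ : MultiOp (NetSystem G d) → MultiOp fun v => P v → Fin d, IsLOCC Λ ∧
      ∃ (B : Type) (_ : Fintype B)
        (M : B → Matrix (∀ v, P v → Fin d) (∀ v, NetSystem G d v) ℂ),
        (∀ ρ, Λ ρ = ∑ b, M b * ρ * (M b).conjTranspose) ∧
        ∀ b (q : EdgeType G → LinkLabel d),
          (∀ t, Correctable m fun i => ∃ j, q (S.edge (t, i) j) ≠ none) →
          ∃ c : ℂ, Matrix.mulVec (M b) (netVector G q) = c • Ψ := by
  classical
  obtain ⟨hgroup, ⟨Q⟩⟩ := exists_pairing d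
  obtain ⟨g, hg⟩ := Q.exists_gadget m
  set T := {t // t ∈ V₀.erase v₀} with hT
  let Y := Fin d × Fin d
  let A : Y → Matrix (Fin d) (Fin d) ℂ := Q.weyl
  have hAu : ∀ s, (A s).conjTranspose * A s = 1 := Q.weyl_unitary
  have hAu' : ∀ s, A s * (A s).conjTranspose = 1 := fun s => mul_eq_one_comm.1 (hAu s)
  have hA : ∀ x y x' y', ∑ s, star (A s x y) * A s x' y' =
      if x = x' ∧ y = y' then (d : ℂ) else 0 := by
    intro x y x' y'
    simpa using Q.weyl_complete x y x' y'
  let ψ : Matrix (Fin d) (T → Fin d) ℂ := Matrix.of fun z x => Ψ (assembleLabel v₀ V₀ hP z x)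
  have hψ : ∑ z, ∑ y, ‖ψ z y‖ ^ 2 = 1 := by
    rw [← hΨ, ← sum_assembleLabel hP hP' hv₀]
    rfl
  let gT : Gadget (T → CodeIndex m → Fin d) (T → Fin d) := Gadget.pi fun _ : T => g
  have : Inhabited gT.S := Classical.inhabited_of_nonempty gT.nonempty_S
  have : Inhabited g.R := Classical.inhabited_of_nonempty g.nonempty_R
  let O := (gT.S × (T → Y)) × g.R
  -- the measurement of `v₀`
  let As : gT.S × (T → Y) → Matrix (Fin d) (T → CodeIndex m → Fin d) ℂ := fun a =>
    teleportOp A ψ a.2 * gT.A a.1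
  have hAs : ∑ a, (As a).conjTranspose * As a = 1 := by
    have h1 : ∀ a, (As a).conjTranspose * As a = (gT.A a.1).conjTranspose *
        ((teleportOp A ψ a.2).conjTranspose * teleportOp A ψ a.2) * gT.A a.1 := by
      intro a
      simp only [As, Matrix.conjTranspose_mul, Matrix.mul_assoc]
    simp only [h1]
    rw [Fintype.sum_prod_type, ← gT.sum_A]
    refine Finset.sum_congr rfl fun s _ => ?_
    dsimp only
    rw [← Matrix.sum_mul, ← Matrix.mul_sum, sum_teleportOp A ψ hA hψ, Matrix.mul_one]
  -- the leg unitaries and their corrections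
  let V : (∀ l, Fin (S.r l) → Y) → T → CodeIndex m → Matrix (Fin d) (Fin d) ℂ := fun μ t i =>
    (List.ofFn fun j => A (μ (t, i) j)).prod
  have hV : ∀ μ t i, (V μ t i).conjTranspose * V μ t i = 1 := fun μ t i =>
    unitary_list_prod _ fun B hB => by
      rw [List.mem_ofFn] at hB
      obtain ⟨j, rfl⟩ := hB
      exact hAu _
  have hV' : ∀ μ t i, V μ t i * (V μ t i).conjTranspose = 1 := fun μ t i =>
    mul_eq_one_comm.1 (hV μ t i)
  let C : (∀ l, Fin (S.r l) → Y) → T → CodeIndex m → Matrix (Fin d) (Fin d) ℂ := fun μ t i =>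
    (V μ t i).conjTranspose.transpose
  have hC : ∀ μ t, (localTensor (C μ t)).conjTranspose * localTensor (C μ t) = 1 := by
    intro μ t
    rw [localTensor_conjTranspose, localTensor_mul, ← localTensor_one]
    congr 1
    funext i
    have : (C μ t i).conjTranspose = (V μ t i).transpose := by
      ext x y
      simp [C]
    rw [this, ← Matrix.transpose_mul, hV, Matrix.transpose_one]
  -- the measurements of the other parties in `V₀`
  let Bs : T → gT.S × (T → Y) → (∀ l, Fin (S.r l) → Y) → g.R →
      Matrix (Fin d) (CodeIndex m → Fin d) ℂ := fun t a μ r =>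
    (A (a.2 t)).conjTranspose * (g.B (a.1 t) r * localTensor (C μ t))
  have hBs : ∀ t a μ, ∑ r, (Bs t a μ r).conjTranspose * Bs t a μ r = 1 := by
    intro t a μ
    have h1 : ∀ r, (Bs t a μ r).conjTranspose * Bs t a μ r = (localTensor (C μ t)).conjTranspose *
        ((g.B (a.1 t) r).conjTranspose * g.B (a.1 t) r) * localTensor (C μ t) := by
      intro r
      simp only [Bs, Matrix.conjTranspose_mul, Matrix.conjTranspose_conjTranspose,
        Matrix.mul_assoc]
      rw [← Matrix.mul_assoc (A _), hAu', Matrix.one_mul]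
    simp only [h1]
    rw [← Matrix.sum_mul, ← Matrix.mul_sum, g.sum_B, Matrix.mul_one, hC]
  -- the end measurements
  let main : ∀ v, (W → O) → (∀ l, Fin (S.r l) → Y) → P v → (P v → Fin d) →
      (T × CodeIndex m → Fin d) → (T × CodeIndex m → Fin d) → ℂ := fun v o μ hv z p q =>
    if v = v₀ then As (o v).1 (z hv) fun t i => p (t, i)
    else if ht : v ∈ V₀.erase v₀ then Bs ⟨v, ht⟩ (o v₀).1 μ (o v).2 (z hv) fun i => q (⟨v, ht⟩, i)
    else 1
  -- The centre uses the first component of the outcome, the other parties of `V₀` the second, and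
  -- the remaining parties none. Every idle component is forced to its default.
  let dummy : W → O → ℂ := fun v i =>
    if v = v₀ then if i.2 = default then 1 else 0
    else if v ∈ V₀.erase v₀ then if i.1 = default then 1 else 0
    else if i = default then 1 else 0
  let e : ∀ v, (W → O) → (∀ l, Fin (S.r l) → Y) → (P v → Fin d) →
      (T × CodeIndex m → Fin d) → (T × CodeIndex m → Fin d) → ℂ := fun v o μ z p q =>
    dummy v (o v) * if hv : P v then main v o μ hv z p q else 1
  have hv₀T : v₀ ∉ V₀.erase v₀ := Finset.notMem_erase _ _
  obtain ⟨Λ, hΛ, B, hB, M, hsum, hM⟩ := exists_isLOCC_of_legs S (K := fun v => P v → Fin d)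
    A hA e
    (by
      intro v o μ p q p' q'
      by_cases hv : v = v₀
      · subst hv
        have hPv := hP' v hv₀
        have h1 : ∀ i : O, ∑ z : P v → Fin d, star (e v (Function.update o v i) μ z p q) *
            e v (Function.update o v i) μ z p' q' =
            (∑ z, star (As i.1 z fun t j => p (t, j)) * As i.1 z fun t j => p' (t, j)) *
              if i.2 = default then 1 else 0 := by
          intro i
          rw [Finset.sum_mul, ← sum_prop_fun hPv]
          refine Finset.sum_congr rfl fun z _ => ?_
          simp only [e, dummy, main, hPv, if_true, dif_pos, Function.update_self]
          split_ifs <;> simp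
        simp only [h1]
        rw [sum_mul_prod (fun a => ∑ z, star (As a z fun t j => p (t, j)) *
          As a z fun t j => p' (t, j)) fun r => if r = default then (1 : ℂ) else 0,
          sum_star_mul_of_complete hAs]
        simp only [Finset.sum_ite_eq', Finset.mem_univ, if_true, mul_one]
        refine if_congr ?_ rfl rfl
        constructor
        · intro h
          refine ⟨fun _ => funext fun l => congrFun (congrFun h l.1) l.2, fun l hl => ?_⟩
          exact absurd l.1.2 (by rw [hl]; exact hv₀T)
        · intro h
          rw [h.1 trivial]
      · by_cases ht : v ∈ V₀.erase v₀
        · have hPv := hP' v (Finset.mem_of_mem_erase ht)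
          have h1 : ∀ i : O, ∑ z : P v → Fin d, star (e v (Function.update o v i) μ z p q) *
              e v (Function.update o v i) μ z p' q' =
              (if i.1 = default then 1 else 0) *
              ∑ z, star (Bs ⟨v, ht⟩ (o v₀).1 μ i.2 z fun j => q (⟨v, ht⟩, j)) *
                Bs ⟨v, ht⟩ (o v₀).1 μ i.2 z fun j => q' (⟨v, ht⟩, j) := by
            intro i
            rw [Finset.mul_sum, ← sum_prop_fun hPv]
            refine Finset.sum_congr rfl fun z _ => ?_
            simp only [e, dummy, main, hPv, if_true, dif_pos, Function.update_self, hv, if_false,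
              ht, Function.update_of_ne (Ne.symm hv)]
            split_ifs <;> simp
          simp only [h1]
          rw [sum_mul_prod (fun a => if a = default then (1 : ℂ) else 0) fun r =>
            ∑ z, star (Bs ⟨v, ht⟩ (o v₀).1 μ r z fun j => q (⟨v, ht⟩, j)) *
              Bs ⟨v, ht⟩ (o v₀).1 μ r z fun j => q' (⟨v, ht⟩, j),
            sum_star_mul_of_complete (hBs _ _ _)]
          refine (congrArg (· * _) ((Finset.sum_ite_eq' Finset.univ default fun _ => (1 : ℂ)).trans
            (if_pos (Finset.mem_univ _)))).trans ((one_mul _).trans ?_)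
          refine if_congr ?_ rfl rfl
          constructor
          · intro h
            refine ⟨fun h' => absurd h' hv, ?_⟩
            rintro ⟨t, j⟩ rfl
            exact congrFun h j
          · intro h
            funext j
            exact h.2 (⟨v, ht⟩, j) rfl
        · have hPv : ¬ P v := fun h => ht (Finset.mem_erase.2 ⟨hv, hP v h⟩)
          have h1 : ∀ i : O, ∑ z : P v → Fin d, star (e v (Function.update o v i) μ z p q) *
              e v (Function.update o v i) μ z p' q' = if i = default then 1 else 0 := by
            intro i
            rw [← sum_prop_fun_of_not hPv (if i = default then (1 : ℂ) else 0)]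
            refine Finset.sum_congr rfl fun z _ => ?_
            simp only [e, dummy, hPv, Function.update_self, hv, if_false, ht, dif_neg,
              not_false_iff]
            split_ifs <;> simp
          simp only [h1]
          rw [Finset.sum_ite_eq' Finset.univ, if_pos (Finset.mem_univ _), if_pos]
          exact ⟨fun h => absurd h hv, fun l hl => absurd l.1.2 (by rw [hl]; exact ht)⟩)
    (V₀.erase v₀) (Finset.erase_subset _ _)
    (by
      intro v hv o o' μ μ' h
      funext z p q
      simp only [e, main, h, hv, dif_neg, not_false_iff])
    (by
      intro v hv o o' μ h h'
      funext z p q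
      simp only [e, main, h, h' v₀ hv₀T])
  refine ⟨Λ, hΛ, B, hB, M, hsum, fun b q hq => ?_⟩
  obtain ⟨o, μ, hc⟩ := hM b
  obtain ⟨c, hc⟩ := hc q
  set LT : T → CodeIndex m → Matrix (Fin d) (Fin d) ℂ := fun t i =>
    S.legMatrix q (t, i) fun j => A (μ (t, i) j) with hLT
  -- the contraction of all legs
  have hdist : ∃ c' : ℂ, As (o v₀).1 * localTensor (fun t => localTensor (LT t)) *
      (localTensor fun t : T => Bs t (o v₀).1 μ (o t.1).2).transpose = c' • ψ := by
    set a := (o v₀).1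
    -- The leg after the receiver has undone the unitary `V`. On an error-free leg the matrix is a
    -- multiple of `V * Vᴴ = 1`.
    let T' : T → CodeIndex m → Matrix (Fin d) (Fin d) ℂ := fun t i =>
      LT t i * (C μ t i).transpose
    have hT' : ∀ t i, (¬ ∃ j, q (S.edge (t, i) j) ≠ none) → IsScalarMatrix (T' t i) := by
      intro t i hgood
      push Not at hgood
      obtain ⟨c', hc'⟩ := S.legMatrix_of_perfect q (t, i) (fun j => A (μ (t, i) j)) hgood
      refine ⟨c', ?_⟩
      simp only [T', hLT, hc', C, Matrix.transpose_transpose]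
      rw [Matrix.smul_mul]
      congr 1
      exact hV' μ t i
    have hmaps : gT.Maps (localTensor fun t => localTensor (T' t))
        (gT.A a.1 * localTensor (fun t => localTensor (T' t)) *
          (gT.B a.1 fun t => (o t.1).2).transpose) := ⟨a.1, fun t => (o t.1).2, rfl⟩
    obtain ⟨T'', hT'', hmaps'⟩ := hmaps.of_pi
    have hscalar : ∀ t, ∃ c' : ℂ, T'' t = c' • 1 := fun t =>
      hg _ _ _ (hmaps' t) (hT' t) (hq t)
    choose cs hcs using hscalar
    obtain ⟨c₁, hc₁⟩ := teleportOp_mul A ψ hAu a.2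
    refine ⟨(∏ t, cs t) * c₁, ?_⟩
    have h1 : (localTensor fun t : T => Bs t a μ (o t.1).2) =
        localTensor (fun t => (A (a.2 t)).conjTranspose) *
          ((gT.B a.1 fun t => (o t.1).2) * localTensor fun t => localTensor (C μ t)) := by
      simp only [gT, Gadget.pi, localTensor_mul]
      rfl
    have h2 : localTensor (fun t => localTensor (LT t)) *
        (localTensor fun t => localTensor (C μ t)).transpose =
        localTensor fun t => localTensor (T' t) := by
      simp only [localTensor_transpose, localTensor_mul]
      rfl
    have h3 : localTensor T'' = (∏ t, cs t) • 1 := by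
      rw [← localTensor_one, ← localTensor_smul]
      congr 1
      exact funext hcs
    -- From the inside outwards: correction of the legs, distillation to scalar links, teleportation
    -- of `ψ` with its correction.
    calc _ = teleportOp A ψ a.2 * (gT.A a.1 * (localTensor (fun t => localTensor (LT t)) *
          (localTensor fun t => localTensor (C μ t)).transpose) *
          (gT.B a.1 fun t => (o t.1).2).transpose) *
          (localTensor fun t => (A (a.2 t)).conjTranspose).transpose := by
          rw [h1]
          simp only [As, Matrix.transpose_mul, Matrix.mul_assoc]
      _ = _ := by
          rw [h2, hT'', h3, Matrix.mul_smul, Matrix.mul_one, Matrix.smul_mul, hc₁, smul_smul]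
  obtain ⟨c', hc'⟩ := hdist
  refine ⟨c * (∏ v, dummy v (o v)) * c', ?_⟩
  funext z
  have hz : Ψ z = ψ (z v₀ (hP' _ hv₀))
      fun t => z t.1 (hP' _ (Finset.mem_of_mem_erase t.2)) := by
    simp only [ψ, Matrix.of_apply]
    rw [assembleLabel_eq hP hP' hv₀ z]
  have hprod : ∀ p q : T × CodeIndex m → Fin d, ∏ v, e v o μ (z v) p q =
      (∏ v, dummy v (o v)) * (As (o v₀).1 (z v₀ (hP' _ hv₀)) (fun t i => p (t, i)) *
        localTensor (fun t : T => Bs t (o v₀).1 μ (o t.1).2)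
          (fun t => z t.1 (hP' _ (Finset.mem_of_mem_erase t.2))) fun t i => q (t, i)) := by
    intro p q
    simp only [e]
    rw [Finset.prod_mul_distrib]
    congr 1
    rw [← Finset.mul_prod_erase _ _ (Finset.mem_univ v₀)]
    congr 1
    · simp [main, hP' _ hv₀]
    · rw [localTensor_apply]
      symm
      rw [← Finset.prod_coe_sort (Finset.univ.erase v₀)]
      refine Fintype.prod_of_injective (fun t : T => (⟨t.1, Finset.mem_erase.2
        ⟨Finset.ne_of_mem_erase t.2, Finset.mem_univ _⟩⟩ : {v // v ∈ Finset.univ.erase v₀}))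
        (fun t t' h => Subtype.ext (congrArg (fun x => x.1) h)) _ _ ?_ ?_
      · rintro ⟨v, hv⟩ hr
        have ht : v ∉ V₀.erase v₀ := fun ht => hr ⟨⟨v, ht⟩, rfl⟩
        have hPv : ¬ P v := fun h => ht (Finset.mem_erase.2 ⟨Finset.ne_of_mem_erase hv, hP v h⟩)
        simp [hPv]
      · rintro ⟨t, ht⟩
        have hPt := hP' t (Finset.mem_of_mem_erase ht)
        simp only [hPt, dif_pos, main, Finset.ne_of_mem_erase ht, if_false, ht]
  rw [hc, Pi.smul_apply, smul_eq_mul, hz, mul_assoc, mul_assoc]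
  congr 1
  have hψ' : c' * ψ (z v₀ (hP' _ hv₀))
      (fun t => z t.1 (hP' _ (Finset.mem_of_mem_erase t.2))) =
      (As (o v₀).1 * localTensor (fun t => localTensor (LT t)) *
      (localTensor fun t : T => Bs t (o v₀).1 μ (o t.1).2).transpose) (z v₀ (hP' _ hv₀))
      (fun t => z t.1 (hP' _ (Finset.mem_of_mem_erase t.2))) := by
    rw [hc']
    rfl
  rw [hψ', Matrix.mul_apply, Finset.mul_sum]
  let E : (T × CodeIndex m → Fin d × Fin d) ≃
      (T → CodeIndex m → Fin d) × (T → CodeIndex m → Fin d) :=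
    { toFun := fun s => (fun t i => (s (t, i)).1, fun t i => (s (t, i)).2)
      invFun := fun x l => (x.1 l.1 l.2, x.2 l.1 l.2)
      left_inv := fun _ => rfl
      right_inv := fun _ => rfl }
  rw [Fintype.sum_equiv E _ (fun x => (∏ v, dummy v (o v)) *
    (As (o v₀).1 (z v₀ (hP' _ hv₀)) x.1 * localTensor (fun t => localTensor (LT t)) x.1 x.2 *
      localTensor (fun t : T => Bs t (o v₀).1 μ (o t.1).2)
          (fun t => z t.1 (hP' _ (Finset.mem_of_mem_erase t.2))) x.2)) ?_]
  · rw [Fintype.sum_prod_type_right]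
    refine Finset.sum_congr rfl fun x _ => ?_
    rw [Matrix.mul_apply, Finset.sum_mul, Finset.mul_sum]
    rfl
  · intro s
    have hl : ∏ l, S.legMatrix q l (fun j => A (μ l j)) (s l).1 (s l).2 =
        localTensor (fun t => localTensor (LT t)) (E s).1 (E s).2 := by
      rw [Fintype.prod_prod_type]
      rfl
    have hring : ∀ {a b D x y z : ℂ}, a = D * (x * z) → b = y → a * b = D * (x * y * z) := by
      rintro _ _ _ _ _ _ rfl rfl
      ring
    have hp := hprod (fun l => (s l).1) fun l => (s l).2
    exact hring hp hl

end Distill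

/-! ### Leg systems from edge-disjoint spiders -/

section OfSpiders

variable {W : Type} [Fintype W] [DecidableEq W] {G : SimpleGraph W} [DecidableRel G.Adj]
  {v₀ : W} {V₀ : Finset W}

theorem Spider.one_le_length {T : Finset W} (S : Spider G v₀ T) (t : {t // t ∈ T}) :
    1 ≤ (S.leg t).length := by
  rw [Nat.one_le_iff_ne_zero]
  intro h
  have := SimpleGraph.Walk.eq_of_length_eq_zero h
  exact S.center_notMem (this ▸ t.2)

/-- The dart number `j` of a leg of a spider. -/
def Spider.dart {T : Finset W} (S : Spider G v₀ T) (t : {t // t ∈ T})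
    (j : Fin ((S.leg t).length - 1 + 1)) : G.Dart :=
  ⟨((S.leg t).getVert j, (S.leg t).getVert (j + 1)),
    (S.leg t).adj_getVert_succ (by have := S.one_le_length t; omega)⟩

theorem Spider.edge_dart_mem_edges {T : Finset W} (S : Spider G v₀ T) (t : {t // t ∈ T})
    (j : Fin ((S.leg t).length - 1 + 1)) : (S.dart t j).edge ∈ S.edges :=
  have hj : (j : ℕ) < (S.leg t).darts.length := by
    have := S.one_le_length t
    rw [SimpleGraph.Walk.length_darts]
    omega
  ⟨t, List.mem_map.2 ⟨(S.leg t).darts[(j : ℕ)], List.getElem_mem hj, by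
    rw [SimpleGraph.Walk.darts_getElem_eq_getVert]
    rfl⟩⟩

/-- On one leg a path repeats no vertex, and traversal in opposite directions would need `j = j' +
1` and `j + 1 = j'`. Two different legs meet only in the centre, so a common edge would be a loop.
-/
theorem Spider.eq_of_edge_dart_eq {T : Finset W} (S : Spider G v₀ T) {t t' : {t // t ∈ T}}
    {j : Fin ((S.leg t).length - 1 + 1)} {j' : Fin ((S.leg t').length - 1 + 1)}
    (h : (S.dart t j).edge = (S.dart t' j').edge) : t = t' ∧ (j : ℕ) = j' := by
  have h1 := S.one_le_length t
  have h1' := S.one_le_length t'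
  have hj : (j : ℕ) < (S.leg t).length := by omega
  have hj' : (j' : ℕ) < (S.leg t').length := by omega
  have h : s((S.leg t).getVert j, (S.leg t).getVert (j + 1)) =
    s((S.leg t').getVert j', (S.leg t').getVert (j' + 1)) := h
  rw [Sym2.eq_iff] at h
  by_cases ht : t = t'
  · subst ht
    refine ⟨rfl, ?_⟩
    have inj := (S.isPath t).getVert_injOn
    rcases h with h | h
    · exact inj (by simp; omega) (by simp; omega) h.1
    · have e1 := inj (by simp; omega) (by simp; omega) h.1
      have e2 := inj (by simp; omega) (by simp; omega) h.2
      omega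
  · exfalso
    have key : ∀ i i', (S.leg t).getVert i = (S.leg t').getVert i' →
        (S.leg t).getVert i = v₀ := fun i i' hi =>
      S.legs_disjoint t t' ht _ ((S.leg t).getVert_mem_support i)
        (hi ▸ (S.leg t').getVert_mem_support i')
    refine ((S.leg t).adj_getVert_succ hj).ne ?_
    rcases h with h | h <;> exact (key _ _ h.1).trans (key _ _ h.2).symm

/-- The legs of pairwise edge-disjoint spiders. -/
def LegSystem.ofSpiders {I : Type} (S : I → Spider G v₀ (V₀.erase v₀))
    (hS : Pairwise fun i j => Disjoint (S i).edges (S j).edges) :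
    LegSystem G v₀ V₀ fun l : {t // t ∈ V₀.erase v₀} × I => l.1.1 where
  r l := ((S l.2).leg l.1).length - 1
  dart l j := (S l.2).dart l.1 j
  start l := by simp [Spider.dart]
  finish l := by
    have := (S l.2).one_le_length l.1
    simp only [Spider.dart, Fin.val_last]
    rw [Nat.sub_add_cancel this, SimpleGraph.Walk.getVert_length]
  chain l j := by simp [Spider.dart]
  -- An inner vertex in `V₀` would be the centre or the end of its own leg, which a path excludes,
  -- or the end of another leg, which disjointness of the legs excludes.
  inner l j hmem := by
    have h1 := (S l.2).one_le_length l.1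
    have hj := j.2
    have inj := ((S l.2).isPath l.1).getVert_injOn
    set w := ((S l.2).leg l.1).getVert (j + 1) with hw
    have hw' : ((S l.2).dart l.1 j.succ).fst = w := by simp [Spider.dart, hw]
    rw [hw'] at hmem
    have hne : w ≠ v₀ := by
      intro h
      have h0 : ((S l.2).leg l.1).getVert (j + 1) = ((S l.2).leg l.1).getVert 0 := by
        rw [← hw, h, SimpleGraph.Walk.getVert_zero]
      have := inj (by simp; omega) (by simp) h0
      omega
    have hT : w ∈ V₀.erase v₀ := Finset.mem_erase.2 ⟨hne, hmem⟩
    by_cases ht : l.1 = ⟨w, hT⟩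
    · have hlt : w = l.1.1 := by rw [ht]
      have h0 : ((S l.2).leg l.1).getVert (j + 1) =
          ((S l.2).leg l.1).getVert ((S l.2).leg l.1).length := by
        rw [← hw, SimpleGraph.Walk.getVert_length, hlt]
      have := inj (by simp; omega) (by simp) h0
      omega
    · exact hne ((S l.2).legs_disjoint _ _ ht w (SimpleGraph.Walk.getVert_mem_support _ _)
        (SimpleGraph.Walk.end_mem_support _))
  edge_injective := by
    rintro ⟨⟨t, i⟩, j⟩ ⟨⟨t', i'⟩, j'⟩ h
    have hi : i = i' := by
      by_contra hne
      exact Set.disjoint_left.1 (hS hne) ((S i).edge_dart_mem_edges t j)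
        ((show ((S i).dart t j).edge = ((S i').dart t' j').edge from h) ▸
          (S i').edge_dart_mem_edges t' j')
    subst hi
    obtain ⟨ht, hj⟩ := (S i).eq_of_edge_dart_eq (t := t) (t' := t') (j := j) (j' := j') h
    subst ht
    exact congrArg (Sigma.mk _) (Fin.ext hj)

end OfSpiders

/-! ## Independent labels -/

section IndependentLabels

open Classical in
/-- The probability of an event for independent labels with distribution `w`. -/
def labelProb {E Z : Type} [Fintype E] [DecidableEq E] [Fintype Z] (w : Z → ℝ)
    (A : (E → Z) → Prop) : ℝ :=
  ∑ q, if A q then ∏ e, w (q e) else 0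

variable {E Z : Type} [Fintype E] [DecidableEq E] [Fintype Z] {w : Z → ℝ}

theorem labelProb_true (hw1 : ∑ z, w z = 1) : labelProb w (fun _ : E → Z => True) = 1 := by
  classical
  simp only [labelProb, if_true]
  rw [← Fintype.piFinset_univ, ← Finset.prod_univ_sum]
  simp [hw1]

theorem labelProb_add_labelProb_not (hw1 : ∑ z, w z = 1) (A : (E → Z) → Prop) :
    labelProb w A + labelProb w (fun q => ¬ A q) = 1 := by
  rw [← labelProb_true (E := E) hw1, labelProb, labelProb, labelProb, ← Finset.sum_add_distrib]
  refine Finset.sum_congr rfl fun q _ => ?_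
  by_cases h : A q <;> simp [h]

theorem labelProb_nonneg (hw : ∀ z, 0 ≤ w z) (A : (E → Z) → Prop) : 0 ≤ labelProb w A :=
  Finset.sum_nonneg fun q _ => by
    split_ifs
    · exact Finset.prod_nonneg fun e _ => hw _
    · exact le_rfl

theorem labelProb_mono (hw : ∀ z, 0 ≤ w z) {A B : (E → Z) → Prop} (h : ∀ q, A q → B q) :
    labelProb w A ≤ labelProb w B :=
  Finset.sum_le_sum fun q _ => by
    have h0 : 0 ≤ ∏ e, w (q e) := Finset.prod_nonneg fun e _ => hw _
    by_cases hA : A q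
    · simp [hA, h q hA]
    · simp only [hA, if_false]
      split_ifs
      · exact h0
      · exact le_rfl

theorem labelProb_exists_le (hw : ∀ z, 0 ≤ w z) {J : Type} [Fintype J]
    (A : J → (E → Z) → Prop) : labelProb w (fun q => ∃ j, A j q) ≤ ∑ j, labelProb w (A j) := by
  classical
  simp only [labelProb]
  rw [Finset.sum_comm]
  refine Finset.sum_le_sum fun q _ => ?_
  have h0 : 0 ≤ ∏ e, w (q e) := Finset.prod_nonneg fun e _ => hw _
  have hnn : ∀ j ∈ Finset.univ, 0 ≤ if A j q then ∏ e, w (q e) else 0 := fun j _ => by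
    split_ifs
    · exact h0
    · exact le_rfl
  by_cases h : ∃ j, A j q
  · obtain ⟨j, hj⟩ := h
    rw [if_pos ⟨j, hj⟩]
    refine le_trans ?_ (Finset.single_le_sum hnn (Finset.mem_univ j))
    rw [if_pos hj]
  · rw [if_neg h]
    exact Finset.sum_nonneg hnn

theorem labelProb_apply (hw1 : ∑ z, w z = 1) (e : E) (B : Z → Prop)
    [DecidablePred B] :
    labelProb w (fun q : E → Z => B (q e)) = ∑ z, if B z then w z else 0 := by
  classical
  have h : ∀ q : E → Z, (if B (q e) then ∏ e', w (q e') else 0) =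
      ∏ e', if e' = e then if B (q e') then w (q e') else 0 else w (q e') := by
    intro q
    rw [← Finset.mul_prod_erase _ _ (Finset.mem_univ e),
      ← Finset.mul_prod_erase Finset.univ (fun e' => if e' = e then _ else _) (Finset.mem_univ e),
      if_pos rfl]
    have : ∏ e' ∈ Finset.univ.erase e,
        (if e' = e then if B (q e') then w (q e') else 0 else w (q e')) =
        ∏ e' ∈ Finset.univ.erase e, w (q e') :=
      Finset.prod_congr rfl fun e' he' => if_neg (Finset.ne_of_mem_erase he')
    rw [this]
    split_ifs <;> simp
  calc labelProb w (fun q : E → Z => B (q e)) =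
        ∑ q : E → Z, ∏ e', if e' = e then if B (q e') then w (q e') else 0 else w (q e') :=
        Finset.sum_congr rfl fun q _ => by rw [← h]; congr
    _ = ∏ e', ∑ z, if e' = e then if B z then w z else 0 else w z := by
        rw [Finset.prod_univ_sum, Fintype.piFinset_univ]
    _ = _ := by
        rw [Finset.prod_eq_single e]
        · simp
        · intro e' _ he'
          simp [he', hw1]
        · simp

/-- Splitting the labels into those on `s` and those off `s` factorises the sum, as `B` ignores the
former and `A` the latter. -/
theorem labelProb_and (hw1 : ∑ z, w z = 1) {A B : (E → Z) → Prop} {s t : Set E}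
    (hA : DependsOn A s) (hB : DependsOn B t) (hst : Disjoint s t) :
    labelProb w (fun q => A q ∧ B q) = labelProb w A * labelProb w B := by
  classical
  have : Nonempty Z := by
    by_contra h
    rw [not_nonempty_iff] at h
    simp at hw1
  let z₀ : Z := Classical.arbitrary Z
  let F := Equiv.piEquivPiSubtypeProd (· ∈ s) fun _ : E => Z
  let A' : ({e // e ∈ s} → Z) → Prop := fun x => A (F.symm (x, fun _ => z₀))
  let B' : ({e // e ∉ s} → Z) → Prop := fun y => B (F.symm (fun _ => z₀, y))
  have hA' : ∀ x y, A (F.symm (x, y)) = A' x := fun x y => hA fun e he => by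
    simp [F, Equiv.piEquivPiSubtypeProd, he]
  have hB' : ∀ x y, B (F.symm (x, y)) = B' y := fun x y => hB fun e he => by
    have : e ∉ s := fun h => Set.disjoint_left.1 hst h he
    simp [F, Equiv.piEquivPiSubtypeProd, this]
  have hw' : ∀ x y, ∏ e, w (F.symm (x, y) e) = (∏ e, w (x e)) * ∏ e, w (y e) := by
    intro x y
    rw [← Fintype.prod_subtype_mul_prod_subtype (· ∈ s)]
    congr 1 <;> refine Fintype.prod_congr _ _ fun e => ?_
    · simp [F, Equiv.piEquivPiSubtypeProd, e.2]
    · simp [F, Equiv.piEquivPiSubtypeProd, e.2]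
  have hsum : ∀ C : (E → Z) → Prop, labelProb w C =
      ∑ x, ∑ y, if C (F.symm (x, y)) then (∏ e, w (x e)) * ∏ e, w (y e) else 0 := by
    intro C
    rw [labelProb, ← F.symm.sum_comp, Fintype.sum_prod_type]
    refine Finset.sum_congr rfl fun x _ => Finset.sum_congr rfl fun y _ => ?_
    rw [hw']
  have h1 := labelProb_true (E := {e // e ∈ s}) hw1
  have h2 := labelProb_true (E := {e // e ∉ s}) hw1
  simp only [labelProb, if_true] at h1 h2
  have hPA : labelProb w A = ∑ x, if A' x then ∏ e, w (x e) else 0 := by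
    rw [hsum]
    refine Finset.sum_congr rfl fun x _ => ?_
    simp only [hA']
    split_ifs
    · rw [← Finset.mul_sum, h2, mul_one]
    · simp
  have hPB : labelProb w B = ∑ y, if B' y then ∏ e, w (y e) else 0 := by
    rw [hsum, Finset.sum_comm]
    refine Finset.sum_congr rfl fun y _ => ?_
    simp only [hB']
    split_ifs
    · rw [← Finset.sum_mul, h1, one_mul]
    · simp
  rw [hPA, hPB, hsum, Finset.sum_mul_sum]
  refine Finset.sum_congr rfl fun x _ => Finset.sum_congr rfl fun y _ => ?_
  simp only [hA', hB']
  by_cases hx : A' x <;> by_cases hy : B' y <;> simp [hx, hy]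

theorem dependsOn_correctable {m : ℕ} {bad : CodeIndex m → (E → Z) → Prop}
    {s : CodeIndex m → Set E} (hbad : ∀ i, DependsOn (bad i) (s i)) :
    DependsOn (fun q => ¬ Correctable m fun i => bad i q) (⋃ i, s i) := by
  intro q q' h
  have : (fun i => bad i q) = fun i => bad i q' :=
    funext fun i => hbad i fun e he => h e (Set.mem_iUnion.2 ⟨i, he⟩)
  simp only [this]

/-- Concatenation suppresses independent errors doubly exponentially. -/
theorem labelProb_not_correctable_le (hw : ∀ z, 0 ≤ w z) (hw1 : ∑ z, w z = 1)
    (m : ℕ) (bad : CodeIndex m → (E → Z) → Prop) (s : CodeIndex m → Set E)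
    (hbad : ∀ i, DependsOn (bad i) (s i)) (hs : Pairwise fun i j => Disjoint (s i) (s j))
    (hprob : ∀ i, labelProb w (bad i) ≤ 1 / 162) :
    labelProb w (fun q => ¬ Correctable m fun i => bad i q) ≤ 1 / 81 * (1 / 2) ^ (m + 1) := by
  induction m with
  | zero =>
    have : (fun q => ¬ Correctable 0 fun i => bad i q) = bad () := by
      funext q
      simp [Correctable]
    rw [this]
    refine (hprob ()).trans ?_
    norm_num
  | succ m ih =>
    let F : Fin 3 × Fin 3 → (E → Z) → Prop := fun i q => ¬ Correctable m fun x => bad (i, x) q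
    have hF : ∀ i, labelProb w (F i) ≤ 1 / 81 * (1 / 2) ^ (m + 1) := fun i =>
      ih (fun x => bad (i, x)) (fun x => s (i, x)) (fun x => hbad _)
        (fun x y hxy => hs fun h => hxy (congrArg Prod.snd h)) fun x => hprob _
    have hdep : ∀ i, DependsOn (F i) (⋃ x, s (i, x)) := fun i =>
      dependsOn_correctable fun x => hbad (i, x)
    -- Failure of the next level needs two different failing blocks, which are independent. Equal
    -- pairs are kept with probability zero, so that the union bound runs over all 81 ordered pairs.
    have hpair : ∀ ij : (Fin 3 × Fin 3) × (Fin 3 × Fin 3),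
        labelProb w (fun q => ij.1 ≠ ij.2 ∧ F ij.1 q ∧ F ij.2 q) ≤
          (1 / 81 * (1 / 2) ^ (m + 1)) ^ 2 := by
      rintro ⟨i, j⟩
      by_cases hij : i = j
      · have : labelProb w (fun q => i ≠ j ∧ F i q ∧ F j q) = 0 := by
          simp [labelProb, hij]
        rw [this]
        positivity
      · have hdisj : Disjoint (⋃ x, s (i, x)) (⋃ x, s (j, x)) := by
          rw [Set.disjoint_iUnion_left]
          intro x
          rw [Set.disjoint_iUnion_right]
          intro y
          exact hs fun h => hij (congrArg Prod.fst h)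
        calc labelProb w (fun q => i ≠ j ∧ F i q ∧ F j q) ≤ labelProb w fun q => F i q ∧ F j q :=
              labelProb_mono hw fun q h => h.2
          _ = labelProb w (F i) * labelProb w (F j) := labelProb_and hw1 (hdep i) (hdep j) hdisj
          _ ≤ (1 / 81 * (1 / 2) ^ (m + 1)) * (1 / 81 * (1 / 2) ^ (m + 1)) :=
              mul_le_mul (hF i) (hF j) (labelProb_nonneg hw _) (by positivity)
          _ = _ := (sq _).symm
    calc labelProb w (fun q => ¬ Correctable (m + 1) fun i => bad i q) ≤
          labelProb w fun q => ∃ ij : (Fin 3 × Fin 3) × (Fin 3 × Fin 3),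
            ij.1 ≠ ij.2 ∧ F ij.1 q ∧ F ij.2 q := by
          refine labelProb_mono hw fun q hq => ?_
          by_contra hne
          push Not at hne
          refine hq fun i hi j hj => ?_
          by_contra hij
          exact hne (i, j) hij hi hj
      _ ≤ ∑ _ij : (Fin 3 × Fin 3) × (Fin 3 × Fin 3), (1 / 81 * (1 / 2) ^ (m + 1) : ℝ) ^ 2 :=
          (labelProb_exists_le hw _).trans (Finset.sum_le_sum fun ij _ => hpair ij)
      -- The map `x ↦ 81 x²` has the fixed point `1 / 81`, and `1 / 162` is half of it. Squaring the
      -- factor `(1 / 2) ^ (m + 1)` gains more than the single factor `1 / 2` that is kept.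
      _ = 1 / 81 * (1 / 2) ^ (m + 1 + 1) * (1 / 2) ^ m := by
          simp only [Finset.sum_const, Finset.card_univ, Fintype.card_prod, Fintype.card_fin]
          norm_num
          ring
      _ ≤ 1 / 81 * (1 / 2) ^ (m + 1 + 1) * 1 := by
          gcongr
          exact pow_le_one₀ (by norm_num) (by norm_num)
      _ = _ := mul_one _

end IndependentLabels

/-! ### Error probabilities of the legs -/

section LegErrors

variable {W : Type} [Fintype W] [DecidableEq W] {G : SimpleGraph W} [DecidableRel G.Adj]
  {d : ℕ} [NeZero d] {v₀ : W} {V₀ : Finset W}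

theorem labelProb_ne_none {p : ℝ} {E : Type} [Fintype E] [DecidableEq E] (e : E) :
    labelProb (linkWeight d p) (fun q : E → LinkLabel d => q e ≠ none) = 1 - p := by
  have h1 := sum_linkWeight d p
  rw [labelProb_apply h1 e fun z => z ≠ none]
  have h2 : ∑ z : LinkLabel d, (if z ≠ none then linkWeight d p z else 0) + p =
      ∑ z, linkWeight d p z := by
    rw [Fintype.sum_option, Fintype.sum_option]
    simp [linkWeight, add_comm]
  linarith

theorem LegSystem.labelProb_error_le {p : ℝ} (h0 : 0 ≤ p) (h1 : p ≤ 1) {L : Type} {tgt : L → W}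
    (S : LegSystem G v₀ V₀ tgt) (l : L) :
    labelProb (linkWeight d p) (fun q => ∃ j, q (S.edge l j) ≠ none) ≤ (S.r l + 1) * (1 - p) := by
  refine (labelProb_exists_le (linkWeight_nonneg d h0 h1) _).trans ?_
  refine (Finset.sum_le_sum fun j _ => (labelProb_ne_none (S.edge l j)).le).trans ?_
  rw [Finset.sum_const, Finset.card_univ, Fintype.card_fin, nsmul_eq_mul]
  push_cast
  exact le_rfl

/-- With high probability, the errors are correctable on the legs to each party. -/
theorem LegSystem.le_labelProb_correctable {p : ℝ} (h0 : 0 ≤ p) (h1 : p ≤ 1) {m : ℕ}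
    (S : LegSystem G v₀ V₀ fun l : {t // t ∈ V₀.erase v₀} × CodeIndex m => l.1.1)
    (hS : ∀ l, (S.r l + 1) * (1 - p) ≤ 1 / 162) :
    1 - V₀.card * (1 / 2) ^ (m + 1) ≤ labelProb (linkWeight d p) fun q =>
      ∀ t, Correctable m fun i => ∃ j, q (S.edge (t, i) j) ≠ none := by
  classical
  have hw := linkWeight_nonneg d h0 h1
  have hw1 := sum_linkWeight d p
  have hadd := labelProb_add_labelProb_not hw1 fun q : EdgeType G → LinkLabel d =>
    ∀ t, Correctable m fun i => ∃ j, q (S.edge (t, i) j) ≠ none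
  have hleg : ∀ t, labelProb (linkWeight d p)
      (fun q => ¬ Correctable m fun i => ∃ j, q (S.edge (t, i) j) ≠ none) ≤
      1 / 81 * (1 / 2) ^ (m + 1) := by
    intro t
    refine labelProb_not_correctable_le hw hw1 m (fun i q => ∃ j, q (S.edge (t, i) j) ≠ none)
      (fun i => Set.range (S.edge (t, i))) ?_ ?_ fun i =>
        (S.labelProb_error_le h0 h1 (t, i)).trans (hS _)
    · intro i q q' h
      have : ∀ j, q (S.edge (t, i) j) = q' (S.edge (t, i) j) := fun j => h _ ⟨j, rfl⟩
      simp only [this]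
    -- Legs to the same target are edge-disjoint, so their errors are independent. Across targets a
    -- union bound suffices.
    · intro i i' hne
      rw [Set.disjoint_left]
      rintro _ ⟨j, rfl⟩ ⟨j', h⟩
      have := S.edge_injective (a₁ := ⟨(t, i'), j'⟩) (a₂ := ⟨(t, i), j⟩) (congrArg Subtype.val h)
      exact hne (congrArg (fun u => u.1.2) this).symm
  have hnot : labelProb (linkWeight d p) (fun q : EdgeType G → LinkLabel d =>
      ¬ ∀ t, Correctable m fun i => ∃ j, q (S.edge (t, i) j) ≠ none) ≤
      V₀.card * (1 / 2) ^ (m + 1) := by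
    simp only [not_forall]
    calc _ ≤ ∑ _t : {t // t ∈ V₀.erase v₀}, (1 / 81 * (1 / 2) ^ (m + 1) : ℝ) :=
          (labelProb_exists_le hw _).trans (Finset.sum_le_sum fun t _ => hleg t)
      _ = (V₀.erase v₀).card * (1 / 81 * (1 / 2) ^ (m + 1)) := by simp
      _ ≤ V₀.card * (1 * (1 / 2) ^ (m + 1)) := by
          gcongr
          · exact Finset.erase_subset _ _
          · norm_num
      _ = _ := by rw [one_mul]
  linarith

end LegErrors

/-! ## Distillation from edge-disjoint spiders -/

section Fidelity

variable {W : Type} [Fintype W] [DecidableEq W] {G : SimpleGraph W} [DecidableRel G.Adj]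
  {d : ℕ} [NeZero d] {v₀ : W} {V₀ : Finset W}

theorem prod_linkWeight_nonneg {p : ℝ} (h0 : 0 ≤ p) (h1 : p ≤ 1)
    (q : EdgeType G → LinkLabel d) : 0 ≤ ∏ e, linkWeight d p (q e) :=
  Finset.prod_nonneg fun _ _ => linkWeight_nonneg d h0 h1 _

theorem sum_prod_linkWeight (p : ℝ) :
    ∑ q : EdgeType G → LinkLabel d, ∏ e, linkWeight d p (q e) = 1 := by
  rw [← Fintype.piFinset_univ, ← Finset.prod_univ_sum]
  simp only [sum_linkWeight, Finset.prod_const_one]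

/-- Measuring everything and preparing zeros is such a map. It serves where no spider is available
and where no party keeps anything. -/
theorem exists_isLOCC_kraus (G : SimpleGraph W) [DecidableRel G.Adj] (d : ℕ) [NeZero d]
    (P : W → Prop) [∀ v, Decidable (P v)] :
    ∃ Λ : MultiOp (NetSystem G d) → MultiOp fun v => P v → Fin d, IsLOCC Λ ∧
      ∃ (B : Type) (_ : Fintype B)
        (A : B → Matrix (∀ v, P v → Fin d) (∀ v, NetSystem G d v) ℂ),
        ∀ ρ, Λ ρ = ∑ b, A b * ρ * (A b).conjTranspose := by
  have h : ∀ v (z : P v → Fin d), star (if z = fun _ => 0 then (1 : ℂ) else 0) *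
      (if z = fun _ => 0 then 1 else 0) = if z = fun _ => 0 then 1 else 0 := fun v z => by
    split_ifs <;> simp
  obtain ⟨Λ, hΛ, B, hB, A, hA, -⟩ := exists_isLOCC_of_used (G := G) (d := d)
    (K := fun v => P v → Fin d) (U := Empty) Empty.elim (fun u => u.elim) (O := Unit)
    (fun v o z y => if z = fun _ => 0 then 1 else 0) (fun v o y y' => by
      simp only [h]
      simp) ∅
    (fun _ _ _ _ _ => rfl) (fun _ _ _ _ _ _ => rfl)
  exact ⟨Λ, hΛ, B, hB, A, hA⟩

/-- Without parties that keep anything, there is nothing to distil. -/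
theorem exists_isLOCC_fidelity_eq_one {P : W → Prop} [∀ v, Decidable (P v)] (hP : ∀ v, ¬ P v)
    (Ψ : (∀ v, P v → Fin d) → ℂ) (hΨ : ∑ z, ‖Ψ z‖ ^ 2 = 1) :
    ∃ Λ : MultiOp (NetSystem G d) → MultiOp fun v => P v → Fin d, IsLOCC Λ ∧
      ∀ p : ℝ, 0 ≤ p → p ≤ 1 → fidelity (Λ (networkState G d p)) (pureState Ψ) = 1 := by
  obtain ⟨Λ, hΛ, B, hB, A, hA⟩ := exists_isLOCC_kraus G d P
  refine ⟨Λ, hΛ, fun p h0 h1 => ?_⟩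
  have hsub : Subsingleton (∀ v, P v → Fin d) :=
    ⟨fun z z' => funext fun v => funext fun hv => absurd hv (hP v)⟩
  have hne : ∀ z, Ψ z ≠ 0 := by
    intro z hz
    rw [Fintype.sum_subsingleton _ z, hz] at hΨ
    simp at hΨ
  have h := fidelity_mixture A Λ hA hΛ.trace_eq _ (prod_linkWeight_nonneg h0 h1)
    (sum_prod_linkWeight p) (netVector G) (sum_norm_netVector G) Ψ hΨ Finset.univ
    fun q _ b => by
      -- The output space is one-dimensional, so every vector in it is a multiple of `Ψ`.
      let z : ∀ v, P v → Fin d := fun _ _ => 0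
      refine ⟨Matrix.mulVec (A b) (netVector G q) z / Ψ z, ?_⟩
      funext z'
      rw [Subsingleton.elim z' z, Pi.smul_apply, smul_eq_mul, div_mul_cancel₀ _ (hne z)]
  rw [← networkState_eq_sum, sum_prod_linkWeight] at h
  exact le_antisymm h.2 h.1

/-- Edge-disjoint spiders with short legs allow to distil any state of `V₀`. -/
theorem exists_isLOCC_of_spiders (hv₀ : v₀ ∈ V₀) {P : W → Prop} [∀ v, Decidable (P v)]
    (hP : ∀ v, P v ↔ v ∈ V₀) (Ψ : (∀ v, P v → Fin d) → ℂ) (hΨ : ∑ z, ‖Ψ z‖ ^ 2 = 1) {m : ℕ}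
    (S : CodeIndex m → Spider G v₀ (V₀.erase v₀))
    (hS : Pairwise fun i j => Disjoint (S i).edges (S j).edges) {ℓ : ℕ}
    (hℓ : ∀ i t, ((S i).leg t).length ≤ ℓ) :
    ∃ Λ : MultiOp (NetSystem G d) → MultiOp fun v => P v → Fin d, IsLOCC Λ ∧
      ∀ p : ℝ, 0 ≤ p → p ≤ 1 → ℓ * (1 - p) ≤ 1 / 162 →
        1 - V₀.card * (1 / 2) ^ (m + 1) ≤ fidelity (Λ (networkState G d p)) (pureState Ψ) ∧
          fidelity (Λ (networkState G d p)) (pureState Ψ) ≤ 1 := by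
  classical
  let L := LegSystem.ofSpiders S hS
  obtain ⟨Λ, hΛ, B, hB, A, hA, hgood⟩ := exists_isLOCC_of_correctable hv₀ (fun v => (hP v).1)
    (fun v => (hP v).2) Ψ hΨ m L
  refine ⟨Λ, hΛ, fun p h0 h1 hp => ?_⟩
  have hr : ∀ l, ((L.r l : ℝ) + 1) * (1 - p) ≤ 1 / 162 := by
    intro l
    have h : L.r l + 1 ≤ ℓ := by
      have h2 : L.r l = ((S l.2).leg l.1).length - 1 := rfl
      have := (S l.2).one_le_length l.1
      have := hℓ l.2 l.1
      omega
    have h' : (L.r l : ℝ) + 1 ≤ ℓ := by exact_mod_cast h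
    exact (mul_le_mul_of_nonneg_right h' (by linarith)).trans hp
  have h := fidelity_mixture A Λ hA hΛ.trace_eq _ (prod_linkWeight_nonneg h0 h1)
    (sum_prod_linkWeight p) (netVector G) (sum_norm_netVector G) Ψ hΨ
    (Finset.univ.filter fun q => ∀ t, Correctable m fun i => ∃ j, q (L.edge (t, i) j) ≠ none)
    fun q hq b => hgood b q (Finset.mem_filter.1 hq).2
  rw [← networkState_eq_sum] at h
  refine ⟨le_trans ?_ h.1, h.2⟩
  rw [Finset.sum_filter]
  exact (L.le_labelProb_correctable (d := d) h0 h1 hr).trans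
    (le_of_eq (Finset.sum_congr rfl fun q _ => by congr))

end Fidelity

/-! ### From single networks to graph sequences -/

theorem sum_norm_extendVector {Q : Type} [DecidableEq Q] {V V₀ : Finset Q} (h : V₀ ⊆ V) {d : ℕ}
    (ψ : ({v // v ∈ V₀} → Fin d) → ℂ) :
    ∑ x, ‖extendVector h ψ x‖ ^ 2 = ∑ x, ‖ψ x‖ ^ 2 :=
  Fintype.sum_bijective (fun (x : ∀ v, OutSystem V V₀ d v) (v : {v // v ∈ V₀}) =>
      x ⟨v.1, h v.2⟩ v.2)
    ⟨fun _ _ hxy => funext fun v => funext fun hv => congrFun hxy ⟨v.1, hv⟩,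
      fun y => ⟨fun v hv => y ⟨v.1, hv⟩, rfl⟩⟩ _ _ fun _ => rfl

/-- Nestedness makes the set of admissible indices upward closed; if it is empty there is nothing to
show. -/
theorem GraphSequence.tendsto_val_atTop (S : GraphSequence) (V₀ : Finset S.Party) :
    Tendsto (fun n : {n // V₀ ⊆ S.V n} => n.1) atTop atTop := by
  rcases isEmpty_or_nonempty {n // V₀ ⊆ S.V n} with h | ⟨⟨n₀, hn₀⟩⟩
  · exact tendsto_of_isEmpty
  · refine tendsto_atTop.2 fun b => ?_
    have hmono : Monotone S.V := monotone_nat_of_le_succ S.nested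
    filter_upwards [eventually_ge_atTop
      (⟨max b n₀, hn₀.trans (hmono (le_max_right _ _))⟩ : {n // V₀ ⊆ S.V n})] with a ha
    exact (le_max_left b n₀).trans ha

/-- A graph sequence with a growing number of edge-disjoint spiders of bounded length at every
finite set of vertices has partial distillability. -/
theorem partiallyDistillable_of_spiders (S : GraphSequence) (d : ℕ) [NeZero d] (ℓ : ℕ)
    (N : ℕ → ℕ → ℕ) (hN : ∀ c, Tendsto (N c) atTop atTop)
    (hS : ∀ n (V₀ : Finset {v // v ∈ S.V n}), ∀ v₀ ∈ V₀,
      ∃ Sp : Fin (N V₀.card n) → Spider (S.graph n) v₀ (V₀.erase v₀),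
        (∀ i t, ((Sp i).leg t).length ≤ ℓ) ∧
        Pairwise fun i j => Disjoint (Sp i).edges (Sp j).edges) :
    PartiallyDistillable S d := by
  classical
  -- Above this threshold a leg of length at most `ℓ` fails with probability at most `1 / 162`.
  -- Using `ℓ + 1` keeps the denominator positive for `ℓ = 0`.
  refine ⟨1 - 1 / (162 * (ℓ + 1)), by simp; positivity, fun V₀ ψ hψ => ?_⟩
  have hΨ : ∀ n : {n // V₀ ⊆ S.V n}, ∑ x, ‖extendVector n.2 ψ x‖ ^ 2 = 1 := fun n =>
    (sum_norm_extendVector n.2 ψ).trans hψ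
  rcases V₀.eq_empty_or_nonempty with rfl | ⟨v₀, hv₀⟩
  · choose Λ hΛ hF using fun n : {n // (∅ : Finset S.Party) ⊆ S.V n} =>
      exists_isLOCC_fidelity_eq_one (G := S.graph n.1) (d := d)
        (P := fun v => v.1 ∈ (∅ : Finset S.Party)) (fun v => Finset.notMem_empty _) _ (hΨ n)
    refine ⟨fun n _ => Λ n, fun n _ => hΛ n, fun p h0 _ h1 => ?_⟩
    simp only [hF _ p h0 h1]
    exact tendsto_const_nhds
  · have key : ∀ n : {n // V₀ ⊆ S.V n},
        ∃ Λ : MultiOp (NetSystem (S.graph n) d) → MultiOp (OutSystem (S.V n) V₀ d),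
        IsLOCC Λ ∧ (N V₀.card n ≠ 0 → ∀ p : ℝ, 0 ≤ p → p ≤ 1 → ℓ * (1 - p) ≤ 1 / 162 →
          1 - V₀.card * (1 / 2) ^ (Nat.log 9 (N V₀.card n) + 1) ≤
            fidelity (Λ (networkState (S.graph n) d p)) (pureState (extendVector n.2 ψ)) ∧
          fidelity (Λ (networkState (S.graph n) d p)) (pureState (extendVector n.2 ψ)) ≤ 1) := by
      intro n
      -- Without spiders any map will do: since `N` tends to infinity, such `n` do not affect the
      -- limit.
      by_cases h0 : N V₀.card n = 0
      · obtain ⟨Λ, hΛ, -⟩ := exists_isLOCC_kraus (S.graph n) d fun v => v.1 ∈ V₀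
        exact ⟨Λ, hΛ, fun h => absurd h0 h⟩
      · have hcard : (V₀.subtype (· ∈ S.V n)).card = V₀.card := by
          rw [Finset.card_subtype, Finset.filter_true_of_mem fun v hv => n.2 hv]
        obtain ⟨Sp, hlen, hdisj⟩ := hS n (V₀.subtype (· ∈ S.V n)) ⟨v₀, n.2 hv₀⟩
          (Finset.mem_subtype.2 hv₀)
        -- The code with `m` levels needs `9 ^ m` spiders, and the largest `m` that the available
        -- ones allow is used.
        obtain ⟨e⟩ : Nonempty (CodeIndex (Nat.log 9 (N V₀.card n)) ↪
            Fin (N (V₀.subtype (· ∈ S.V n)).card n)) := by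
          rw [Function.Embedding.nonempty_iff_card_le, CodeIndex.card, Fintype.card_fin, hcard]
          exact Nat.pow_log_le_self 9 h0
        obtain ⟨Λ, hΛ, hF⟩ := exists_isLOCC_of_spiders (d := d) (Finset.mem_subtype.2 hv₀)
          (P := fun v => v.1 ∈ V₀) (fun v => Finset.mem_subtype.symm) _ (hΨ n)
          (fun i => Sp (e i)) (fun i j hij => hdisj (e.injective.ne hij)) (fun i => hlen (e i))
        rw [hcard] at hF
        exact ⟨Λ, hΛ, fun _ => hF⟩
    choose Λ hΛ hF using key
    refine ⟨fun n _ => Λ n, fun n _ => hΛ n, fun p h0 hp h1 => ?_⟩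
    have hp' : ℓ * (1 - p) ≤ 1 / 162 := by
      have h2 : 1 - p ≤ 1 / (162 * (ℓ + 1)) := by linarith
      calc ℓ * (1 - p) ≤ (ℓ + 1) * (1 / (162 * (ℓ + 1))) := by
            gcongr
            linarith
        _ = 1 / 162 := by field_simp
    have hNV := (hN V₀.card).comp (S.tendsto_val_atTop V₀)
    have hlog : Tendsto (fun n : {n // V₀ ⊆ S.V n} => Nat.log 9 (N V₀.card n) + 1) atTop atTop :=
      tendsto_atTop.2 fun b => by
        filter_upwards [hNV.eventually_ge_atTop (9 ^ b)] with n hn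
        exact (Nat.le_log_of_pow_le (by norm_num) hn).trans (Nat.le_succ _)
    have hlim : Tendsto (fun n : {n // V₀ ⊆ S.V n} =>
        1 - (V₀.card : ℝ) * (1 / 2) ^ (Nat.log 9 (N V₀.card n) + 1)) atTop (𝓝 1) := by
      have := ((tendsto_pow_atTop_nhds_zero_of_lt_one (r := (1 / 2 : ℝ)) (by norm_num)
        (by norm_num)).comp hlog).const_mul (V₀.card : ℝ)
      simpa using this.const_sub 1
    have hpos := hNV.eventually_ge_atTop 1
    refine tendsto_of_tendsto_of_tendsto_of_le_of_le' hlim tendsto_const_nhds ?_ ?_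
    · filter_upwards [hpos] with n hn
      exact (hF n (Nat.one_le_iff_ne_zero.1 hn) p h0 h1 hp').1
    · filter_upwards [hpos] with n hn
      exact (hF n (Nat.one_le_iff_ne_zero.1 hn) p h0 h1 hp').2

theorem hammingSequence_partiallyDistillable {k : ℕ} (hk : 1 ≤ k) (d : ℕ) [NeZero d] :
    PartiallyDistillable (hammingSequence k hk) d := by
  refine partiallyDistillable_of_spiders (hammingSequence k hk) d (k + 1)
    -- The graph of index `n` lives on `[n + 1]^k`. For a single party the spiders have no legs, so
    -- any number of them exists and `n` is a convenient choice.
    (fun c n => if 2 ≤ c then ((n + 1 - 1) / (c - 1) - 1) * k else n) (fun c => ?_) ?_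
  · by_cases hc : 2 ≤ c
    · simp only [hc, if_true]
      refine tendsto_atTop.2 fun b => ?_
      filter_upwards [eventually_ge_atTop ((b + 1) * (c - 1))] with n hn
      have h1 : b + 1 ≤ (n + 1 - 1) / (c - 1) := (Nat.le_div_iff_mul_le (by omega)).2 hn
      calc b ≤ (n + 1 - 1) / (c - 1) - 1 := by omega
        _ ≤ _ := Nat.le_mul_of_pos_right _ hk
    · simp only [hc, if_false]
      exact tendsto_id
  · intro n V₀ v₀ hv₀
    by_cases hc : 2 ≤ V₀.card
    · rw [if_pos hc]
      exact exists_edgeDisjoint_spiders k (n + 1) V₀ hc v₀ hv₀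
    · have he : V₀.erase v₀ = ∅ := by
        rw [← Finset.card_eq_zero, Finset.card_erase_of_mem hv₀]
        omega
      have hno : ∀ t : {t // t ∈ V₀.erase v₀}, False := fun t =>
        Finset.eq_empty_iff_forall_notMem.1 he t.1 t.2
      refine ⟨fun _ => ⟨Finset.notMem_erase _ _, fun t => (hno t).elim, fun t => (hno t).elim,
        fun t => (hno t).elim⟩, fun _ t => (hno t).elim, fun i j _ => ?_⟩
      refine Set.disjoint_left.2 ?_
      rintro e ⟨t, -⟩
      exact (hno t).elim

end

theorem theorem10 (α : ℝ) (hα₀ : 0 < α) (hα₁ : α < 1) :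
    ∃ (k : ℕ) (hk : 1 ≤ k),
      -- the maximum degree is `O(|G_n|^α)`
      ((fun n => (((hammingSequence k hk).graph n).maxDegree : ℝ)) =O[atTop]
        fun n => (((hammingSequence k hk).V n).card : ℝ) ^ α) ∧
      -- partial distillability, for every local dimension of the links
      (∀ d : ℕ, 2 ≤ d → PartiallyDistillable (hammingSequence k hk) d) ∧
      -- edge-disjoint spiders with short legs in the graph on `[n]^k`
      (∀ (n : ℕ) (V₀ : Finset {v // v ∈ hammingVertices k n}), 2 ≤ V₀.card → ∀ v₀ ∈ V₀,
        ∃ S : Fin (((n - 1) / (V₀.card - 1) - 1) * k) →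
            Spider (hammingGraph k n) v₀ (V₀.erase v₀),
          (∀ i t, ((S i).leg t).length ≤ k + 1) ∧
          Pairwise fun i j => Disjoint (S i).edges (S j).edges) := by
  -- This is the condition `1 ≤ k * α` of the degree bound, and it forces `k` to be positive.
  obtain ⟨k, hk⟩ := exists_nat_ge (1 / α)
  have hk1 : 1 ≤ k := by
    have h : 0 < 1 / α := by positivity
    have : (0 : ℝ) < k := h.trans_le hk
    exact_mod_cast this
  refine ⟨k, hk1, hammingSequence_maxDegree_isBigO hk1 ((div_le_iff₀ hα₀).1 hk), fun d hd => ?_,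
    exists_edgeDisjoint_spiders k⟩
  have : NeZero d := ⟨by omega⟩
  exact hammingSequence_partiallyDistillable hk1 d
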